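/- **Theorem 1.1 (Existence of average-field-Pauli minimizers).** For $u\in H^1(\mathbb R^2;\mathbb C)$ put $$\mathbf A[|u|^2](x)=\int_{\mathbb R^2}\frac{(x-y)^\perp}{|x-y|^2}\,|u(y)|^2\,dy=\big((\nabla^\perp\log|\cdot|)*|u|^2\big)(x),\qquad (x_1,x_2)^\perp=(-x_2,x_1),$$ and for $\beta\ge 0$ let $$g_*(\beta)=\inf\left\{\frac{\int_{\mathbb R^2}|(-\mathrm i\nabla+\beta\mathbf A[|u|^2])u|^2}{\frac12\int_{\mathbb R^2}|u|^4}\;:\;u\in H^1(\mathbb R^2;\mathbb C),\ \int_{\mathbb R^2}|u|^2=1\right\}.$$ Let $V\in L^\infty_{\rm loc}(\mathbb R^2;\mathbb R)$ with $V(x)\to+\infty$ as $|x|\to\infty$, and for $g\in\mathbb R$ let $$\mathcal E_{\beta,g}[u]=\int_{\mathbb R^2}\Big[|(-\mathrm i\nabla+\beta\mathbf A[|u|^2])u|^2+V|u|^2-\frac g2|u|^4\Big],$$ $$E_{\beta,g}=\inf\Big\{\mathcal E_{\beta,g}[u]\;:\;u\in H^1(\mathbb R^2;\mathbb C),\ \int_{\mathbb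 R^2} V|u|^2<\infty,\ \int_{\mathbb R^2}|u|^2=1\Big\}.$$ Suppose that $\beta\ge 0$ and $g<g_*(\beta)$, or that $\beta>0$ and $g=g_*(0)$. Then $E_{\beta,g}$ is finite and is attained: there is $u\in H^1(\mathbb R^2;\mathbb C)$ with $\int V|u|^2<\infty$ and $\int|u|^2=1$ such that $\mathcal E_{\beta,g}[u]=E_{\beta,g}$. In particular, for $\beta>0$ minimizers exist for all $g_*(0)\le g<g_*(\beta)$. -/

import Mathlib

open MeasureTheory Filter
open scoped ContDiff

noncomputable section

namespace AfP

/-- The Euclidean plane `ℝ²`. -/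
abbrev Plane : Type := EuclideanSpace ℝ (Fin 2)

/-- The `i`-th partial derivative of a differentiable real function on the plane. -/
def partialDeriv (i : Fin 2) (f : Plane → ℝ) (x : Plane) : ℝ :=
  fderiv ℝ f x (EuclideanSpace.single i 1)

/-- `G = (G 0, G 1)` is square integrable and is the weak gradient of `u`:
`∫ u ∂ᵢφ = - ∫ (G i) φ` for every test function `φ ∈ C_c^∞(ℝ²)`. -/
def IsWeakGradient (u : Plane → ℂ) (G : Fin 2 → Plane → ℂ) : Prop :=
  ∀ i : Fin 2, MemLp (G i) 2 volume ∧
    ∀ φ : Plane → ℝ, ContDiff ℝ ∞ φ → HasCompactSupport φ →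
      ∫ x, partialDeriv i φ x • u x = - ∫ x, φ x • G i x

/-- Membership in the Sobolev space `H¹(ℝ²; ℂ)`. -/
def MemH1 (u : Plane → ℂ) : Prop :=
  MemLp u 2 volume ∧ ∃ G : Fin 2 → Plane → ℂ, IsWeakGradient u G

/-- A square-integrable weak gradient is unique up to null sets, so that the choice made in
`weakGradient` is immaterial inside integrals. -/
theorem IsWeakGradient.ae_eq {u : Plane → ℂ} {G H : Fin 2 → Plane → ℂ}
    (hG : IsWeakGradient u G) (hH : IsWeakGradient u H) (i : Fin 2) :
    G i =ᵐ[volume] H i := by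
  refine ae_eq_of_integral_contDiff_smul_eq
    ((hG i).1.locallyIntegrable (by norm_num)) ((hH i).1.locallyIntegrable (by norm_num)) ?_
  intro φ hφ hc
  have h1 := (hG i).2 φ hφ hc
  have h2 := (hH i).2 φ hφ hc
  exact neg_injective (h1.symm.trans h2)

open Classical in
/-- The weak gradient of `u ∈ H¹(ℝ²; ℂ)` (and `0` for other functions). -/
def weakGradient (u : Plane → ℂ) : Fin 2 → Plane → ℂ :=
  if h : ∃ G : Fin 2 → Plane → ℂ, IsWeakGradient u G then h.choose else 0

/-- The logarithmic potential `w₀(x) = log |x|`. -/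
def w₀ (x : Plane) : ℝ := Real.log ‖x‖

/-- The skew gradient `∇^⊥ f = (-∂₂ f, ∂₁ f)`. -/
def gradPerp (f : Plane → ℝ) (x : Plane) : Plane :=
  !₂[-partialDeriv 1 f x, partialDeriv 0 f x]

/-- The vector potential `𝐀[ρ] = (∇^⊥ w₀) * ρ`. -/
def vecPot (ρ : Plane → ℝ) (x : Plane) : Plane :=
  ∫ y, ρ y • gradPerp w₀ (x - y)

/-- The density `|(-i∇ + β 𝐀[|u|²]) u|²`. -/
def kineticDensity (β : ℝ) (u : Plane → ℂ) (x : Plane) : ℝ :=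
  ∑ i : Fin 2, ‖-Complex.I * weakGradient u i x
    + ((β * vecPot (fun y => ‖u y‖ ^ 2) x i : ℝ) : ℂ) * u x‖ ^ 2

/-- The average-field-Pauli functional. -/
def energy (V : Plane → ℝ) (β g : ℝ) (u : Plane → ℂ) : ℝ :=
  ∫ x, (kineticDensity β u x + V x * ‖u x‖ ^ 2 - g / 2 * ‖u x‖ ^ 4)

/-- The critical coupling `g_*(β)`. -/
def gStar (β : ℝ) : ℝ :=
  sInf {q : ℝ | ∃ u : Plane → ℂ, MemH1 u ∧ ∫ x, ‖u x‖ ^ 2 = 1 ∧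
    q = (∫ x, kineticDensity β u x) / (1 / 2 * ∫ x, ‖u x‖ ^ 4)}

/-- `u ∈ L²_V`, i.e. `u ∈ L²` and `∫ V |u|² < ∞`; as `V` is bounded below in our use, the latter
means that `V |u|²` is integrable. -/
def MemL2V (V : Plane → ℝ) (u : Plane → ℂ) : Prop :=
  MemLp u 2 volume ∧ Integrable (fun x => V x * ‖u x‖ ^ 2) volume

/-- The admissible functions: `u ∈ H¹ ∩ L²_V` with `∫ |u|² = 1`. -/
def Admissible (V : Plane → ℝ) (u : Plane → ℂ) : Prop :=
  MemH1 u ∧ MemL2V V u ∧ ∫ x, ‖u x‖ ^ 2 = 1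

/-- The ground state energy, as an infimum in `[-∞, ∞]`. -/
def groundEnergy (V : Plane → ℝ) (β g : ℝ) : EReal :=
  ⨅ (u : Plane → ℂ) (_ : Admissible V u), (energy V β g u : EReal)

end AfP

end

/-! The proof is the direct method. When `g < gStar β`, the definition of `gStar` gives coercivity:
for normalized `u`, a fixed positive fraction of the magnetic kinetic energy survives after
subtracting `g / 2 * ∫ |u|⁴` (`exists_coercive`). The borderline case `g = gStar 0`, `β > 0` is an
instance of this, because `gStar 0 < gStar β` (`gStar_zero_lt`).

Strict inequality. Let `D₀, D₁` be the components of the magnetic gradient. Since `curl 𝐀[ρ] = 2πρ`,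
the integral of `Im (D̄₀ D₁)` equals `-πβ ∫ |u|⁴` (`IsTest.integral_imForm_magGrad`). Completing
squares gives, pointwise and for `λ² ≤ 1`, `|D|² ≥ (1 - λ²) |∇|u||² - 2λ Im (D̄₀ D₁)`
(`magnetic_lower_bound`). Integrating, and using `gStar 0` on a regularized modulus, yields `gStar β
≥ (1 - λ²) gStar 0 + 4πβλ`, which exceeds `gStar 0` for small `λ > 0`.

Compactness. The gradient of `|u|²` is bounded by `2|u|` times the magnetic gradient, whatever the
potential, so Sobolev inequalities for `|u|²` bound `u` in `L⁴` and `L⁸` by the magnetic energy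
alone (`exists_sobolev_H1`). Mass and the `L⁸` bound control `𝐀[|u|²]` uniformly, hence also the
ordinary gradient (`exists_H1_bounds`). Since `V → ∞`, minimizing sequences are tight, and a
subsequence converges strongly in `L²` with weakly convergent gradients (`exists_strong_subseq`).
Then `∫ |u|⁴` converges, the potentials converge uniformly, the magnetic gradients converge weakly,
and the kinetic and potential energies are lower semicontinuous.

Inequalities in `H¹` are proved for test functions and extended by density;
`IsWeakGradient.exists_isTest_seq_energy` supplies the continuity. -/

namespace AfP

open scoped Topology ENNReal NNReal Convolution ComplexConjugate

/-! ### Mollification in `L²` -/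

theorem eLpNorm_two_sq {α : Type*} [MeasurableSpace α] {E : Type*} [NormedAddCommGroup E]
    (f : α → E) (μ : Measure α) :
    eLpNorm f 2 μ ^ 2 = ∫⁻ x, ‖f x‖ₑ ^ 2 ∂μ := by
  have := eLpNorm_nnreal_pow_eq_lintegral (μ := μ) (f := f) (p := 2) (by norm_num)
  simpa using this

section Mollify

variable {α : Type*} [MeasurableSpace α] {μ : Measure α}
  {E : Type*} [NormedAddCommGroup E] [NormedSpace ℝ E]

theorem lintegral_mul_sq_le {f g : α → ℝ≥0∞} (hf : AEMeasurable f μ) (hg : AEMeasurable g μ) :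
    (∫⁻ x, f x * g x ∂μ) ^ 2 ≤ (∫⁻ x, f x ^ 2 ∂μ) * ∫⁻ x, g x ^ 2 ∂μ := by
  have h := ENNReal.lintegral_mul_le_Lp_mul_Lq μ Real.HolderConjugate.two_two hf hg
  have h2 := pow_le_pow_left' h 2
  refine h2.trans (le_of_eq ?_)
  rw [mul_pow, ← ENNReal.rpow_natCast, ← ENNReal.rpow_mul, ← ENNReal.rpow_natCast,
    ← ENNReal.rpow_mul]
  norm_num

/-- Cauchy–Schwarz for the measure `|φ| dμ`, with one square root of `|φ|` in each factor. When `φ`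
has mass one this is Jensen's inequality. -/
theorem enorm_integral_smul_sq_le {φ : α → ℝ} {h : α → E} (hφ : AEMeasurable φ μ)
    (hh : AEStronglyMeasurable h μ) :
    ‖∫ t, φ t • h t ∂μ‖ₑ ^ 2 ≤ (∫⁻ t, ‖φ t‖ₑ ∂μ) * ∫⁻ t, ‖φ t‖ₑ * ‖h t‖ₑ ^ 2 ∂μ := by
  have h1 : ‖∫ t, φ t • h t ∂μ‖ₑ ≤ ∫⁻ t, ‖φ t‖ₑ ^ (1 / 2 : ℝ) * (‖φ t‖ₑ ^ (1 / 2 : ℝ) * ‖h t‖ₑ) ∂μ := by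
    refine (enorm_integral_le_lintegral_enorm _).trans (le_of_eq ?_)
    refine lintegral_congr fun t => ?_
    rw [enorm_smul, ← mul_assoc, ← ENNReal.rpow_add_of_nonneg _ _ (by norm_num) (by norm_num)]
    norm_num
  refine (pow_le_pow_left' h1 2).trans ((lintegral_mul_sq_le ?_ ?_).trans (le_of_eq ?_))
  · fun_prop
  · exact (by fun_prop : AEMeasurable (fun t => ‖φ t‖ₑ ^ (1 / 2 : ℝ)) μ).mul hh.enorm
  · have key : ∀ t, (‖φ t‖ₑ ^ (1 / 2 : ℝ)) ^ 2 = ‖φ t‖ₑ := fun t => by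
      rw [← ENNReal.rpow_natCast, ← ENNReal.rpow_mul]; norm_num
    simp only [mul_pow, key]

end Mollify

/-- The mollification error is a `φ`-average of translation errors; Jensen and Tonelli transfer the
bound. It serves both for a fixed `f` and, in the compactness argument, uniformly along an
`H¹`-bounded sequence. -/
theorem lintegral_convolution_sub_sq_le {φ : Plane → ℝ} {f : Plane → ℂ} {B : ℝ≥0∞}
    (hφ : Continuous φ) (hφc : HasCompactSupport φ) (hφ0 : ∀ x, 0 ≤ φ x)
    (hφ1 : ∫ x, φ x = 1) (hf : LocallyIntegrable f volume)
    (hB : ∀ t ∈ Function.support φ, ∫⁻ x, ‖f (x - t) - f x‖ₑ ^ 2 ≤ B) :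
    ∫⁻ x, ‖(φ ⋆[ContinuousLinearMap.lsmul ℝ ℝ, volume] f) x - f x‖ₑ ^ 2 ≤ B := by
  have hφi : Integrable φ := hφ.integrable_of_hasCompactSupport hφc
  have hmass : ∫⁻ t, ‖φ t‖ₑ = 1 := by
    have h1 := ofReal_integral_eq_lintegral_ofReal hφi (Eventually.of_forall hφ0)
    rw [hφ1, ENNReal.ofReal_one] at h1
    rw [h1]
    exact lintegral_congr fun t => Real.enorm_of_nonneg (hφ0 t)
  have hm : AEStronglyMeasurable (fun p : Plane × Plane => f (p.1 - p.2) - f p.1)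
      (volume.prod volume) := by
    refine AEStronglyMeasurable.sub ?_ ?_
    · exact hf.aestronglyMeasurable.comp_quasiMeasurePreserving
        (quasiMeasurePreserving_sub volume volume)
    · exact hf.aestronglyMeasurable.comp_fst
  have hm1 : ∀ x, AEStronglyMeasurable (fun t => f (x - t) - f x) volume := fun x =>
    (hf.aestronglyMeasurable.comp_quasiMeasurePreserving
      (quasiMeasurePreserving_sub_left volume x)).sub aestronglyMeasurable_const
  calc ∫⁻ x, ‖(φ ⋆[ContinuousLinearMap.lsmul ℝ ℝ, volume] f) x - f x‖ₑ ^ 2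
      ≤ ∫⁻ x, ∫⁻ t, ‖φ t‖ₑ * ‖f (x - t) - f x‖ₑ ^ 2 := by
        refine lintegral_mono fun x => ?_
        have hc : Integrable (fun t => φ t • f (x - t)) := 
          (hφc.convolutionExists_left (ContinuousLinearMap.lsmul ℝ ℝ) hφ hf x)
        have : (φ ⋆[ContinuousLinearMap.lsmul ℝ ℝ, volume] f) x - f x
            = ∫ t, φ t • (f (x - t) - f x) := by
          simp only [smul_sub]
          rw [integral_sub hc (hφi.smul_const _), integral_smul_const, hφ1, one_smul]
          rfl
        rw [this]
        refine (enorm_integral_smul_sq_le hφ.aemeasurable (hm1 x)).trans ?_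
        rw [hmass, one_mul]
    _ = ∫⁻ t, ∫⁻ x, ‖φ t‖ₑ * ‖f (x - t) - f x‖ₑ ^ 2 := by
        refine lintegral_lintegral_swap ?_
        refine AEMeasurable.mul ?_ (hm.enorm.pow_const 2)
        exact (hφ.comp continuous_snd).enorm.aemeasurable
    _ ≤ ∫⁻ t, ‖φ t‖ₑ * B := by
        refine lintegral_mono fun t => ?_
        rw [lintegral_const_mul' _ _ enorm_ne_top]
        by_cases ht : φ t = 0
        · simp [ht]
        · gcongr
          exact hB t ht
    _ = B := by
        rw [lintegral_mul_const'' _ (by fun_prop), hmass, one_mul]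

/-- Translations form a continuous family of measure-preserving maps, and composition of an `L²`
class with such a family is continuous. -/
theorem tendsto_eLpNorm_translate_sub {f : Plane → ℂ} (hf : MemLp f 2 volume) :
    Tendsto (fun t : Plane => eLpNorm (fun x => f (x - t) - f x) 2 volume) (𝓝 0) (𝓝 0) := by
  have : Fact ((1 : ℝ≥0∞) ≤ 2) := ⟨by norm_num⟩
  let g : Plane → C(Plane, Plane) := fun t => ⟨fun x => x - t, by fun_prop⟩
  have hg : Continuous g := ContinuousMap.continuous_of_continuous_uncurry _ (by
    change Continuous fun p : Plane × Plane => p.2 - p.1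
    fun_prop)
  have hgm : ∀ t, MeasurePreserving (g t) (volume : Measure Plane) volume := fun t =>
    measurePreserving_sub_right volume t
  have h := ((continuous_const (y := hf.toLp f)).compMeasurePreservingLp hg hgm
    (by norm_num)).tendsto 0
  rw [tendsto_iff_edist_tendsto_0] at h
  refine h.congr fun t => ?_
  rw [Lp.toLp_compMeasurePreserving, Lp.toLp_compMeasurePreserving, Lp.edist_toLp_toLp]
  congr 1
  ext x
  simp [g]

/-! ### Test functions and weak gradients -/

/-- The `i`-th partial derivative of a differentiable complex function on the plane. -/
noncomputable def pd (i : Fin 2) (v : Plane → ℂ) (x : Plane) : ℂ :=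
  fderiv ℝ v x (EuclideanSpace.single i 1)

/-- Complex test functions: smooth with compact support. -/
structure IsTest (v : Plane → ℂ) : Prop where
  contDiff : ContDiff ℝ ∞ v
  hasCompactSupport : HasCompactSupport v

theorem IsTest.differentiable {v : Plane → ℂ} (hv : IsTest v) : Differentiable ℝ v :=
  hv.contDiff.differentiable (by simp)

theorem IsTest.continuous {v : Plane → ℂ} (hv : IsTest v) : Continuous v :=
  hv.contDiff.continuous

theorem IsTest.continuous_fderiv {v : Plane → ℂ} (hv : IsTest v) : Continuous (fderiv ℝ v) :=
  hv.contDiff.continuous_fderiv (by simp)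

theorem IsTest.isTest_pd {v : Plane → ℂ} (hv : IsTest v) (i : Fin 2) : IsTest (pd i v) := by
  refine ⟨?_, ?_⟩
  · exact (hv.contDiff.fderiv_right (m := ∞) (by simp)).clm_apply contDiff_const
  · exact hv.hasCompactSupport.fderiv_apply ℝ (EuclideanSpace.single i 1)

theorem IsTest.memLp {v : Plane → ℂ} (hv : IsTest v) (p : ℝ≥0∞) : MemLp v p volume :=
  hv.continuous.memLp_of_hasCompactSupport hv.hasCompactSupport

theorem IsTest.isWeakGradient {v : Plane → ℂ} (hv : IsTest v) :
    IsWeakGradient v (fun i => pd i v) := by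
  intro i
  refine ⟨(hv.isTest_pd i).memLp 2, fun φ hφ hc => ?_⟩
  have hφ1 : Continuous (fun x => fderiv ℝ φ x (EuclideanSpace.single i 1)) :=
    (hφ.continuous_fderiv (by simp)).clm_apply continuous_const
  have h := integral_smul_fderiv_eq_neg_fderiv_smul_of_integrable (μ := (volume : Measure Plane))
    (f := φ) (g := v) (v := EuclideanSpace.single i 1) ?_ ?_ ?_
    (fun x _ => (hφ.differentiable (by simp)).differentiableAt)
    (fun x _ => hv.differentiable.differentiableAt)
  · unfold partialDeriv pd
    rw [h, neg_neg]
  · exact (hφ1.smul hv.continuous).integrable_of_hasCompactSupport hv.hasCompactSupport.smul_left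
  · exact (hφ.continuous.smul (hv.isTest_pd i).continuous).integrable_of_hasCompactSupport
      (hv.isTest_pd i).hasCompactSupport.smul_left
  · exact (hφ.continuous.smul hv.continuous).integrable_of_hasCompactSupport
      hv.hasCompactSupport.smul_left

theorem MemH1.isWeakGradient {u : Plane → ℂ} (hu : MemH1 u) :
    IsWeakGradient u (weakGradient u) := by
  have h := hu.2
  unfold weakGradient
  rw [dif_pos h]
  exact h.choose_spec

theorem IsWeakGradient.weakGradient_ae_eq {u : Plane → ℂ} {G : Fin 2 → Plane → ℂ}
    (hG : IsWeakGradient u G) (i : Fin 2) : weakGradient u i =ᵐ[volume] G i := by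
  have h : ∃ G : Fin 2 → Plane → ℂ, IsWeakGradient u G := ⟨G, hG⟩
  have h' : IsWeakGradient u (weakGradient u) := by
    unfold weakGradient
    rw [dif_pos h]
    exact h.choose_spec
  exact h'.ae_eq hG i

theorem IsTest.memH1 {v : Plane → ℂ} (hv : IsTest v) : MemH1 v :=
  ⟨hv.memLp 2, _, hv.isWeakGradient⟩

/-! ### Density of test functions in `H¹` -/

theorem integrable_smul_of_memLp {φ : Plane → ℝ} {u : Plane → ℂ} (hφ : Continuous φ)
    (hc : HasCompactSupport φ) (hu : MemLp u 2 volume) : Integrable (fun x => φ x • u x) :=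
  (hu.locallyIntegrable (by norm_num)).integrable_smul_left_of_hasCompactSupport hφ hc

/-- Testing the weak gradient of `u` with `φ χ` moves the product rule onto smooth functions. -/
theorem IsWeakGradient.cutoff {u : Plane → ℂ} {G : Fin 2 → Plane → ℂ} (hu : MemLp u 2 volume)
    (hG : IsWeakGradient u G) {χ : Plane → ℝ} (hχ : ContDiff ℝ ∞ χ) (hχc : HasCompactSupport χ) :
    IsWeakGradient (fun x => χ x • u x) (fun i x => χ x • G i x + partialDeriv i χ x • u x) := by
  intro i
  have hχ' : Continuous (partialDeriv i χ) :=
    (hχ.continuous_fderiv (by simp)).clm_apply continuous_const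
  have hχ'c : HasCompactSupport (partialDeriv i χ) :=
    hχc.fderiv_apply ℝ (EuclideanSpace.single i 1)
  have hb : MemLp χ ⊤ volume := hχ.continuous.memLp_of_hasCompactSupport hχc
  have hb' : MemLp (partialDeriv i χ) ⊤ volume := hχ'.memLp_of_hasCompactSupport hχ'c
  refine ⟨((hG i).1.smul hb).add (hu.smul hb'), fun φ hφ hc => ?_⟩
  have h := (hG i).2 (fun x => φ x * χ x) (hφ.mul hχ) hc.mul_right
  have hφ' : Continuous (partialDeriv i φ) :=
    (hφ.continuous_fderiv (by simp)).clm_apply continuous_const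
  have hd : ∀ x, partialDeriv i (fun x => φ x * χ x) x
      = partialDeriv i φ x * χ x + φ x * partialDeriv i χ x := by
    intro x
    unfold partialDeriv
    rw [fderiv_fun_mul (hφ.differentiable (by simp)).differentiableAt
      (hχ.differentiable (by simp)).differentiableAt]
    simp
    ring
  have e1 : ∀ x, partialDeriv i (fun x => φ x * χ x) x • u x
      = partialDeriv i φ x • χ x • u x + φ x • partialDeriv i χ x • u x := by
    intro x; rw [hd, add_smul, mul_smul, mul_smul]
  have i1 : Integrable fun x => partialDeriv i φ x • χ x • u x := by
    have := integrable_smul_of_memLp (φ := fun x => partialDeriv i φ x * χ x)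
      (hφ'.mul hχ.continuous) hχc.mul_left hu
    simpa only [mul_smul] using this
  have i2 : Integrable fun x => φ x • partialDeriv i χ x • u x := by
    have := integrable_smul_of_memLp (φ := fun x => φ x * partialDeriv i χ x)
      (hφ.continuous.mul hχ') hχ'c.mul_left hu
    simpa only [mul_smul] using this
  have i3 : Integrable fun x => φ x • χ x • G i x := by
    have := integrable_smul_of_memLp (φ := fun x => φ x * χ x)
      (hφ.continuous.mul hχ.continuous) hχc.mul_left (hG i).1
    simpa only [mul_smul] using this
  simp only [e1, smul_add] at h ⊢
  rw [integral_add i1 i2] at h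
  rw [integral_add i3 i2]
  simp only [mul_smul] at h
  rw [neg_add, ← h]
  ring

/-- The derivative falls on `φ`; the weak gradient tested with `y ↦ φ (x - y)` then moves it to `u`.
The sign from reflecting `φ` cancels the one in the definition. -/
theorem IsWeakGradient.pd_convolution {u : Plane → ℂ} {G : Fin 2 → Plane → ℂ}
    (hu : MemLp u 2 volume) (hG : IsWeakGradient u G) {φ : Plane → ℝ} (hφ : ContDiff ℝ ∞ φ)
    (hc : HasCompactSupport φ) (i : Fin 2) (x : Plane) :
    pd i (φ ⋆[ContinuousLinearMap.lsmul ℝ ℝ, volume] u) x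
      = (φ ⋆[ContinuousLinearMap.lsmul ℝ ℝ, volume] G i) x := by
  have hul := hu.locallyIntegrable (by norm_num)
  have h1 := hc.hasFDerivAt_convolution_left (ContinuousLinearMap.lsmul ℝ ℝ)
    (hφ.of_le (by simp)) hul x
  have hφ' : Continuous (fderiv ℝ φ) := hφ.continuous_fderiv (by simp)
  unfold pd
  rw [h1.fderiv]
  have h2 : Integrable (fun t => ((ContinuousLinearMap.lsmul ℝ ℝ).precompL Plane)
      (fderiv ℝ φ t) (u (x - t))) :=
    (hc.fderiv ℝ).convolutionExists_left _ hφ' hul x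
  have h3 : (fderiv ℝ φ ⋆[(ContinuousLinearMap.lsmul ℝ ℝ).precompL Plane, volume] u) x
      (EuclideanSpace.single i 1) = ∫ t, partialDeriv i φ t • u (x - t) := by
    unfold convolution
    rw [ContinuousLinearMap.integral_apply h2]
    rfl
  rw [h3]
  have hψ : ContDiff ℝ ∞ (fun y => φ (x - y)) := hφ.comp (contDiff_const.sub contDiff_id)
  have hψc : HasCompactSupport (fun y => φ (x - y)) :=
    hc.comp_homeomorph (Homeomorph.subLeft x)
  have h4 := (hG i).2 _ hψ hψc
  have h5 : ∀ y, partialDeriv i (fun y => φ (x - y)) y = - partialDeriv i φ (x - y) := by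
    intro y
    unfold partialDeriv
    have : HasFDerivAt (fun y => φ (x - y)) ((fderiv ℝ φ (x - y)).comp
        (-(ContinuousLinearMap.id ℝ Plane))) y :=
      ((hφ.differentiable (by simp)) (x - y)).hasFDerivAt.comp y ((hasFDerivAt_id y).const_sub x)
    rw [this.fderiv]
    simp
  simp only [h5, neg_smul, integral_neg, neg_inj] at h4
  have h6 : ∫ t, partialDeriv i φ t • u (x - t) = ∫ y, partialDeriv i φ (x - y) • u y := by
    rw [← integral_sub_left_eq_self _ volume x]
    simp
  rw [h6, h4]
  unfold convolution
  rw [← integral_sub_left_eq_self _ volume x]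
  simp

theorem exists_mollify_eLpNorm_sub_le {f : Plane → ℂ} (hf : MemLp f 2 volume) {ε : ℝ≥0∞}
    (hε : 0 < ε) : ∃ δ > 0, ∀ φ : ContDiffBump (0 : Plane), φ.rOut ≤ δ →
      eLpNorm (fun x => (φ.normed volume ⋆[ContinuousLinearMap.lsmul ℝ ℝ, volume] f) x - f x)
        2 volume ≤ ε := by
  have h := (tendsto_eLpNorm_translate_sub hf).eventually_le_const hε
  obtain ⟨δ, hδ, hball⟩ := Metric.eventually_nhds_iff_ball.1 h
  refine ⟨δ, hδ, fun φ hφ => ?_⟩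
  rw [← ENNReal.pow_le_pow_left_iff (n := 2) (by norm_num), eLpNorm_two_sq]
  refine lintegral_convolution_sub_sq_le φ.continuous_normed φ.hasCompactSupport_normed
    φ.nonneg_normed φ.integral_normed (hf.locallyIntegrable (by norm_num)) fun t ht => ?_
  rw [← eLpNorm_two_sq]
  rw [φ.support_normed_eq] at ht
  gcongr
  exact hball t (Metric.ball_subset_ball hφ ht)

theorem tendsto_eLpNorm_two_of_dominated {E : Type*} [NormedAddCommGroup E]
    {F : ℕ → Plane → E} {g : Plane → ℂ} (hF : ∀ n, AEStronglyMeasurable (F n) volume)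
    (hg : MemLp g 2 volume) (hle : ∀ n, ∀ᵐ x, ‖F n x‖ ≤ ‖g x‖)
    (hlim : ∀ᵐ x, Tendsto (fun n => F n x) atTop (𝓝 0)) :
    Tendsto (fun n => eLpNorm (F n) 2 volume) atTop (𝓝 0) := by
  have h : Tendsto (fun n => ∫⁻ x, ‖F n x‖ₑ ^ 2) atTop (𝓝 (∫⁻ _ : Plane, 0)) := by
    refine tendsto_lintegral_of_dominated_convergence' (fun x => ‖g x‖ₑ ^ 2)
      (fun n => (hF n).enorm.pow_const 2) (fun n => ?_) ?_ ?_
    · filter_upwards [hle n] with x hx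
      gcongr
      exact enorm_le_iff_norm_le.2 hx
    · rw [← eLpNorm_two_sq]
      exact (ENNReal.pow_lt_top hg.2).ne
    · filter_upwards [hlim] with x hx
      have := ENNReal.Tendsto.pow (n := 2) hx.enorm
      simpa using this
  rw [lintegral_zero] at h
  have h2 := h.ennrpow_const (1 / 2 : ℝ)
  rw [ENNReal.zero_rpow_of_pos (by norm_num)] at h2
  refine h2.congr fun n => ?_
  rw [← eLpNorm_two_sq, ← ENNReal.rpow_natCast, ← ENNReal.rpow_mul]
  norm_num

/-- Smooth cutoff functions exhausting the plane, with gradients of size `O(1/n)`. -/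
theorem exists_cutoff_seq : ∃ (χ : ℕ → Plane → ℝ) (C : ℝ), (∀ n, ContDiff ℝ ∞ (χ n)) ∧
    (∀ n, HasCompactSupport (χ n)) ∧ (∀ n x, 0 ≤ χ n x ∧ χ n x ≤ 1) ∧
    (∀ x, Tendsto (fun n => χ n x) atTop (𝓝 1)) ∧
    (∀ n i x, ‖partialDeriv i (χ n) x‖ ≤ C * ((n : ℝ) + 1)⁻¹) := by
  let b : ContDiffBump (0 : Plane) := ⟨1, 2, one_pos, one_lt_two⟩
  have hb : ContDiff ℝ ∞ b := b.contDiff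
  obtain ⟨C, hC⟩ := (b.hasCompactSupport.fderiv ℝ).exists_bound_of_continuous
    (hb.continuous_fderiv (by simp))
  -- Dilations of a single bump; the chain rule yields the factor `(n + 1)⁻¹` in the gradient.
  refine ⟨fun n x => b (((n : ℝ) + 1)⁻¹ • x), C, fun n => ?_, fun n => ?_, fun n x =>
    ⟨b.nonneg, b.le_one⟩, fun x => ?_, fun n i x => ?_⟩
  · exact hb.comp (contDiff_const_smul _)
  · exact b.hasCompactSupport.comp_smul (by positivity)
  · have h1 : Tendsto (fun n : ℕ => ((n : ℝ) + 1)⁻¹ • x) atTop (𝓝 0) := by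
      have := (tendsto_one_div_add_atTop_nhds_zero_nat (𝕜 := ℝ)).smul_const x
      simpa using this
    have h2 := (b.continuous.tendsto 0).comp h1
    have h3 : b 0 = 1 := b.one_of_mem_closedBall (by simp [b])
    rw [h3] at h2
    exact h2
  · unfold partialDeriv
    have hd : HasFDerivAt (fun x => b (((n : ℝ) + 1)⁻¹ • x))
        ((fderiv ℝ b (((n : ℝ) + 1)⁻¹ • x)).comp
          (((n : ℝ) + 1)⁻¹ • ContinuousLinearMap.id ℝ Plane)) x :=
      ((hb.differentiable (by simp)) _).hasFDerivAt.comp x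
        ((hasFDerivAt_id x).const_smul (((n : ℝ) + 1)⁻¹))
    rw [hd.fderiv]
    have h1 : ((fderiv ℝ b (((n : ℝ) + 1)⁻¹ • x)).comp
          (((n : ℝ) + 1)⁻¹ • ContinuousLinearMap.id ℝ Plane)) (EuclideanSpace.single i 1)
        = ((n : ℝ) + 1)⁻¹ * (fderiv ℝ b (((n : ℝ) + 1)⁻¹ • x)) (EuclideanSpace.single i 1) := by
      simp
    rw [h1, norm_mul, norm_inv, Real.norm_of_nonneg (by positivity : (0:ℝ) ≤ (n:ℝ)+1), mul_comm]
    gcongr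
    refine ((fderiv ℝ b _).le_opNorm _).trans ?_
    simpa using hC _

/-- The term `∂ᵢχₙ u` created by the cutoff tends to zero in `L²` because `∂ᵢχₙ = O(1/n)` uniformly.
-/
theorem IsWeakGradient.exists_compactSupport_approx {u : Plane → ℂ} {G : Fin 2 → Plane → ℂ}
    (hu : MemLp u 2 volume) (hG : IsWeakGradient u G) {ε : ℝ≥0∞} (hε : 0 < ε) :
    ∃ (w : Plane → ℂ) (H : Fin 2 → Plane → ℂ), MemLp w 2 volume ∧ HasCompactSupport w ∧
      IsWeakGradient w H ∧ eLpNorm (fun x => w x - u x) 2 volume ≤ ε ∧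
      ∀ i, eLpNorm (fun x => H i x - G i x) 2 volume ≤ ε := by
  obtain ⟨χ, C, hχ, hχc, hχb, hχl, hχd⟩ := exists_cutoff_seq
  have hd1 : ∀ f : Plane → ℂ, MemLp f 2 volume →
      Tendsto (fun n => eLpNorm (fun x => χ n x • f x - f x) 2 volume) atTop (𝓝 0) := by
    intro f hf
    refine tendsto_eLpNorm_two_of_dominated (g := f) (fun n => ?_) hf (fun n => ?_) ?_
    · exact ((hχ n).continuous.aestronglyMeasurable.smul hf.1).sub hf.1
    · refine Eventually.of_forall fun x => ?_
      have : χ n x • f x - f x = (χ n x - 1) • f x := by rw [sub_smul, one_smul]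
      rw [this, norm_smul]
      have h1 : ‖χ n x - 1‖ ≤ 1 := by
        rw [Real.norm_eq_abs, abs_le]
        constructor <;> linarith [(hχb n x).1, (hχb n x).2]
      nlinarith [norm_nonneg (f x)]
    · refine Eventually.of_forall fun x => ?_
      have := ((hχl x).smul_const (f x)).sub_const (f x)
      simpa using this
  have hd2 : ∀ i, Tendsto (fun n => eLpNorm (fun x => partialDeriv i (χ n) x • u x) 2 volume)
      atTop (𝓝 0) := by
    intro i
    have hlim : Tendsto (fun n : ℕ => ENNReal.ofReal (C * ((n : ℝ) + 1)⁻¹) * eLpNorm u 2 volume)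
        atTop (𝓝 0) := by
      have h1 : Tendsto (fun n : ℕ => C * ((n : ℝ) + 1)⁻¹) atTop (𝓝 0) := by
        have := (tendsto_one_div_add_atTop_nhds_zero_nat (𝕜 := ℝ)).const_mul C
        simpa using this
      have h2 := ENNReal.tendsto_ofReal h1
      have h3 := ENNReal.Tendsto.mul_const h2 (Or.inr hu.2.ne)
      simpa using h3
    refine tendsto_of_tendsto_of_tendsto_of_le_of_le tendsto_const_nhds hlim
      (fun n => zero_le) fun n => ?_
    refine eLpNorm_le_mul_eLpNorm_of_ae_le_mul (Eventually.of_forall fun x => ?_) 2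
    rw [norm_smul]
    gcongr
    exact hχd n i x
  have hε2 : 0 < ε / 2 := ENNReal.half_pos hε.ne'
  have hev : ∀ᶠ n in atTop, eLpNorm (fun x => χ n x • u x - u x) 2 volume ≤ ε / 2 ∧
      ∀ i, eLpNorm (fun x => χ n x • G i x - G i x) 2 volume ≤ ε / 2 ∧
        eLpNorm (fun x => partialDeriv i (χ n) x • u x) 2 volume ≤ ε / 2 := by
    refine ((hd1 u hu).eventually_le_const hε2).and ?_
    rw [eventually_all]
    exact fun i => ((hd1 _ (hG i).1).eventually_le_const hε2).and
      ((hd2 i).eventually_le_const hε2)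
  obtain ⟨n, hn1, hn2⟩ := hev.exists
  have hcut := hG.cutoff hu (hχ n) (hχc n)
  have hb : MemLp (χ n) ⊤ volume := (hχ n).continuous.memLp_of_hasCompactSupport (hχc n)
  refine ⟨_, _, hu.smul hb, (hχc n).smul_right, hcut,
    hn1.trans ENNReal.half_le_self, fun i => ?_⟩
  have hdc : Continuous (partialDeriv i (χ n)) :=
    ((hχ n).continuous_fderiv (by simp)).clm_apply continuous_const
  have e : (fun x => χ n x • G i x + partialDeriv i (χ n) x • u x - G i x)
      = (fun x => χ n x • G i x - G i x) + fun x => partialDeriv i (χ n) x • u x := by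
    ext x; simp; ring
  rw [e]
  refine (eLpNorm_add_le ?_ ?_ (by norm_num)).trans
    ((add_le_add (hn2 i).1 (hn2 i).2).trans (ENNReal.add_halves ε).le)
  · exact ((hχ n).continuous.aestronglyMeasurable.smul (hG i).1.1).sub (hG i).1.1
  · exact hdc.aestronglyMeasurable.smul hu.1

theorem IsWeakGradient.exists_isTest_approx {u : Plane → ℂ} {G : Fin 2 → Plane → ℂ}
    (hu : MemLp u 2 volume) (hG : IsWeakGradient u G) {ε : ℝ≥0∞} (hε : 0 < ε) :
    ∃ v : Plane → ℂ, IsTest v ∧ eLpNorm (fun x => v x - u x) 2 volume ≤ ε ∧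
      ∀ i, eLpNorm (fun x => pd i v x - G i x) 2 volume ≤ ε := by
  have hε2 : 0 < ε / 2 := ENNReal.half_pos hε.ne'
  obtain ⟨w, H, hw, hwc, hH, h1, h2⟩ := hG.exists_compactSupport_approx hu hε2
  obtain ⟨δ, hδ, hδw⟩ := exists_mollify_eLpNorm_sub_le hw hε2
  choose δ' hδ' hδH using fun i => exists_mollify_eLpNorm_sub_le (hH i).1 hε2
  -- One radius must serve the function and both components of its gradient.
  set r := min δ (min (δ' 0) (δ' 1)) with hr
  have hr0 : 0 < r := lt_min hδ (lt_min (hδ' 0) (hδ' 1))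
  let φ : ContDiffBump (0 : Plane) := ⟨r / 2, r, by positivity, by linarith⟩
  have hwl := hw.locallyIntegrable (by norm_num)
  have htest : IsTest (φ.normed volume ⋆[ContinuousLinearMap.lsmul ℝ ℝ, volume] w) :=
    ⟨φ.hasCompactSupport_normed.contDiff_convolution_left _ φ.contDiff_normed hwl,
      φ.hasCompactSupport_normed.convolution _ hwc⟩
  have tri : ∀ f g h : Plane → ℂ, AEStronglyMeasurable f volume → AEStronglyMeasurable g volume →
      AEStronglyMeasurable h volume → eLpNorm (fun x => f x - g x) 2 volume ≤ ε / 2 →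
      eLpNorm (fun x => g x - h x) 2 volume ≤ ε / 2 →
      eLpNorm (fun x => f x - h x) 2 volume ≤ ε := by
    intro f g h hf hg hh hfg hgh
    have e : (fun x => f x - h x) = (fun x => f x - g x) + fun x => g x - h x := by
      ext x; simp
    rw [e]
    exact (eLpNorm_add_le (hf.sub hg) (hg.sub hh) (by norm_num)).trans
      ((add_le_add hfg hgh).trans (ENNReal.add_halves ε).le)
  refine ⟨_, htest, tri _ w u htest.continuous.aestronglyMeasurable hw.1 hu.1
    (hδw φ (min_le_left _ _)) h1, fun i => ?_⟩
  refine tri _ (H i) _ (htest.isTest_pd i).continuous.aestronglyMeasurable (hH i).1.1 (hG i).1.1 ?_ (h2 i)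
  have := hδH i φ (by fin_cases i <;> simp [φ, r])
  simpa only [hH.pd_convolution hw φ.contDiff_normed φ.hasCompactSupport_normed i] using this

/-- Test functions are dense in `H¹`. -/
theorem IsWeakGradient.exists_isTest_seq {u : Plane → ℂ} {G : Fin 2 → Plane → ℂ}
    (hu : MemLp u 2 volume) (hG : IsWeakGradient u G) :
    ∃ v : ℕ → Plane → ℂ, (∀ n, IsTest (v n)) ∧
      Tendsto (fun n => eLpNorm (fun x => v n x - u x) 2 volume) atTop (𝓝 0) ∧
      ∀ i, Tendsto (fun n => eLpNorm (fun x => pd i (v n) x - G i x) 2 volume) atTop (𝓝 0) := by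
  have hpos : ∀ n : ℕ, (0 : ℝ≥0∞) < ((n : ℝ≥0∞) + 1)⁻¹ := fun n => by
    rw [ENNReal.inv_pos]; exact_mod_cast ENNReal.natCast_ne_top (n + 1)
  choose v hv h1 h2 using fun n : ℕ => hG.exists_isTest_approx hu (hpos n)
  have hlim : Tendsto (fun n : ℕ => ((n : ℝ≥0∞) + 1)⁻¹) atTop (𝓝 0) := by
    have := (tendsto_add_atTop_iff_nat 1).2 ENNReal.tendsto_inv_nat_nhds_zero
    simpa using this
  exact ⟨v, hv, tendsto_of_tendsto_of_tendsto_of_le_of_le tendsto_const_nhds hlim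
    (fun _ => zero_le) h1, fun i => tendsto_of_tendsto_of_tendsto_of_le_of_le
    tendsto_const_nhds hlim (fun _ => zero_le) fun n => h2 n i⟩

/-! ### Sobolev inequalities for the density of a test function -/

theorem IsTest.contDiff_normSq {v : Plane → ℂ} (hv : IsTest v) :
    ContDiff ℝ ∞ (fun x => ‖v x‖ ^ 2) := hv.contDiff.norm_sq ℝ

theorem IsTest.hasCompactSupport_normSq {v : Plane → ℂ} (hv : IsTest v) :
    HasCompactSupport (fun x => ‖v x‖ ^ 2) :=
  hv.hasCompactSupport.comp_left (g := fun z : ℂ => ‖z‖ ^ 2) (by simp)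

/-- The embedding `W^{1,1} ⊂ L²` of the plane is applied to `|v|²`, followed by Cauchy–Schwarz on `∫
|v| |s|`. Leaving `s` abstract allows the modulus of any magnetic gradient. -/
theorem exists_sobolev_four : ∃ C : ℝ≥0, ∀ (v : Plane → ℂ) (s : Plane → ℝ), IsTest v →
    AEMeasurable s volume →
    (∀ x, ‖fderiv ℝ (fun x => ‖v x‖ ^ 2) x‖ ≤ 2 * ‖v x‖ * ‖s x‖) →
    ∫⁻ x, ‖v x‖ₑ ^ 4 ≤ C * (∫⁻ x, ‖v x‖ₑ ^ 2) * ∫⁻ x, ‖s x‖ₑ ^ 2 := by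
  have hfin : Module.finrank ℝ Plane = 2 := by simp
  have hconj : NNReal.HolderConjugate (Module.finrank ℝ Plane : ℝ≥0) 2 := by
    rw [hfin]; exact_mod_cast NNReal.HolderConjugate.two_two
  refine ⟨eLpNormLESNormFDerivOneConst (volume : Measure Plane) (2 : ℝ≥0) ^ 2 * 4, fun v s hv hs hvs => ?_⟩
  have h := eLpNorm_le_eLpNorm_fderiv_one (volume : Measure Plane)
    (hv.contDiff_normSq.of_le (by simp)) hv.hasCompactSupport_normSq hconj
  have h2 := pow_le_pow_left' h 2
  have e1 : eLpNorm (fun x => ‖v x‖ ^ 2) ((2 : ℝ≥0) : ℝ≥0∞) volume ^ 2 = ∫⁻ x, ‖v x‖ₑ ^ 4 := by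
    rw [ENNReal.coe_ofNat, eLpNorm_two_sq]
    refine lintegral_congr fun x => ?_
    rw [enorm_pow, enorm_norm, ← pow_mul]
  rw [e1, mul_pow] at h2
  refine h2.trans ?_
  rw [eLpNorm_one_eq_lintegral_enorm]
  have h3 : ∫⁻ x, ‖fderiv ℝ (fun x => ‖v x‖ ^ 2) x‖ₑ ≤ 2 * ∫⁻ x, ‖v x‖ₑ * ‖s x‖ₑ := by
    rw [← lintegral_const_mul' _ _ (by norm_num)]
    refine lintegral_mono fun x => ?_
    have := ENNReal.ofReal_le_ofReal (hvs x)
    rw [ofReal_norm, mul_assoc, ENNReal.ofReal_mul (by norm_num),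
      ENNReal.ofReal_mul (norm_nonneg _), ofReal_norm, ofReal_norm] at this
    simpa using this
  calc _ ≤ (eLpNormLESNormFDerivOneConst (volume : Measure Plane) (2 : ℝ≥0) : ℝ≥0∞) ^ 2 *
        (2 * ∫⁻ x, ‖v x‖ₑ * ‖s x‖ₑ) ^ 2 := by gcongr
    _ ≤ (eLpNormLESNormFDerivOneConst (volume : Measure Plane) (2 : ℝ≥0) : ℝ≥0∞) ^ 2 *
        (4 * ((∫⁻ x, ‖v x‖ₑ ^ 2) * ∫⁻ x, ‖s x‖ₑ ^ 2)) := by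
        rw [mul_pow]
        have := lintegral_mul_sq_le (μ := (volume : Measure Plane))
          hv.continuous.enorm.aemeasurable hs.enorm
        have h4 : (2 : ℝ≥0∞) ^ 2 = 4 := by norm_num
        rw [h4]
        gcongr
    _ = _ := by push_cast; ring

/-- Here `W^{1,4/3} ⊂ L⁴` is applied to `|v|²`, and `∫ |v|^{4/3} |s|^{4/3}` is split by Hölder. The
exponent 8 is what puts the density in `L⁴`, as the bounds on the vector potential require. -/
theorem exists_sobolev_eight : ∃ C : ℝ≥0, ∀ (v : Plane → ℂ) (s : Plane → ℝ), IsTest v →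
    AEMeasurable s volume →
    (∀ x, ‖fderiv ℝ (fun x => ‖v x‖ ^ 2) x‖ ≤ 2 * ‖v x‖ * ‖s x‖) →
    ∫⁻ x, ‖v x‖ₑ ^ 8 ≤ C * (∫⁻ x, ‖v x‖ₑ ^ 4) * (∫⁻ x, ‖s x‖ₑ ^ 2) ^ 2 := by
  have hfin : Module.finrank ℝ Plane = 2 := by simp
  refine ⟨eLpNormLESNormFDerivOfEqInnerConst (volume : Measure Plane) ((4 / 3 : ℝ≥0) : ℝ) ^ 4 * 16,
    fun v s hv hs hvs => ?_⟩
  have h := eLpNorm_le_eLpNorm_fderiv_of_eq_inner (volume : Measure Plane)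
    (hv.contDiff_normSq.of_le (by simp)) hv.hasCompactSupport_normSq (p := 4 / 3) (p' := 4)
    (by rw [one_le_div (by norm_num)]; norm_num) (by rw [hfin]; norm_num)
    (by rw [hfin]; push_cast; norm_num)
  have h2 := pow_le_pow_left' h 4
  have e1 : eLpNorm (fun x => ‖v x‖ ^ 2) ((4 : ℝ≥0) : ℝ≥0∞) volume ^ 4 = ∫⁻ x, ‖v x‖ₑ ^ 8 := by
    have := eLpNorm_nnreal_pow_eq_lintegral (μ := (volume : Measure Plane))
      (f := fun x => ‖v x‖ ^ 2) (p := 4) (by norm_num)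
    have h4 : (((4 : ℝ≥0) : ℝ)) = ((4 : ℕ) : ℝ) := by norm_num
    simp only [h4, ENNReal.rpow_natCast] at this
    rw [this]
    refine lintegral_congr fun x => ?_
    rw [enorm_pow, enorm_norm, ← pow_mul]
  rw [e1, mul_pow] at h2
  refine h2.trans ?_
  have e2 : eLpNorm (fderiv ℝ fun x => ‖v x‖ ^ 2) ((4 / 3 : ℝ≥0) : ℝ≥0∞) volume ^ 4
      = (∫⁻ x, ‖fderiv ℝ (fun x => ‖v x‖ ^ 2) x‖ₑ ^ (4 / 3 : ℝ)) ^ 3 := by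
    have := eLpNorm_nnreal_pow_eq_lintegral (μ := (volume : Measure Plane))
      (f := fderiv ℝ fun x => ‖v x‖ ^ 2) (p := 4 / 3) (by norm_num)
    have h4 : (((4 / 3 : ℝ≥0) : ℝ)) = (4 / 3 : ℝ) := by norm_num
    rw [h4] at this
    rw [← this, ← ENNReal.rpow_natCast, ← ENNReal.rpow_natCast, ← ENNReal.rpow_mul]
    norm_num
  rw [e2]
  have h3 : ∫⁻ x, ‖fderiv ℝ (fun x => ‖v x‖ ^ 2) x‖ₑ ^ (4 / 3 : ℝ)
      ≤ (2 : ℝ≥0∞) ^ (4 / 3 : ℝ) * ∫⁻ x, ‖v x‖ₑ ^ (4 / 3 : ℝ) * ‖s x‖ₑ ^ (4 / 3 : ℝ) := by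
    rw [← lintegral_const_mul' _ _ (by norm_num)]
    refine lintegral_mono fun x => ?_
    have := ENNReal.ofReal_le_ofReal (hvs x)
    rw [ofReal_norm, mul_assoc, ENNReal.ofReal_mul (by norm_num),
      ENNReal.ofReal_mul (norm_nonneg _), ofReal_norm, ofReal_norm] at this
    have h5 := ENNReal.rpow_le_rpow this (by norm_num : (0:ℝ) ≤ 4 / 3)
    rw [ENNReal.mul_rpow_of_nonneg _ _ (by norm_num),
      ENNReal.mul_rpow_of_nonneg _ _ (by norm_num)] at h5
    simpa using h5
  -- These exponents turn the powers `4/3` into exactly `∫ |v|⁴` and `∫ |s|²`.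
  have hold : Real.HolderConjugate 3 (3 / 2) := by
    rw [Real.holderConjugate_iff]; norm_num
  have h6 := ENNReal.lintegral_mul_le_Lp_mul_Lq (volume : Measure Plane) hold
    (f := fun x => ‖v x‖ₑ ^ (4 / 3 : ℝ)) (g := fun x => ‖s x‖ₑ ^ (4 / 3 : ℝ))
    (hv.continuous.enorm.aemeasurable.pow_const _) (hs.enorm.pow_const _)
  have e3 : ∀ a : ℝ≥0∞, (a ^ (4 / 3 : ℝ)) ^ (3 : ℝ) = a ^ 4 := fun a => by
    rw [← ENNReal.rpow_mul, ← ENNReal.rpow_natCast]; norm_num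
  have e4 : ∀ a : ℝ≥0∞, (a ^ (4 / 3 : ℝ)) ^ (3 / 2 : ℝ) = a ^ 2 := fun a => by
    rw [← ENNReal.rpow_mul, ← ENNReal.rpow_natCast]; norm_num
  have e5 : ∀ a : ℝ≥0∞, (a ^ (1 / 3 : ℝ)) ^ 3 = a := fun a => by
    rw [← ENNReal.rpow_natCast, ← ENNReal.rpow_mul]; norm_num
  have e6 : ∀ a : ℝ≥0∞, (a ^ (1 / (3 / 2) : ℝ)) ^ 3 = a ^ 2 := fun a => by
    rw [← ENNReal.rpow_natCast, ← ENNReal.rpow_mul, ← ENNReal.rpow_natCast]; norm_num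
  have e7 : ((2 : ℝ≥0∞) ^ (4 / 3 : ℝ)) ^ 3 = 16 := by
    rw [← ENNReal.rpow_natCast, ← ENNReal.rpow_mul,
      show (4 / 3 * ((3 : ℕ) : ℝ) : ℝ) = ((4 : ℕ) : ℝ) by norm_num, ENNReal.rpow_natCast]
    norm_num
  simp only [Pi.mul_apply, e3, e4] at h6
  set C0 := (eLpNormLESNormFDerivOfEqInnerConst (volume : Measure Plane) ((4 / 3 : ℝ≥0) : ℝ) : ℝ≥0∞)
  calc _ ≤ C0 ^ 4 * ((2 : ℝ≥0∞) ^ (4 / 3 : ℝ) * ((∫⁻ x, ‖v x‖ₑ ^ 4) ^ (1 / 3 : ℝ) *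
        (∫⁻ x, ‖s x‖ₑ ^ 2) ^ (1 / (3 / 2) : ℝ))) ^ 3 := by
        gcongr
        exact h3.trans (by gcongr)
    _ = C0 ^ 4 * (16 * ((∫⁻ x, ‖v x‖ₑ ^ 4) * (∫⁻ x, ‖s x‖ₑ ^ 2) ^ 2)) := by
        rw [mul_pow, mul_pow, e5, e6, e7]
    _ = _ := by rw [ENNReal.coe_mul, ENNReal.coe_pow, ENNReal.coe_ofNat]; ring

/-- The derivative of the density is controlled by any magnetic gradient. -/
theorem IsTest.norm_fderiv_normSq_le {v : Plane → ℂ} (hv : IsTest v) (b : Fin 2 → ℝ) (x : Plane) :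
    ‖fderiv ℝ (fun x => ‖v x‖ ^ 2) x‖ ≤
      2 * ‖v x‖ * ‖Real.sqrt (∑ i, ‖-Complex.I * pd i v x + (b i : ℂ) * v x‖ ^ 2)‖ := by
  have hd : HasFDerivAt (fun x => ‖v x‖ ^ 2) _ x := (hv.differentiable x).hasFDerivAt.norm_sq
  rw [hd.fderiv, Real.norm_of_nonneg (Real.sqrt_nonneg _)]
  set L := (2 • (innerSL ℝ (v x)).comp (fderiv ℝ v x) : Plane →L[ℝ] ℝ) with hL
  have hLi : ∀ i, |L (EuclideanSpace.single i 1)|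
      ≤ 2 * ‖v x‖ * ‖-Complex.I * pd i v x + (b i : ℂ) * v x‖ := by
    intro i
    -- The potential may be inserted freely: its contribution `Re (v̄ · i b v)` is zero.
    have e : L (EuclideanSpace.single i 1) =
        2 * ((starRingEnd ℂ (v x)) * (Complex.I * (-Complex.I * pd i v x + (b i : ℂ) * v x))).re := by
      simp [hL, pd, Complex.inner]
      ring
    rw [e, abs_mul, abs_two, mul_assoc]
    gcongr
    refine (Complex.abs_re_le_norm _).trans ?_
    simp
  refine ContinuousLinearMap.opNorm_le_bound _ (by positivity) fun y => ?_
  have hy : y = ∑ i, y i • (EuclideanSpace.single i 1 : Plane) := by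
    ext j; fin_cases j <;> simp
  have h1 : |L y| ≤ ∑ i, |y i| * (2 * ‖v x‖ * ‖-Complex.I * pd i v x + (b i : ℂ) * v x‖) := by
    conv_lhs => rw [hy]
    rw [map_sum]
    refine (Finset.abs_sum_le_sum_abs _ _).trans (Finset.sum_le_sum fun i _ => ?_)
    rw [map_smul, smul_eq_mul, abs_mul]
    gcongr
    exact hLi i
  rw [Real.norm_eq_abs]
  refine h1.trans ?_
  have h2 := Real.sum_mul_le_sqrt_mul_sqrt Finset.univ (fun i => |y i|)
    (fun i => ‖-Complex.I * pd i v x + (b i : ℂ) * v x‖)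
  have h3 : ‖y‖ = Real.sqrt (∑ i, |y i| ^ 2) := by
    rw [EuclideanSpace.norm_eq]; rfl
  calc ∑ i, |y i| * (2 * ‖v x‖ * ‖-Complex.I * pd i v x + (b i : ℂ) * v x‖)
      = 2 * ‖v x‖ * ∑ i, |y i| * ‖-Complex.I * pd i v x + (b i : ℂ) * v x‖ := by
        rw [Finset.mul_sum]; exact Finset.sum_congr rfl fun i _ => by ring
    _ ≤ 2 * ‖v x‖ * (‖y‖ * Real.sqrt (∑ i, ‖-Complex.I * pd i v x + (b i : ℂ) * v x‖ ^ 2)) := by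
        rw [h3]; gcongr
    _ = _ := by ring

/-- Gagliardo–Nirenberg inequalities for test functions, with an arbitrary magnetic potential. -/
theorem exists_magnetic_sobolev : ∃ C : ℝ≥0, ∀ (v : Plane → ℂ) (b : Fin 2 → Plane → ℝ), IsTest v →
    (∀ i, AEMeasurable (b i) volume) →
    ∫⁻ x, ‖v x‖ₑ ^ 4 ≤ C * (∫⁻ x, ‖v x‖ₑ ^ 2) *
      (∫⁻ x, ∑ i, ‖-Complex.I * pd i v x + (b i x : ℂ) * v x‖ₑ ^ 2) ∧
    ∫⁻ x, ‖v x‖ₑ ^ 8 ≤ C * (∫⁻ x, ‖v x‖ₑ ^ 4) *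
      (∫⁻ x, ∑ i, ‖-Complex.I * pd i v x + (b i x : ℂ) * v x‖ₑ ^ 2) ^ 2 := by
  obtain ⟨C₁, h₁⟩ := exists_sobolev_four
  obtain ⟨C₂, h₂⟩ := exists_sobolev_eight
  refine ⟨max C₁ C₂, fun v b hv hb => ?_⟩
  set s : Plane → ℝ := fun x =>
    Real.sqrt (∑ i, ‖-Complex.I * pd i v x + (b i x : ℂ) * v x‖ ^ 2) with hs
  have hsm : AEMeasurable s volume := by
    refine AEMeasurable.sqrt (Finset.aemeasurable_fun_sum _ fun i _ => ?_)
    refine AEMeasurable.pow_const (AEMeasurable.norm ?_) 2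
    exact ((hv.isTest_pd i).continuous.aemeasurable.const_mul _).add
      ((Complex.measurable_ofReal.comp_aemeasurable (hb i)).mul hv.continuous.aemeasurable)
  have hse : ∀ x, ‖s x‖ₑ ^ 2 = ∑ i, ‖-Complex.I * pd i v x + (b i x : ℂ) * v x‖ₑ ^ 2 := by
    intro x
    rw [Real.enorm_of_nonneg (Real.sqrt_nonneg _), ← ENNReal.ofReal_pow (Real.sqrt_nonneg _),
      Real.sq_sqrt (by positivity), ENNReal.ofReal_sum_of_nonneg (fun i _ => by positivity)]
    refine Finset.sum_congr rfl fun i _ => ?_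
    rw [ENNReal.ofReal_pow (norm_nonneg _), ofReal_norm]
  have hd := fun x => hv.norm_fderiv_normSq_le (fun i => b i x) x
  have r₁ := h₁ v s hv hsm hd
  have r₂ := h₂ v s hv hsm hd
  simp only [hse] at r₁ r₂
  refine ⟨r₁.trans ?_, r₂.trans ?_⟩
  · gcongr; exact le_max_left _ _
  · gcongr; exact le_max_right _ _

/-! ### The vector potential -/

/-- Rotation by a right angle. -/
noncomputable def perp (z : Plane) : Plane := !₂[-z 1, z 0]

theorem norm_perp (z : Plane) : ‖perp z‖ = ‖z‖ := by
  simp [perp, EuclideanSpace.norm_eq, add_comm]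

theorem continuous_perp : Continuous perp := by
  unfold perp
  fun_prop

theorem hasFDerivAt_w₀ {z : Plane} (hz : z ≠ 0) :
    HasFDerivAt w₀ ((‖z‖ ^ 2)⁻¹ • innerSL ℝ z) z := by
  have h1 : HasFDerivAt (fun x : Plane => ‖x‖ ^ 2) _ z := (hasFDerivAt_id z).norm_sq
  have hz' : ‖z‖ ^ 2 ≠ 0 := by positivity
  have h2 := (h1.log hz').const_mul (1 / 2 : ℝ)
  have e : w₀ = fun x : Plane => 1 / 2 * Real.log (‖x‖ ^ 2) := by
    ext x; rw [w₀, Real.log_pow]; push_cast; ring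
  rw [e]
  refine h2.congr_fderiv ?_
  ext y
  simp
  ring

/-- `log ‖x‖` tends to `-∞` at the origin, whatever value is assigned there. Hence `fderiv` takes
its default value zero, which lets the formula for `gradPerp w₀` hold everywhere. -/
theorem not_differentiableAt_w₀_zero : ¬ DifferentiableAt ℝ w₀ (0 : Plane) := by
  intro h
  have h1 : Tendsto w₀ (𝓝[≠] (0 : Plane)) (𝓝 (w₀ 0)) :=
    h.continuousAt.tendsto.mono_left nhdsWithin_le_nhds
  have h2 : Tendsto w₀ (𝓝[≠] (0 : Plane)) atBot := by
    refine Real.tendsto_log_nhdsNE_zero.comp ?_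
    exact (tendsto_norm_nhdsNE_zero (E := Plane)).mono_right
      (nhdsWithin_mono _ fun x hx => ne_of_gt hx)
  exact not_tendsto_nhds_of_tendsto_atBot h2 _ h1

theorem gradPerp_w₀ (z : Plane) : gradPerp w₀ z = (‖z‖ ^ 2)⁻¹ • perp z := by
  unfold gradPerp partialDeriv
  by_cases hz : z = 0
  · subst hz
    rw [fderiv_zero_of_not_differentiableAt not_differentiableAt_w₀_zero]
    ext i; fin_cases i <;> simp [perp]
  · rw [(hasFDerivAt_w₀ hz).fderiv]
    ext i
    fin_cases i <;> simp [perp, EuclideanSpace.inner_single_right]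

theorem norm_gradPerp_w₀ (z : Plane) : ‖gradPerp w₀ z‖ = ‖z‖⁻¹ := by
  rw [gradPerp_w₀, norm_smul, norm_perp, norm_inv, norm_pow, norm_norm]
  by_cases hz : ‖z‖ = 0
  · simp [hz]
  · field_simp

theorem measurable_gradPerp_w₀ : Measurable (gradPerp w₀) := by
  have : gradPerp w₀ = fun z => (‖z‖ ^ 2)⁻¹ • perp z := funext gradPerp_w₀
  rw [this]
  exact (by fun_prop : Measurable fun z : Plane => (‖z‖ ^ 2)⁻¹).smul continuous_perp.measurable

/-- A three-way split of `a / d`: either `d ≥ τ¹²`, or `1/d ≤ τ³a³`, or `d` is small and `a³ <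
1/(τ³d)`, which forces `a√d ≤ τ`. After integration the terms become an `L¹` norm, an `L⁴` norm and
a fixed integrable singularity. The last two carry positive powers of `τ`, so a density small in
`L¹` and bounded in `L⁴` has a small potential. -/
theorem div_le_of_threshold {a d τ : ℝ} (ha : 0 ≤ a) (hd : 0 < d) (hτ : 0 < τ) (hτ1 : τ ≤ 1) :
    a * d⁻¹ ≤ (τ ^ 12)⁻¹ * a + τ ^ 3 * a ^ 4
      + τ * (Set.Iio (1 : ℝ)).indicator (fun d => (d * √d)⁻¹) d := by
  have hi : 0 ≤ (Set.Iio (1 : ℝ)).indicator (fun d => (d * √d)⁻¹) d :=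
    Set.indicator_nonneg (fun y _ => inv_nonneg.2 (by
      rcases le_total 0 y with h | h
      · positivity
      · simp [Real.sqrt_eq_zero_of_nonpos h])) d
  by_cases h1 : τ ^ 12 ≤ d
  · have : a * d⁻¹ ≤ (τ ^ 12)⁻¹ * a := by
      rw [mul_comm]; gcongr
    have h2 : 0 ≤ τ ^ 3 * a ^ 4 := by positivity
    have h3 := mul_nonneg hτ.le hi
    linarith
  push Not at h1
  have hd1 : d < 1 := h1.trans_le (pow_le_one₀ hτ.le hτ1)
  rw [Set.indicator_of_mem (by exact hd1)]
  rw [Set.indicator_of_mem (by exact hd1)] at hi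
  have hA : 0 ≤ (τ ^ 12)⁻¹ * a := by positivity
  by_cases h2 : d⁻¹ ≤ τ ^ 3 * a ^ 3
  · have : a * d⁻¹ ≤ τ ^ 3 * a ^ 4 := by
      calc a * d⁻¹ ≤ a * (τ ^ 3 * a ^ 3) := by gcongr
        _ = _ := by ring
    have h3 := mul_nonneg hτ.le hi
    linarith
  push Not at h2
  have hB : 0 ≤ τ ^ 3 * a ^ 4 := by positivity
  set e := √d with he
  have he0 : 0 < e := Real.sqrt_pos.2 hd
  have hde : d = e ^ 2 := (Real.sq_sqrt hd.le).symm
  have key : a * e ≤ τ := by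
    have h3 : τ ^ 3 * a ^ 3 * e ^ 2 < 1 := by
      rw [← hde]
      calc τ ^ 3 * a ^ 3 * d < d⁻¹ * d := by gcongr
        _ = 1 := inv_mul_cancel₀ hd.ne'
    have h4 : e ≤ τ ^ 6 := by
      have : e ^ 2 < (τ ^ 6) ^ 2 := by rw [← hde, ← pow_mul]; exact h1
      exact (lt_of_pow_lt_pow_left₀ 2 (by positivity) this).le
    have h5 : (a * e) ^ 3 ≤ τ ^ 3 := by
      have : τ ^ 3 * (a * e) ^ 3 ≤ τ ^ 3 * τ ^ 3 := by
        calc τ ^ 3 * (a * e) ^ 3 = (τ ^ 3 * a ^ 3 * e ^ 2) * e := by ring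
          _ ≤ 1 * τ ^ 6 := by gcongr
          _ = _ := by ring
      exact le_of_mul_le_mul_left this (by positivity)
    exact le_of_pow_le_pow_left₀ (by norm_num) hτ.le h5
  have : a * d⁻¹ ≤ τ * (d * e)⁻¹ := by
    rw [mul_inv, mul_comm d⁻¹, ← mul_assoc]
    gcongr
    rw [← div_eq_mul_inv, le_div_iff₀ he0]
    exact key
  linarith

/-- In polar coordinates the Jacobian turns `r^{-3/2}` into `r^{-1/2}`, which is integrable on `(0,
1)`. -/
theorem integrable_singular_kernel :
    Integrable (fun z : Plane => (Set.Iio (1 : ℝ)).indicator (fun d => (d * √d)⁻¹) ‖z‖) := by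
  rw [integrable_fun_norm_addHaar volume]
  have hfin : Module.finrank ℝ Plane = 2 := by simp
  rw [hfin]
  have h1 : IntegrableOn (fun y : ℝ => y ^ (-(1 / 2) : ℝ)) (Set.Ioo 0 1) :=
    (intervalIntegral.integrableOn_Ioo_rpow_iff one_pos).2 (by norm_num)
  have h2 : IntegrableOn ((Set.Ioo (0:ℝ) 1).indicator fun y : ℝ => y ^ (-(1 / 2) : ℝ))
      (Set.Ioi 0) := ((integrable_indicator_iff measurableSet_Ioo).2 h1).integrableOn
  refine h2.congr_fun (fun y hy => ?_) measurableSet_Ioi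
  have hy0 : (0 : ℝ) < y := hy
  by_cases hy1 : y < 1
  · rw [Set.indicator_of_mem (by exact ⟨hy0, hy1⟩), Set.indicator_of_mem (by exact hy1),
      Real.rpow_neg hy0.le, ← Real.sqrt_eq_rpow, mul_inv]
    simp [hy0.ne']
  · rw [Set.indicator_of_notMem (fun h => hy1 h.2), Set.indicator_of_notMem (by exact hy1)]
    simp

/-- Integrates the threshold splitting in `y`; by translation invariance the singular part
contributes the same `I` for every `x`. The norm stays inside the integral because the Fubini
argument for the curl needs absolute convergence. -/
theorem exists_vecPot_integral_bound : ∃ I : ℝ, 0 ≤ I ∧ ∀ σ : Plane → ℝ, Integrable σ →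
    Integrable (fun x => σ x ^ 4) → ∀ x,
      Integrable (fun y => σ y • gradPerp w₀ (x - y)) ∧ ∀ τ : ℝ, 0 < τ → τ ≤ 1 →
        ∫ y, ‖σ y • gradPerp w₀ (x - y)‖ ≤ (τ ^ 12)⁻¹ * (∫ y, |σ y|) + τ ^ 3 * (∫ y, σ y ^ 4) + τ * I := by
  set k : Plane → ℝ := fun z => (Set.Iio (1 : ℝ)).indicator (fun d => (d * √d)⁻¹) ‖z‖ with hk
  have hk0 : ∀ z, 0 ≤ k z := fun z => Set.indicator_apply_nonneg fun _ => by positivity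
  refine ⟨∫ z, k z, integral_nonneg hk0, fun σ h1 h4 x => ?_⟩
  have hki : Integrable (fun y => k (x - y)) := integrable_singular_kernel.comp_sub_left x
  have hdom : ∀ τ : ℝ, 0 < τ → τ ≤ 1 → ∀ᵐ y, ‖σ y • gradPerp w₀ (x - y)‖
      ≤ (τ ^ 12)⁻¹ * |σ y| + τ ^ 3 * σ y ^ 4 + τ * k (x - y) := by
    intro τ hτ hτ1
    have hne : ∀ᵐ y : Plane, y ≠ x := by
      simp [ae_iff]
    filter_upwards [hne] with y hy
    have hd : 0 < ‖x - y‖ := norm_pos_iff.2 (sub_ne_zero.2 hy.symm)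
    have := div_le_of_threshold (abs_nonneg (σ y)) hd hτ hτ1
    rw [norm_smul, norm_gradPerp_w₀, Real.norm_eq_abs]
    have e : |σ y| ^ 4 = σ y ^ 4 := (by decide : Even 4).pow_abs _
    rw [e] at this
    exact this
  have hint : ∀ τ : ℝ, Integrable
      (fun y => (τ ^ 12)⁻¹ * |σ y| + τ ^ 3 * σ y ^ 4 + τ * k (x - y)) := fun τ =>
    ((h1.abs.const_mul _).add (h4.const_mul _)).add (hki.const_mul _)
  have hm : AEStronglyMeasurable (fun y => σ y • gradPerp w₀ (x - y)) volume :=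
    h1.1.smul (measurable_gradPerp_w₀.comp (measurable_const.sub measurable_id)).aestronglyMeasurable
  refine ⟨(hint 1).mono' hm (hdom 1 one_pos le_rfl), fun τ hτ hτ1 => ?_⟩
  refine (integral_mono_ae ((hint 1).mono' hm (hdom 1 one_pos le_rfl)).norm (hint τ)
    (hdom τ hτ hτ1)).trans (le_of_eq ?_)
  have hA : Integrable (fun y => (τ ^ 12)⁻¹ * |σ y| + τ ^ 3 * σ y ^ 4) :=
    (h1.abs.const_mul _).add (h4.const_mul _)
  rw [integral_add hA (hki.const_mul _),
    integral_add (h1.abs.const_mul _) (h4.const_mul _), integral_const_mul, integral_const_mul,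
    integral_const_mul, integral_sub_left_eq_self k volume x]

/-- The vector potential of `σ ∈ L¹ ∩ L⁴` is defined everywhere and bounded. -/
theorem exists_vecPot_bound : ∃ I : ℝ, 0 ≤ I ∧ ∀ σ : Plane → ℝ, Integrable σ →
    Integrable (fun x => σ x ^ 4) → ∀ x,
      Integrable (fun y => σ y • gradPerp w₀ (x - y)) ∧ ∀ τ : ℝ, 0 < τ → τ ≤ 1 →
        ‖vecPot σ x‖ ≤ (τ ^ 12)⁻¹ * (∫ y, |σ y|) + τ ^ 3 * (∫ y, σ y ^ 4) + τ * I := by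
  obtain ⟨I, hI0, hI⟩ := exists_vecPot_integral_bound
  exact ⟨I, hI0, fun σ h1 h4 x => ⟨(hI σ h1 h4 x).1, fun τ hτ hτ1 =>
    (norm_integral_le_integral_norm _).trans ((hI σ h1 h4 x).2 τ hτ hτ1)⟩⟩

theorem aestronglyMeasurable_vecPot {σ : Plane → ℝ} (hσ : AEStronglyMeasurable σ volume) :
    AEStronglyMeasurable (vecPot σ) volume := by
  have : AEStronglyMeasurable (fun p : Plane × Plane => σ p.2 • gradPerp w₀ (p.1 - p.2))
      (volume.prod volume) :=
    hσ.comp_snd.smul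
      (measurable_gradPerp_w₀.comp (measurable_fst.sub measurable_snd)).aestronglyMeasurable
  exact this.integral_prod_right'

/-! ### Continuity of the self-generated field -/

theorem eLpNorm_pow_eq_lintegral {E : Type*} [NormedAddCommGroup E] (f : Plane → E) {n : ℕ}
    (hn : n ≠ 0) : eLpNorm f n volume ^ n = ∫⁻ x, ‖f x‖ₑ ^ n := by
  have := eLpNorm_nnreal_pow_eq_lintegral (μ := (volume : Measure Plane)) (f := f) (p := n)
    (by exact_mod_cast hn)
  simpa using this

theorem memLp_natCast_iff {u : Plane → ℂ} {n : ℕ} (hn : n ≠ 0)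
    (hu : AEStronglyMeasurable u volume) :
    MemLp u n volume ↔ Integrable (fun x => ‖u x‖ ^ n) := by
  have := memLp_norm_rpow_iff (q := (n : ℝ≥0∞)) (p := n) hu (by exact_mod_cast hn) (by simp)
  rw [ENNReal.div_self (by exact_mod_cast hn) (by simp), memLp_one_iff_integrable] at this
  rw [← this]
  simp

theorem lintegral_enorm_pow_eq {u : Plane → ℂ} {n : ℕ}
    (hu : Integrable (fun x => ‖u x‖ ^ n)) :
    ∫⁻ x, ‖u x‖ₑ ^ n = ENNReal.ofReal (∫ x, ‖u x‖ ^ n) := by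
  rw [ofReal_integral_eq_lintegral_ofReal hu (Eventually.of_forall fun x => by positivity)]
  refine lintegral_congr fun x => ?_
  rw [ENNReal.ofReal_pow (norm_nonneg _), ofReal_norm]

theorem integrable_norm_pow_of_le_eight {u : Plane → ℂ} (h2 : MemLp u 2 volume)
    (h8 : MemLp u 8 volume) {n : ℕ} (hn : 2 ≤ n) (hn8 : n ≤ 8) :
    Integrable (fun x => ‖u x‖ ^ n) := by
  have i2 : Integrable (fun x => ‖u x‖ ^ 2) := (memLp_natCast_iff (by norm_num) h2.1).1 h2
  have i8 : Integrable (fun x => ‖u x‖ ^ 8) := (memLp_natCast_iff (by norm_num) h2.1).1 h8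
  refine (i2.add i8).mono' (h2.1.norm.pow n) (Eventually.of_forall fun x => ?_)
  rw [norm_pow, norm_norm]
  simp only [Pi.add_apply]
  rcases le_total ‖u x‖ 1 with h | h
  · have := pow_le_pow_of_le_one (norm_nonneg (u x)) h hn
    have : 0 ≤ ‖u x‖ ^ 8 := by positivity
    linarith
  · have := pow_le_pow_right₀ h hn8
    have : 0 ≤ ‖u x‖ ^ 2 := by positivity
    linarith

section Convergence

variable {u : ℕ → Plane → ℂ} {u₀ : Plane → ℂ}

/-- Follows from `||a|² - |b|²| ≤ |a - b|² + 2 |a - b| |b|` and Cauchy–Schwarz. -/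
theorem tendsto_integral_abs_normSq_sub (hu : ∀ n, MemLp (u n) 2 volume)
    (hu₀ : MemLp u₀ 2 volume)
    (hlim : Tendsto (fun n => eLpNorm (fun x => u n x - u₀ x) 2 volume) atTop (𝓝 0)) :
    Tendsto (fun n => ∫ x, |‖u n x‖ ^ 2 - ‖u₀ x‖ ^ 2|) atTop (𝓝 0) := by
  have hbd : ∀ n, ∫⁻ x, ‖‖u n x‖ ^ 2 - ‖u₀ x‖ ^ 2‖ₑ ≤
      eLpNorm (fun x => u n x - u₀ x) 2 volume ^ 2 +
        2 * (eLpNorm (fun x => u n x - u₀ x) 2 volume * eLpNorm u₀ 2 volume) := by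
    intro n
    have hm : AEStronglyMeasurable (fun x => u n x - u₀ x) volume := (hu n).1.sub hu₀.1
    have hcs : ∫⁻ x, ‖u n x - u₀ x‖ₑ * ‖u₀ x‖ₑ ≤
        eLpNorm (fun x => u n x - u₀ x) 2 volume * eLpNorm u₀ 2 volume := by
      rw [← ENNReal.pow_le_pow_left_iff (n := 2) (by norm_num), mul_pow, eLpNorm_two_sq,
        eLpNorm_two_sq]
      exact lintegral_mul_sq_le hm.enorm hu₀.1.enorm
    calc ∫⁻ x, ‖‖u n x‖ ^ 2 - ‖u₀ x‖ ^ 2‖ₑ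
        ≤ ∫⁻ x, (‖u n x - u₀ x‖ₑ ^ 2 + 2 * (‖u n x - u₀ x‖ₑ * ‖u₀ x‖ₑ)) := by
          refine lintegral_mono fun x => ?_
          have : ‖‖u n x‖ ^ 2 - ‖u₀ x‖ ^ 2‖ ≤
              ‖u n x - u₀ x‖ ^ 2 + 2 * (‖u n x - u₀ x‖ * ‖u₀ x‖) := by
            have h1 := abs_norm_sub_norm_le (u n x) (u₀ x)
            have h2 : ‖u n x‖ ≤ ‖u n x - u₀ x‖ + ‖u₀ x‖ := by
              have := norm_add_le (u n x - u₀ x) (u₀ x)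
              simpa using this
            rw [Real.norm_eq_abs, sq_sub_sq, abs_mul, abs_of_nonneg (by positivity)]
            nlinarith [norm_nonneg (u n x - u₀ x), norm_nonneg (u₀ x), norm_nonneg (u n x),
              abs_nonneg (‖u n x‖ - ‖u₀ x‖)]
          have := ENNReal.ofReal_le_ofReal this
          rw [ofReal_norm, ENNReal.ofReal_add (by positivity) (by positivity),
            ENNReal.ofReal_pow (norm_nonneg _), ENNReal.ofReal_mul (by norm_num),
            ENNReal.ofReal_mul (norm_nonneg _), ofReal_norm, ofReal_norm] at this
          simpa using this
      _ = (∫⁻ x, ‖u n x - u₀ x‖ₑ ^ 2) + 2 * ∫⁻ x, ‖u n x - u₀ x‖ₑ * ‖u₀ x‖ₑ := by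
          rw [lintegral_add_left' (hm.enorm.pow_const 2), lintegral_const_mul' _ _ (by norm_num)]
      _ ≤ _ := by
          rw [eLpNorm_two_sq]
          gcongr
  have hl : Tendsto (fun n => eLpNorm (fun x => u n x - u₀ x) 2 volume ^ 2 +
        2 * (eLpNorm (fun x => u n x - u₀ x) 2 volume * eLpNorm u₀ 2 volume)) atTop (𝓝 0) := by
    have h1 := ENNReal.Tendsto.pow (n := 2) hlim
    have h2 := ENNReal.Tendsto.const_mul (a := 2)
      (ENNReal.Tendsto.mul_const hlim (Or.inr hu₀.2.ne)) (Or.inr (by norm_num))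
    have := h1.add h2
    simpa using this
  have h3 := tendsto_of_tendsto_of_tendsto_of_le_of_le tendsto_const_nhds hl
    (fun _ => zero_le) hbd
  have h4 := (ENNReal.tendsto_toReal ENNReal.zero_ne_top).comp h3
  rw [ENNReal.toReal_zero] at h4
  refine h4.congr fun n => ?_
  have hm : AEStronglyMeasurable (fun x => ‖u n x‖ ^ 2 - ‖u₀ x‖ ^ 2) volume :=
    ((hu n).1.norm.pow 2).sub (hu₀.1.norm.pow 2)
  rw [Function.comp, ← integral_norm_eq_lintegral_enorm hm]
  rfl

theorem vecPot_sub {ρ ρ' : Plane → ℝ} {x : Plane}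
    (h : Integrable (fun y => ρ y • gradPerp w₀ (x - y)))
    (h' : Integrable (fun y => ρ' y • gradPerp w₀ (x - y))) :
    vecPot (fun y => ρ y - ρ' y) x = vecPot ρ x - vecPot ρ' x := by
  unfold vecPot
  simp only [sub_smul]
  rw [integral_sub h h']

theorem normSq_integrable {v : Plane → ℂ} (h2 : MemLp v 2 volume) (h8 : MemLp v 8 volume) :
    Integrable (fun x => ‖v x‖ ^ 2) ∧ Integrable (fun x => (‖v x‖ ^ 2) ^ 4) := by
  refine ⟨integrable_norm_pow_of_le_eight h2 h8 (by norm_num) (by norm_num), ?_⟩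
  have := integrable_norm_pow_of_le_eight h2 h8 (n := 8) (by norm_num) (by norm_num)
  simpa only [← pow_mul] using this

theorem exists_vecPot_le {v : Plane → ℂ} (h2 : MemLp v 2 volume) (h8 : MemLp v 8 volume) :
    ∃ B : ℝ, ∀ x, ‖vecPot (fun y => ‖v y‖ ^ 2) x‖ ≤ B := by
  obtain ⟨I, -, hI⟩ := exists_vecPot_bound
  obtain ⟨i2, i8⟩ := normSq_integrable h2 h8
  exact ⟨_, fun x => (hI _ i2 i8 x).2 1 one_pos le_rfl⟩

/-- By linearity the difference is the potential of `|uₙ|² - |u₀|²`, which tends to zero in `L¹` and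
stays bounded in `L⁴`. Hence the convergence is uniform in `x`. -/
theorem eventually_vecPot_sub_le (hu : ∀ n, MemLp (u n) 2 volume) (hu₀ : MemLp u₀ 2 volume)
    (hu8 : ∀ n, MemLp (u n) 8 volume) (hu₀8 : MemLp u₀ 8 volume) {M : ℝ}
    (hM : ∀ n, ∫ x, ‖u n x‖ ^ 8 ≤ M)
    (hlim : Tendsto (fun n => eLpNorm (fun x => u n x - u₀ x) 2 volume) atTop (𝓝 0))
    {ε : ℝ} (hε : 0 < ε) : ∀ᶠ n in atTop, ∀ x,
      ‖vecPot (fun y => ‖u n y‖ ^ 2) x - vecPot (fun y => ‖u₀ y‖ ^ 2) x‖ ≤ ε := by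
  obtain ⟨I, hI0, hI⟩ := exists_vecPot_bound
  set M' : ℝ := 8 * (M + ∫ x, ‖u₀ x‖ ^ 8) with hM'
  have hM0 : 0 ≤ M := (integral_nonneg fun x => by positivity).trans (hM 0)
  have hM'0 : 0 ≤ M' := by
    have : 0 ≤ ∫ x, ‖u₀ x‖ ^ 8 := integral_nonneg fun x => by positivity
    positivity
  -- `τ` is fixed before `n`: it makes the `L⁴` and singular terms at most `ε / 2`; afterwards `n`
  -- beats the large factor `τ⁻¹²` of the `L¹` term.
  set τ : ℝ := min 1 (ε / 2 / (M' + I + 1)) with hτ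
  have hpos : 0 < M' + I + 1 := by positivity
  have hτ0 : 0 < τ := lt_min one_pos (by positivity)
  have hτ1 : τ ≤ 1 := min_le_left _ _
  have hτ2 : τ ^ 3 * M' + τ * I ≤ ε / 2 := by
    have h1 : τ ^ 3 ≤ τ := by
      calc τ ^ 3 ≤ τ ^ 1 := pow_le_pow_of_le_one hτ0.le hτ1 (by norm_num)
        _ = τ := pow_one τ
    have h2 : τ * (M' + I + 1) ≤ ε / 2 := by
      rw [← le_div_iff₀ hpos]; exact min_le_right _ _
    nlinarith
  have hev := (tendsto_integral_abs_normSq_sub hu hu₀ hlim).const_mul ((τ ^ 12)⁻¹)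
  rw [mul_zero] at hev
  filter_upwards [hev.eventually_le_const (half_pos hε)] with n hn x
  obtain ⟨i2, i8⟩ := normSq_integrable (hu n) (hu8 n)
  obtain ⟨j2, j8⟩ := normSq_integrable hu₀ hu₀8
  have hb : ∀ x, (‖u n x‖ ^ 2 - ‖u₀ x‖ ^ 2) ^ 4 ≤ 8 * (‖u n x‖ ^ 8 + ‖u₀ x‖ ^ 8) := by
    intro x
    have e1 : ‖u n x‖ ^ 8 = (‖u n x‖ ^ 2) ^ 4 := by rw [← pow_mul]
    have e2 : ‖u₀ x‖ ^ 8 = (‖u₀ x‖ ^ 2) ^ 4 := by rw [← pow_mul]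
    rw [e1, e2]
    have h1 := add_pow_le (sq_nonneg ‖u n x‖) (sq_nonneg ‖u₀ x‖) 4
    have h2 : (‖u n x‖ ^ 2 - ‖u₀ x‖ ^ 2) ^ 4 ≤ (‖u n x‖ ^ 2 + ‖u₀ x‖ ^ 2) ^ 4 := by
      have h3 : |‖u n x‖ ^ 2 - ‖u₀ x‖ ^ 2| ≤ ‖u n x‖ ^ 2 + ‖u₀ x‖ ^ 2 := by
        rw [abs_le]; constructor <;> nlinarith [sq_nonneg ‖u n x‖, sq_nonneg ‖u₀ x‖]
      have h4 := pow_le_pow_left₀ (abs_nonneg _) h3 4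
      rwa [(by decide : Even 4).pow_abs] at h4
    norm_num at h1
    linarith
  have hI8 : Integrable (fun x => 8 * (‖u n x‖ ^ 8 + ‖u₀ x‖ ^ 8)) := by
    have := (i8.add j8).const_mul 8
    simpa only [← pow_mul, Pi.add_apply] using this
  have k4 : Integrable (fun x => (‖u n x‖ ^ 2 - ‖u₀ x‖ ^ 2) ^ 4) := by
    refine hI8.mono' ((i2.1.sub j2.1).pow 4) (Eventually.of_forall fun x => ?_)
    rw [Real.norm_of_nonneg (by positivity)]
    exact hb x
  have hk4 : ∫ x, (‖u n x‖ ^ 2 - ‖u₀ x‖ ^ 2) ^ 4 ≤ M' := by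
    refine (integral_mono k4 hI8 hb).trans ?_
    simp only [← pow_mul] at i8 j8
    rw [integral_const_mul, integral_add i8 j8, hM']
    have := hM n
    gcongr
  rw [← vecPot_sub (hI _ i2 i8 x).1 (hI _ j2 j8 x).1]
  refine ((hI _ (i2.sub j2) k4 x).2 τ hτ0 hτ1).trans ?_
  have h5 : τ ^ 3 * ∫ y, (‖u n y‖ ^ 2 - ‖u₀ y‖ ^ 2) ^ 4 ≤ τ ^ 3 * M' := by gcongr
  simp only [Pi.sub_apply] at hn ⊢
  linarith

/-- With densities `a, b`, splitting at `a + b = s` gives `|a² - b²| ≤ s |a - b| + s⁻² (a + b)⁴`.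
The last term is uniformly small for large `s`, by the `L⁸` bound; then the first tends to zero. -/
theorem tendsto_integral_norm_pow_four (hu : ∀ n, MemLp (u n) 2 volume)
    (hu₀ : MemLp u₀ 2 volume)
    (hu8 : ∀ n, MemLp (u n) 8 volume) (hu₀8 : MemLp u₀ 8 volume) {M : ℝ}
    (hM : ∀ n, ∫ x, ‖u n x‖ ^ 8 ≤ M)
    (hlim : Tendsto (fun n => eLpNorm (fun x => u n x - u₀ x) 2 volume) atTop (𝓝 0)) :
    Tendsto (fun n => ∫ x, ‖u n x‖ ^ 4) atTop (𝓝 (∫ x, ‖u₀ x‖ ^ 4)) := by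
  set M' : ℝ := 8 * (M + ∫ x, ‖u₀ x‖ ^ 8) with hM'
  have hM0 : 0 ≤ M := (integral_nonneg fun x => by positivity).trans (hM 0)
  have hM'0 : 0 ≤ M' := by
    have : 0 ≤ ∫ x, ‖u₀ x‖ ^ 8 := integral_nonneg fun x => by positivity
    positivity
  have hL1 := tendsto_integral_abs_normSq_sub hu hu₀ hlim
  have key : ∀ n, ∀ s : ℝ, 0 < s → |(∫ x, ‖u n x‖ ^ 4) - ∫ x, ‖u₀ x‖ ^ 4| ≤
      s * (∫ x, |‖u n x‖ ^ 2 - ‖u₀ x‖ ^ 2|) + (s ^ 2)⁻¹ * M' := by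
    intro n s hs
    have i4 := integrable_norm_pow_of_le_eight (hu n) (hu8 n) (n := 4) (by norm_num) (by norm_num)
    have j4 := integrable_norm_pow_of_le_eight hu₀ hu₀8 (n := 4) (by norm_num) (by norm_num)
    have i2 := integrable_norm_pow_of_le_eight (hu n) (hu8 n) (n := 2) (by norm_num) (by norm_num)
    have j2 := integrable_norm_pow_of_le_eight hu₀ hu₀8 (n := 2) (by norm_num) (by norm_num)
    have i8 := integrable_norm_pow_of_le_eight (hu n) (hu8 n) (n := 8) (by norm_num) (by norm_num)
    have j8 := integrable_norm_pow_of_le_eight hu₀ hu₀8 (n := 8) (by norm_num) (by norm_num)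
    have I1 : Integrable (fun x => s * |‖u n x‖ ^ 2 - ‖u₀ x‖ ^ 2|) := (i2.sub j2).abs.const_mul s
    have I2 : Integrable (fun x => (s ^ 2)⁻¹ * (8 * (‖u n x‖ ^ 8 + ‖u₀ x‖ ^ 8))) :=
      ((i8.add j8).const_mul 8).const_mul _
    rw [← integral_sub i4 j4, ← Real.norm_eq_abs]
    refine (norm_integral_le_of_norm_le (I1.add I2) (Eventually.of_forall fun x => ?_)).trans ?_
    · set a := ‖u n x‖ ^ 2 with ha
      set b := ‖u₀ x‖ ^ 2 with hb
      have ha0 : 0 ≤ a := by positivity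
      have hb0 : 0 ≤ b := by positivity
      have e1 : ‖u n x‖ ^ 4 = a ^ 2 := by rw [ha, ← pow_mul]
      have e2 : ‖u₀ x‖ ^ 4 = b ^ 2 := by rw [hb, ← pow_mul]
      have e3 : ‖u n x‖ ^ 8 = a ^ 4 := by rw [ha, ← pow_mul]
      have e4 : ‖u₀ x‖ ^ 8 = b ^ 4 := by rw [hb, ← pow_mul]
      simp only [Pi.add_apply, e1, e2, e3, e4, ← ha, ← hb]
      rw [Real.norm_eq_abs, sq_sub_sq, abs_mul, abs_of_nonneg (add_nonneg ha0 hb0)]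
      have h8 := add_pow_le ha0 hb0 4
      norm_num at h8
      have hab : |a - b| ≤ a + b := by rw [abs_le]; constructor <;> linarith
      rcases le_total (a + b) s with h | h
      · have h1 : (a + b) * |a - b| ≤ s * |a - b| := by gcongr
        have h2 : 0 ≤ (s ^ 2)⁻¹ * (8 * (a ^ 4 + b ^ 4)) := by positivity
        linarith
      · have h1 : (a + b) * |a - b| ≤ (a + b) ^ 2 := by
          rw [sq]; gcongr
        have h2 : (a + b) ^ 2 ≤ (s ^ 2)⁻¹ * (a + b) ^ 4 := by
          rw [inv_mul_eq_div, le_div_iff₀ (by positivity)]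
          have : s ^ 2 ≤ (a + b) ^ 2 := by gcongr
          calc (a + b) ^ 2 * s ^ 2 ≤ (a + b) ^ 2 * (a + b) ^ 2 := by gcongr
            _ = _ := by ring
        have h3 : (s ^ 2)⁻¹ * (a + b) ^ 4 ≤ (s ^ 2)⁻¹ * (8 * (a ^ 4 + b ^ 4)) := by gcongr
        have h4 : 0 ≤ s * |a - b| := by positivity
        linarith
    · simp only [Pi.add_apply]
      rw [integral_add I1 I2, integral_const_mul, integral_const_mul, integral_const_mul,
        integral_add i8 j8, hM']
      have := hM n
      gcongr
  rw [Metric.tendsto_atTop']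
  intro ε hε
  obtain ⟨s, hs0, hs⟩ : ∃ s : ℝ, 0 < s ∧ (s ^ 2)⁻¹ * M' < ε / 2 := by
    have h1 : Tendsto (fun s : ℝ => (s ^ 2)⁻¹ * M') atTop (𝓝 (0 * M')) :=
      ((tendsto_pow_atTop (by norm_num)).inv_tendsto_atTop).mul_const M'
    rw [zero_mul] at h1
    obtain ⟨s, hs⟩ := ((h1.eventually_lt_const (half_pos hε)).and (eventually_gt_atTop 0)).exists
    exact ⟨s, hs.2, hs.1⟩
  have h2 := hL1.const_mul s
  rw [mul_zero] at h2
  obtain ⟨N, hN⟩ := eventually_atTop.1 (h2.eventually_lt_const (half_pos hε))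
  refine ⟨N, fun n hn => ?_⟩
  rw [Real.dist_eq]
  have := key n s hs0
  have := hN n hn.le
  linarith

end Convergence

/-! ### Magnetic gradients and Sobolev inequalities in `H¹` -/

/-- The components of `(-i∇ + β 𝐀[|u|²]) u`, where `G` is the gradient of `u`. -/
noncomputable def magGrad (β : ℝ) (u : Plane → ℂ) (G : Fin 2 → Plane → ℂ) (i : Fin 2)
    (x : Plane) : ℂ :=
  -Complex.I * G i x + ((β * vecPot (fun y => ‖u y‖ ^ 2) x i : ℝ) : ℂ) * u x

theorem abs_coord_le_norm (z : Plane) (i : Fin 2) : |z i| ≤ ‖z‖ := by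
  simpa using PiLp.norm_apply_le z i

theorem aemeasurable_vecPot_coord {u : Plane → ℂ} (hu : AEStronglyMeasurable u volume)
    (β : ℝ) (i : Fin 2) :
    AEMeasurable (fun x => β * vecPot (fun y => ‖u y‖ ^ 2) x i) volume := by
  have h := (aestronglyMeasurable_vecPot (hu.norm.pow 2)).aemeasurable
  have h2 : Measurable fun z : Plane => z i := by fun_prop
  exact (h2.comp_aemeasurable h).const_mul β

theorem aestronglyMeasurable_magGrad {u : Plane → ℂ} {G : Fin 2 → Plane → ℂ} {β : ℝ} {i : Fin 2}
    (hu : AEStronglyMeasurable u volume) (hG : AEStronglyMeasurable (G i) volume) :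
    AEStronglyMeasurable (magGrad β u G i) volume := by
  refine (hG.const_mul _).add (AEStronglyMeasurable.mul ?_ hu)
  exact (Complex.measurable_ofReal.comp_aemeasurable
    (aemeasurable_vecPot_coord hu β i)).aestronglyMeasurable

theorem memLp_magGrad {u : Plane → ℂ} {G : Fin 2 → Plane → ℂ} {β : ℝ} {i : Fin 2}
    (hu : MemLp u 2 volume) (hu8 : MemLp u 8 volume) (hG : MemLp (G i) 2 volume) :
    MemLp (magGrad β u G i) 2 volume := by
  obtain ⟨B, hB⟩ := exists_vecPot_le hu hu8
  refine (hG.const_mul _).add (MemLp.of_le_mul (c := |β| * B) hu ?_ (Eventually.of_forall fun x => ?_))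
  · exact (Complex.measurable_ofReal.comp_aemeasurable
      (aemeasurable_vecPot_coord hu.1 β i)).aestronglyMeasurable.mul hu.1
  · rw [norm_mul, Complex.norm_real, Real.norm_eq_abs, abs_mul]
    gcongr
    exact (abs_coord_le_norm _ i).trans (hB x)

/-- Adding `i (Gₙ - G₀)` cancels the gradients and leaves `β (𝐀ₙ uₙ - 𝐀₀ u₀)`. This part converges
strongly without any convergence of gradients, so the lemma serves both strong and weak limits of
magnetic gradients. -/
theorem tendsto_eLpNorm_magGrad_sub_potential {u : ℕ → Plane → ℂ} {u₀ : Plane → ℂ}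
    {G : ℕ → Fin 2 → Plane → ℂ} {G₀ : Fin 2 → Plane → ℂ} (β : ℝ) (i : Fin 2)
    (hu : ∀ n, MemLp (u n) 2 volume) (hu₀ : MemLp u₀ 2 volume)
    (hu8 : ∀ n, MemLp (u n) 8 volume) (hu₀8 : MemLp u₀ 8 volume) {M : ℝ}
    (hM : ∀ n, ∫ x, ‖u n x‖ ^ 8 ≤ M)
    (hlim : Tendsto (fun n => eLpNorm (fun x => u n x - u₀ x) 2 volume) atTop (𝓝 0)) :
    Tendsto (fun n => eLpNorm (fun x => (magGrad β (u n) (G n) i x - magGrad β u₀ G₀ i x)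
      + Complex.I * (G n i x - G₀ i x)) 2 volume) atTop (𝓝 0) := by
  obtain ⟨B, hB⟩ := exists_vecPot_le hu₀ hu₀8
  have hB0 : 0 ≤ B := (norm_nonneg _).trans (hB 0)
  rw [ENNReal.tendsto_nhds_zero]
  intro ε hε
  obtain ⟨δ, hδ0, hδ⟩ : ∃ δ : ℝ, 0 < δ ∧
      ENNReal.ofReal (|β| * δ) * eLpNorm u₀ 2 volume < ε / 2 := by
    have h1 : Tendsto (fun δ : ℝ => ENNReal.ofReal (|β| * δ) * eLpNorm u₀ 2 volume) (𝓝[>] 0)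
        (𝓝 (ENNReal.ofReal (|β| * 0) * eLpNorm u₀ 2 volume)) := by
      refine ENNReal.Tendsto.mul_const (ENNReal.tendsto_ofReal ?_) (Or.inr hu₀.2.ne)
      exact (tendsto_id.mono_left nhdsWithin_le_nhds).const_mul _
    rw [mul_zero, ENNReal.ofReal_zero, zero_mul] at h1
    obtain ⟨δ, h⟩ := ((h1.eventually_lt_const (ENNReal.half_pos hε.ne')).and
      self_mem_nhdsWithin).exists
    exact ⟨δ, h.2, h.1⟩
  have h2 : Tendsto (fun n => ENNReal.ofReal (|β| * (B + δ)) *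
      eLpNorm (fun x => u n x - u₀ x) 2 volume) atTop (𝓝 0) := by
    have := ENNReal.Tendsto.const_mul (a := ENNReal.ofReal (|β| * (B + δ))) hlim
      (Or.inr ENNReal.ofReal_ne_top)
    simpa using this
  filter_upwards [h2.eventually_le_const (ENNReal.half_pos hε.ne'),
    eventually_vecPot_sub_le hu hu₀ hu8 hu₀8 hM hlim hδ0] with n hn hA
  set A : Plane → Plane := vecPot (fun y => ‖u n y‖ ^ 2) with hAdef
  set A₀ : Plane → Plane := vecPot (fun y => ‖u₀ y‖ ^ 2) with hA₀def
  -- `𝐀ₙuₙ - 𝐀₀u₀ = 𝐀ₙ(uₙ - u₀) + (𝐀ₙ - 𝐀₀)u₀`: the first term is small as `𝐀ₙ` is bounded, the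
  -- second by uniform convergence.
  have e : (fun x => (magGrad β (u n) (G n) i x - magGrad β u₀ G₀ i x)
      + Complex.I * (G n i x - G₀ i x)) =
      (fun x => ((β * A x i : ℝ) : ℂ) * (u n x - u₀ x)) +
        fun x => (((β * A x i : ℝ) : ℂ) - ((β * A₀ x i : ℝ) : ℂ)) * u₀ x := by
    ext x
    simp only [magGrad, ← hAdef, ← hA₀def, Pi.add_apply]
    ring
  have mA : AEStronglyMeasurable (fun x => ((β * A x i : ℝ) : ℂ)) volume :=
    (Complex.measurable_ofReal.comp_aemeasurable
      (aemeasurable_vecPot_coord (hu n).1 β i)).aestronglyMeasurable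
  have mA₀ : AEStronglyMeasurable (fun x => ((β * A₀ x i : ℝ) : ℂ)) volume :=
    (Complex.measurable_ofReal.comp_aemeasurable
      (aemeasurable_vecPot_coord hu₀.1 β i)).aestronglyMeasurable
  rw [e]
  refine (eLpNorm_add_le (mA.mul ((hu n).1.sub hu₀.1)) ((mA.sub mA₀).mul hu₀.1)
    (by norm_num)).trans ?_
  rw [← ENNReal.add_halves ε]
  refine add_le_add (le_trans ?_ hn) (le_trans ?_ hδ.le)
  · refine eLpNorm_le_mul_eLpNorm_of_ae_le_mul (Eventually.of_forall fun x => ?_) 2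
    simp only [Pi.mul_apply, Pi.sub_apply]
    rw [norm_mul, Complex.norm_real, Real.norm_eq_abs, abs_mul]
    gcongr
    refine (abs_coord_le_norm _ i).trans ?_
    have h3 := norm_add_le (A x - A₀ x) (A₀ x)
    rw [sub_add_cancel] at h3
    linarith [hA x, hB x]
  · refine eLpNorm_le_mul_eLpNorm_of_ae_le_mul (Eventually.of_forall fun x => ?_) 2
    simp only [Pi.mul_apply, Pi.sub_apply]
    rw [norm_mul, ← Complex.ofReal_sub, Complex.norm_real, Real.norm_eq_abs, ← mul_sub, abs_mul]
    gcongr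
    have := abs_coord_le_norm (A x - A₀ x) i
    simp only [PiLp.sub_apply] at this
    exact this.trans (hA x)

/-- Fatou's lemma along an almost everywhere convergent subsequence. -/
theorem lintegral_pow_le_of_tendsto {u : ℕ → Plane → ℂ} {u₀ : Plane → ℂ} {p : ℕ}
    (hu : ∀ n, AEStronglyMeasurable (u n) volume) (hu₀ : AEStronglyMeasurable u₀ volume)
    (hlim : Tendsto (fun n => eLpNorm (fun x => u n x - u₀ x) 2 volume) atTop (𝓝 0))
    {c : ℕ → ℝ≥0∞} {c₀ : ℝ≥0∞} (hc : Tendsto c atTop (𝓝 c₀))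
    (hle : ∀ n, ∫⁻ x, ‖u n x‖ₑ ^ p ≤ c n) : ∫⁻ x, ‖u₀ x‖ₑ ^ p ≤ c₀ := by
  obtain ⟨ns, hns, hae⟩ := (tendstoInMeasure_of_tendsto_eLpNorm (by norm_num) hu hu₀
    hlim).exists_seq_tendsto_ae
  calc ∫⁻ x, ‖u₀ x‖ₑ ^ p = ∫⁻ x, liminf (fun n => ‖u (ns n) x‖ₑ ^ p) atTop := by
        refine lintegral_congr_ae ?_
        filter_upwards [hae] with x hx
        exact (ENNReal.Tendsto.pow hx.enorm).liminf_eq.symm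
    _ ≤ liminf (fun n => ∫⁻ x, ‖u (ns n) x‖ₑ ^ p) atTop :=
        lintegral_liminf_le' fun n => (hu (ns n)).enorm.pow_const p
    _ ≤ liminf (fun n => c (ns n)) atTop := liminf_le_liminf (Eventually.of_forall fun n => hle _)
    _ = c₀ := (hc.comp hns.tendsto_atTop).liminf_eq

theorem tendsto_eLpNorm_of_tendsto_sub {E : Type*} [NormedAddCommGroup E] {f : ℕ → Plane → E}
    {f₀ : Plane → E} (hf : ∀ n, AEStronglyMeasurable (f n) volume) (hf₀ : MemLp f₀ 2 volume)
    (h : Tendsto (fun n => eLpNorm (fun x => f n x - f₀ x) 2 volume) atTop (𝓝 0)) :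
    Tendsto (fun n => eLpNorm (f n) 2 volume) atTop (𝓝 (eLpNorm f₀ 2 volume)) := by
  have h1 : ∀ n, eLpNorm (f n) 2 volume ≤ eLpNorm f₀ 2 volume +
      eLpNorm (fun x => f n x - f₀ x) 2 volume := fun n => by
    have e : f n = f₀ + fun x => f n x - f₀ x := by ext x; simp
    conv_lhs => rw [e]
    exact eLpNorm_add_le hf₀.1 ((hf n).sub hf₀.1) (by norm_num)
  have h2 : ∀ n, eLpNorm f₀ 2 volume - eLpNorm (fun x => f n x - f₀ x) 2 volume ≤
      eLpNorm (f n) 2 volume := fun n => by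
    rw [tsub_le_iff_right]
    have e : f₀ = f n - fun x => f n x - f₀ x := by ext x; simp
    conv_lhs => rw [e]
    exact eLpNorm_sub_le (hf n) ((hf n).sub hf₀.1) (by norm_num)
  refine tendsto_of_tendsto_of_tendsto_of_le_of_le ?_ ?_ h2 h1
  · have := ENNReal.Tendsto.sub (tendsto_const_nhds (x := eLpNorm f₀ 2 volume) (f := atTop)) h
      (Or.inl hf₀.2.ne)
    simpa using this
  · have := (tendsto_const_nhds (x := eLpNorm f₀ 2 volume) (f := atTop)).add h
    simpa using this

theorem tendsto_lintegral_sum_sq {f : ℕ → Fin 2 → Plane → ℂ}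
    {f₀ : Fin 2 → Plane → ℂ} (hf : ∀ n i, AEStronglyMeasurable (f n i) volume)
    (hf₀ : ∀ i, MemLp (f₀ i) 2 volume)
    (h : ∀ i, Tendsto (fun n => eLpNorm (fun x => f n i x - f₀ i x) 2 volume) atTop (𝓝 0)) :
    Tendsto (fun n => ∫⁻ x, ∑ i, ‖f n i x‖ₑ ^ 2) atTop (𝓝 (∫⁻ x, ∑ i, ‖f₀ i x‖ₑ ^ 2)) := by
  have e : ∀ g : Fin 2 → Plane → ℂ, (∀ i, AEStronglyMeasurable (g i) volume) →
      ∫⁻ x, ∑ i, ‖g i x‖ₑ ^ 2 = ∑ i, eLpNorm (g i) 2 volume ^ 2 := fun g hg => by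
    rw [lintegral_finsetSum' _ fun i _ => (hg i).enorm.pow_const 2]
    simp only [eLpNorm_two_sq]
  rw [e _ fun i => (hf₀ i).1]
  simp only [fun n => e (f n) (hf n)]
  exact tendsto_finsetSum _ fun i _ =>
    ENNReal.Tendsto.pow (tendsto_eLpNorm_of_tendsto_sub (fun n => hf n i) (hf₀ i) (h i))

theorem tendsto_eLpNorm_magGrad_sub {u : ℕ → Plane → ℂ} {u₀ : Plane → ℂ}
    {G : ℕ → Fin 2 → Plane → ℂ} {G₀ : Fin 2 → Plane → ℂ} (β : ℝ) (i : Fin 2)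
    (hu : ∀ n, MemLp (u n) 2 volume) (hu₀ : MemLp u₀ 2 volume)
    (hu8 : ∀ n, MemLp (u n) 8 volume) (hu₀8 : MemLp u₀ 8 volume) {M : ℝ}
    (hM : ∀ n, ∫ x, ‖u n x‖ ^ 8 ≤ M)
    (hlim : Tendsto (fun n => eLpNorm (fun x => u n x - u₀ x) 2 volume) atTop (𝓝 0))
    (hG : ∀ n, AEStronglyMeasurable (G n i) volume) (hG₀ : AEStronglyMeasurable (G₀ i) volume)
    (hGlim : Tendsto (fun n => eLpNorm (fun x => G n i x - G₀ i x) 2 volume) atTop (𝓝 0)) :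
    Tendsto (fun n => eLpNorm (fun x => magGrad β (u n) (G n) i x - magGrad β u₀ G₀ i x)
      2 volume) atTop (𝓝 0) := by
  have h := tendsto_eLpNorm_magGrad_sub_potential (G := G) (G₀ := G₀) β i hu hu₀ hu8 hu₀8 hM hlim
  have h2 := h.add hGlim
  rw [add_zero] at h2
  refine tendsto_of_tendsto_of_tendsto_of_le_of_le tendsto_const_nhds h2 (fun _ => zero_le)
    fun n => ?_
  have e : (fun x => magGrad β (u n) (G n) i x - magGrad β u₀ G₀ i x) =
      (fun x => (magGrad β (u n) (G n) i x - magGrad β u₀ G₀ i x)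
        + Complex.I * (G n i x - G₀ i x)) - fun x => Complex.I * (G n i x - G₀ i x) := by
    ext x; simp
  have hm := (aestronglyMeasurable_magGrad (β := β) (hu n).1 (hG n)).sub
    (aestronglyMeasurable_magGrad (β := β) hu₀.1 hG₀)
  have hm2 : AEStronglyMeasurable (fun x => Complex.I * (G n i x - G₀ i x)) volume :=
    ((hG n).sub hG₀).const_mul _
  rw [e]
  refine (eLpNorm_sub_le (hm.add hm2) hm2 (by norm_num)).trans ?_
  gcongr
  · exact le_rfl
  · exact eLpNorm_mono fun x => by simp

/-- Approximation in `H¹` by test functions that are bounded in `L⁸`. -/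
theorem IsWeakGradient.exists_isTest_seq_bounded {u : Plane → ℂ} {G : Fin 2 → Plane → ℂ}
    (hu : MemLp u 2 volume) (hG : IsWeakGradient u G) :
    ∃ (v : ℕ → Plane → ℂ) (M : ℝ), (∀ n, IsTest (v n)) ∧ (∀ n, ∫ x, ‖v n x‖ ^ 8 ≤ M) ∧
      Tendsto (fun n => eLpNorm (fun x => v n x - u x) 2 volume) atTop (𝓝 0) ∧
      ∀ i, Tendsto (fun n => eLpNorm (fun x => pd i (v n) x - G i x) 2 volume) atTop (𝓝 0) := by
  obtain ⟨v, hv, h1, h2⟩ := hG.exists_isTest_seq hu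
  obtain ⟨C, hC⟩ := exists_magnetic_sobolev
  have hK := tendsto_lintegral_sum_sq (f := fun n i x => pd i (v n) x)
    (fun n i => ((hv n).isTest_pd i).continuous.aestronglyMeasurable) (fun i => (hG i).1) h2
  have hN := ENNReal.Tendsto.pow (n := 2)
    (tendsto_eLpNorm_of_tendsto_sub (fun n => (hv n).continuous.aestronglyMeasurable) hu h1)
  set K : ℝ≥0∞ := ∫⁻ x, ∑ i, ‖G i x‖ₑ ^ 2 with hKdef
  have hKfin : K ≠ ⊤ := by
    rw [hKdef, lintegral_finsetSum' _ fun i _ => (hG i).1.1.enorm.pow_const 2]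
    simp only [← eLpNorm_two_sq]
    exact ENNReal.sum_ne_top.2 fun i _ => ENNReal.pow_ne_top (hG i).1.2.ne
  have hNfin : eLpNorm u 2 volume ^ 2 ≠ ⊤ := ENNReal.pow_ne_top hu.2.ne
  have hb : ∀ n, ∫⁻ x, ‖v n x‖ₑ ^ 8 ≤ C * (C * eLpNorm (v n) 2 volume ^ 2 *
      ∫⁻ x, ∑ i, ‖pd i (v n) x‖ₑ ^ 2) * (∫⁻ x, ∑ i, ‖pd i (v n) x‖ₑ ^ 2) ^ 2 := by
    intro n
    -- With zero potential the magnetic inequalities are the ordinary ones; the `L⁴` bound is fed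
    -- into the `L⁸` bound.
    have h := hC (v n) (fun _ _ => 0) (hv n) (fun _ => aemeasurable_const)
    simp only [Complex.ofReal_zero, zero_mul, add_zero, enorm_mul, enorm_neg] at h
    have hI : ‖Complex.I‖ₑ = 1 := by
      rw [← ofReal_norm, Complex.norm_I, ENNReal.ofReal_one]
    simp only [hI, one_mul] at h
    rw [eLpNorm_two_sq]
    refine h.2.trans ?_
    gcongr
    exact h.1
  have hlimb : Tendsto (fun n => C * (C * eLpNorm (v n) 2 volume ^ 2 *
      ∫⁻ x, ∑ i, ‖pd i (v n) x‖ₑ ^ 2) * (∫⁻ x, ∑ i, ‖pd i (v n) x‖ₑ ^ 2) ^ 2) atTop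
      (𝓝 (C * (C * eLpNorm u 2 volume ^ 2 * K) * K ^ 2)) := by
    refine ENNReal.Tendsto.mul (ENNReal.Tendsto.const_mul (ENNReal.Tendsto.mul
      (ENNReal.Tendsto.const_mul hN (Or.inr ENNReal.coe_ne_top)) (Or.inr hKfin) hK
      (Or.inr ?_)) (Or.inr ENNReal.coe_ne_top)) (Or.inr ?_) (ENNReal.Tendsto.pow hK) (Or.inr ?_)
    · exact ENNReal.mul_ne_top ENNReal.coe_ne_top hNfin
    · exact ENNReal.pow_ne_top hKfin
    · exact ENNReal.mul_ne_top ENNReal.coe_ne_top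
        (ENNReal.mul_ne_top (ENNReal.mul_ne_top ENNReal.coe_ne_top hNfin) hKfin)
  set L := C * (C * eLpNorm u 2 volume ^ 2 * K) * K ^ 2 with hL
  have hLfin : L ≠ ⊤ := ENNReal.mul_ne_top (ENNReal.mul_ne_top ENNReal.coe_ne_top
    (ENNReal.mul_ne_top (ENNReal.mul_ne_top ENNReal.coe_ne_top hNfin) hKfin))
    (ENNReal.pow_ne_top hKfin)
  obtain ⟨N, hNN⟩ := eventually_atTop.1 (hlimb.eventually_le_const
    (ENNReal.lt_add_right hLfin one_ne_zero))
  -- The bound holds only from `N` on, so the sequence is shifted.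
  refine ⟨fun n => v (n + N), (L + 1).toReal, fun n => hv _, fun n => ?_,
    (tendsto_add_atTop_iff_nat N).2 h1, fun i => (tendsto_add_atTop_iff_nat N).2 (h2 i)⟩
  have h3 := (hb (n + N)).trans (hNN _ (Nat.le_add_left _ _))
  have h8 : Integrable (fun x => ‖v (n + N) x‖ ^ 8) :=
    (memLp_natCast_iff (by norm_num) (hv _).continuous.aestronglyMeasurable).1 ((hv _).memLp 8)
  rw [lintegral_enorm_pow_eq h8] at h3
  exact (ENNReal.ofReal_le_iff_le_toReal (by simp [hLfin])).1 h3

theorem IsWeakGradient.memLp_eight {u : Plane → ℂ} {G : Fin 2 → Plane → ℂ}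
    (hu : MemLp u 2 volume) (hG : IsWeakGradient u G) : MemLp u 8 volume := by
  obtain ⟨v, M, hv, hM, h1, -⟩ := hG.exists_isTest_seq_bounded hu
  have h := lintegral_pow_le_of_tendsto (p := 8) (c := fun _ => ENNReal.ofReal M)
    (fun n => (hv n).continuous.aestronglyMeasurable) hu.1 h1 tendsto_const_nhds fun n => by
      have h8 : Integrable (fun x => ‖v n x‖ ^ 8) :=
        (memLp_natCast_iff (by norm_num) (hv _).continuous.aestronglyMeasurable).1 ((hv _).memLp 8)
      rw [lintegral_enorm_pow_eq h8]
      exact ENNReal.ofReal_le_ofReal (hM n)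
  refine ⟨hu.1, ?_⟩
  have e := eLpNorm_pow_eq_lintegral u (n := 8) (by norm_num)
  by_contra hcon
  rw [not_lt, top_le_iff] at hcon
  have h8 : ((8 : ℕ) : ℝ≥0∞) = 8 := by norm_num
  rw [h8, hcon] at e
  rw [← e] at h
  simp at h

/-- The kinetic energy `∫ |(-i∇ + β 𝐀[|u|²]) u|²` for a given gradient of `u`. -/
noncomputable def kinEnergy (β : ℝ) (u : Plane → ℂ) (G : Fin 2 → Plane → ℂ) : ℝ :=
  ∫ x, ∑ i, ‖magGrad β u G i x‖ ^ 2

theorem integrable_sum_magGrad_sq {u : Plane → ℂ} {G : Fin 2 → Plane → ℂ}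
    (hu : MemLp u 2 volume) (hG : IsWeakGradient u G) (β : ℝ) :
    Integrable (fun x => ∑ i, ‖magGrad β u G i x‖ ^ 2) := by
  refine integrable_finsetSum _ fun i _ => ?_
  have h := memLp_magGrad (β := β) (i := i) hu (hG.memLp_eight hu) (hG i).1
  exact (memLp_natCast_iff (by norm_num) h.1).1 h

theorem kineticDensity_ae_eq {u : Plane → ℂ} {G : Fin 2 → Plane → ℂ}
    (hG : IsWeakGradient u G) (β : ℝ) :
    kineticDensity β u =ᵐ[volume] fun x => ∑ i, ‖magGrad β u G i x‖ ^ 2 := by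
  filter_upwards [hG.weakGradient_ae_eq 0, hG.weakGradient_ae_eq 1] with x h0 h1
  simp [kineticDensity, magGrad, Fin.sum_univ_two, h0, h1]

theorem integral_kineticDensity {u : Plane → ℂ} {G : Fin 2 → Plane → ℂ}
    (hG : IsWeakGradient u G) (β : ℝ) : ∫ x, kineticDensity β u x = kinEnergy β u G :=
  integral_congr_ae (kineticDensity_ae_eq hG β)

theorem kinEnergy_nonneg (β : ℝ) (u : Plane → ℂ) (G : Fin 2 → Plane → ℂ) :
    0 ≤ kinEnergy β u G := integral_nonneg fun x => by positivity

theorem ofReal_kinEnergy {u : Plane → ℂ} {G : Fin 2 → Plane → ℂ}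
    (hu : MemLp u 2 volume) (hG : IsWeakGradient u G) (β : ℝ) :
    ENNReal.ofReal (kinEnergy β u G) = ∫⁻ x, ∑ i, ‖magGrad β u G i x‖ₑ ^ 2 := by
  unfold kinEnergy
  rw [ofReal_integral_eq_lintegral_ofReal (integrable_sum_magGrad_sq hu hG β)
    (Eventually.of_forall fun x => by positivity)]
  refine lintegral_congr fun x => ?_
  rw [ENNReal.ofReal_sum_of_nonneg fun i _ => by positivity]
  refine Finset.sum_congr rfl fun i _ => ?_
  rw [ENNReal.ofReal_pow (norm_nonneg _), ofReal_norm]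

/-- The energy terms are continuous along a sequence of test functions converging in `H¹`. -/
theorem IsWeakGradient.exists_isTest_seq_energy {u : Plane → ℂ} {G : Fin 2 → Plane → ℂ}
    (hu : MemLp u 2 volume) (hG : IsWeakGradient u G) (β : ℝ) :
    ∃ (v : ℕ → Plane → ℂ), (∀ n, IsTest (v n)) ∧
      Tendsto (fun n => eLpNorm (fun x => v n x - u x) 2 volume) atTop (𝓝 0) ∧
      Tendsto (fun n => ∫ x, ‖v n x‖ ^ 2) atTop (𝓝 (∫ x, ‖u x‖ ^ 2)) ∧
      Tendsto (fun n => ∫ x, ‖v n x‖ ^ 4) atTop (𝓝 (∫ x, ‖u x‖ ^ 4)) ∧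
      Tendsto (fun n => kinEnergy β (v n) fun i => pd i (v n)) atTop (𝓝 (kinEnergy β u G)) := by
  obtain ⟨v, M, hv, hM, h1, h2⟩ := hG.exists_isTest_seq_bounded hu
  have hu8 := hG.memLp_eight hu
  refine ⟨v, hv, h1, ?_, tendsto_integral_norm_pow_four (fun n => (hv n).memLp 2) hu
    (fun n => (hv n).memLp 8) hu8 hM h1, ?_⟩
  · have h3 := tendsto_integral_abs_normSq_sub (fun n => (hv n).memLp 2) hu h1
    rw [tendsto_iff_dist_tendsto_zero]
    refine squeeze_zero (fun _ => dist_nonneg) (fun n => ?_) h3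
    have i1 := integrable_norm_pow_of_le_eight ((hv n).memLp 2) ((hv n).memLp 8) (n := 2)
      (by norm_num) (by norm_num)
    have i2 := integrable_norm_pow_of_le_eight hu hu8 (n := 2) (by norm_num) (by norm_num)
    rw [Real.dist_eq, ← integral_sub i1 i2]
    exact abs_integral_le_integral_abs
  · have h4 := tendsto_lintegral_sum_sq (f := fun n i => magGrad β (v n) (fun i => pd i (v n)) i)
      (f₀ := fun i => magGrad β u G i)
      (fun n i => aestronglyMeasurable_magGrad ((hv n).memLp 2).1
        ((hv n).isTest_pd i).continuous.aestronglyMeasurable)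
      (fun i => memLp_magGrad hu hu8 (hG i).1)
      (fun i => tendsto_eLpNorm_magGrad_sub β i (fun n => (hv n).memLp 2) hu
        (fun n => (hv n).memLp 8) hu8 hM h1
        (fun n => ((hv n).isTest_pd i).continuous.aestronglyMeasurable) (hG i).1.1 (h2 i))
    simp only [fun n => (ofReal_kinEnergy ((hv n).memLp 2) (hv n).isWeakGradient β).symm,
      ← ofReal_kinEnergy hu hG β] at h4
    have h5 := (ENNReal.tendsto_toReal ENNReal.ofReal_ne_top).comp h4
    simp only [ENNReal.toReal_ofReal (kinEnergy_nonneg _ _ _)] at h5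
    exact h5.congr fun n => ENNReal.toReal_ofReal (kinEnergy_nonneg _ _ _)

/-- Magnetic Gagliardo–Nirenberg inequalities in `H¹`. -/
theorem exists_sobolev_H1 : ∃ C : ℝ, 0 ≤ C ∧ ∀ (β : ℝ) (u : Plane → ℂ) (G : Fin 2 → Plane → ℂ),
    MemLp u 2 volume → IsWeakGradient u G →
    ∫ x, ‖u x‖ ^ 4 ≤ C * (∫ x, ‖u x‖ ^ 2) * kinEnergy β u G ∧
    ∫ x, ‖u x‖ ^ 8 ≤ C * (∫ x, ‖u x‖ ^ 4) * kinEnergy β u G ^ 2 := by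
  obtain ⟨C, hC⟩ := exists_magnetic_sobolev
  refine ⟨C, C.2, fun β u G hu hG => ?_⟩
  obtain ⟨v, hv, h1, hN, h4, hK⟩ := hG.exists_isTest_seq_energy hu β
  have hvint : ∀ n (p : ℕ), p ≠ 0 → Integrable (fun x => ‖v n x‖ ^ p) := fun n p hp =>
    (memLp_natCast_iff hp (hv _).continuous.aestronglyMeasurable).1 ((hv _).memLp p)
  have hu8 := hG.memLp_eight hu
  have key : ∀ n, (∫ x, ‖v n x‖ ^ 4 ≤
        C * (∫ x, ‖v n x‖ ^ 2) * kinEnergy β (v n) fun i => pd i (v n)) ∧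
      ∫⁻ x, ‖v n x‖ₑ ^ 8 ≤ ENNReal.ofReal
        (C * (∫ x, ‖v n x‖ ^ 4) * (kinEnergy β (v n) fun i => pd i (v n)) ^ 2) := by
    intro n
    have h := hC (v n) (fun i x => β * vecPot (fun y => ‖v n y‖ ^ 2) x i) (hv n)
      (fun i => aemeasurable_vecPot_coord ((hv n).memLp 2).1 β i)
    have e := ofReal_kinEnergy ((hv n).memLp 2) (hv n).isWeakGradient β
    simp only [magGrad] at e
    rw [← e, lintegral_enorm_pow_eq (hvint n 4 (by norm_num)),
      lintegral_enorm_pow_eq (hvint n 2 (by norm_num))] at h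
    have hCe : (C : ℝ≥0∞) = ENNReal.ofReal (C : ℝ) := (ENNReal.ofReal_coe_nnreal).symm
    have p2 : 0 ≤ ∫ x, ‖v n x‖ ^ 2 := integral_nonneg fun x => by positivity
    have p4 : 0 ≤ ∫ x, ‖v n x‖ ^ 4 := integral_nonneg fun x => by positivity
    have pK := kinEnergy_nonneg β (v n) (fun i => pd i (v n))
    have pC : (0 : ℝ) ≤ C := C.2
    rw [hCe, ← ENNReal.ofReal_mul pC, ← ENNReal.ofReal_mul (by positivity),
      ← ENNReal.ofReal_mul pC, ← ENNReal.ofReal_pow pK, ← ENNReal.ofReal_mul (by positivity)] at h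
    refine ⟨?_, h.2⟩
    exact (ENNReal.ofReal_le_ofReal_iff (by positivity)).1 h.1
  constructor
  · exact le_of_tendsto_of_tendsto h4 ((hN.const_mul _).mul hK)
      (Eventually.of_forall fun n => (key n).1)
  -- The eighth powers are only bounded along the approximation, so Fatou replaces convergence on
  -- the left.
  · have h5 := lintegral_pow_le_of_tendsto (p := 8)
      (fun n => (hv n).continuous.aestronglyMeasurable) hu.1 h1
      (ENNReal.tendsto_ofReal ((h4.const_mul (C : ℝ)).mul (hK.pow 2))) fun n => (key n).2
    rw [lintegral_enorm_pow_eq (integrable_norm_pow_of_le_eight hu hu8 (by norm_num) le_rfl)] at h5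
    have p4 : 0 ≤ ∫ x, ‖u x‖ ^ 4 := integral_nonneg fun x => by positivity
    have pK := kinEnergy_nonneg β u G
    exact (ENNReal.ofReal_le_ofReal_iff (mul_nonneg (mul_nonneg C.2 p4) (sq_nonneg _))).1 h5

/-! ### The curl of the vector potential -/

theorem integral_plane_eq_integral_prod {E : Type*} [NormedAddCommGroup E] [NormedSpace ℝ E]
    (f : Plane → E) : ∫ z, f z = ∫ p : ℝ × ℝ, f !₂[p.1, p.2] := by
  have h1 := (EuclideanSpace.volume_preserving_symm_measurableEquiv_toLp (Fin 2)).symm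
  have h2 := (volume_preserving_finTwoArrow ℝ).symm
  rw [← h1.integral_comp', ← h2.integral_comp']
  rfl

/-- The weak form of `div (z / |z|²) = 2πδ`. In polar coordinates the Jacobian cancels the
singularity and leaves a radial derivative; each ray contributes `-f y`, and the angles have total
length `2π`. -/
theorem integral_fderiv_radial {f : Plane → ℝ} (hf : ContDiff ℝ 1 f) (hc : HasCompactSupport f)
    (y : Plane) : ∫ z, (‖z‖ ^ 2)⁻¹ * fderiv ℝ f (y + z) z = -(2 * Real.pi) * f y := by
  set e : ℝ → Plane := fun θ => !₂[Real.cos θ, Real.sin θ] with he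
  have hec : Continuous e := by
    rw [he]; fun_prop
  have hen : ∀ θ, ‖e θ‖ = 1 := fun θ => by
    simp [he, EuclideanSpace.norm_eq]
  rw [integral_plane_eq_integral_prod, ← integral_comp_polarCoord_symm]
  set F : ℝ × ℝ → ℝ := fun p => fderiv ℝ f (y + p.1 • e p.2) (e p.2) with hF
  have hFc : Continuous F := by
    have : Continuous fun p : ℝ × ℝ => fderiv ℝ f (y + p.1 • e p.2) :=
      (hf.continuous_fderiv (by simp)).comp (by fun_prop)
    exact this.clm_apply (hec.comp continuous_snd)
  have h1 : ∫ p in polarCoord.target, p.1 •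
      ((‖(!₂[(polarCoord.symm p).1, (polarCoord.symm p).2] : Plane)‖ ^ 2)⁻¹ *
        fderiv ℝ f (y + !₂[(polarCoord.symm p).1, (polarCoord.symm p).2])
          !₂[(polarCoord.symm p).1, (polarCoord.symm p).2]) = ∫ p in polarCoord.target, F p := by
    refine setIntegral_congr_fun polarCoord.open_target.measurableSet fun p hp => ?_
    have hp0 : 0 < p.1 := hp.1
    have hz : (!₂[(polarCoord.symm p).1, (polarCoord.symm p).2] : Plane) = p.1 • e p.2 := by
      ext i; fin_cases i <;> simp [he]
    simp only [hz, map_smul, smul_eq_mul, norm_smul, hen, Real.norm_of_nonneg hp0.le, hF]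
    field_simp
  rw [h1]
  obtain ⟨R, hR⟩ := (Metric.isBounded_iff_subset_closedBall y).1
    (hc.fderiv ℝ).isCompact.isBounded
  have hF0 : ∀ p : ℝ × ℝ, 0 < p.1 → R < p.1 → F p = 0 := by
    intro p hp0 hp
    have : fderiv ℝ f (y + p.1 • e p.2) = 0 := by
      apply image_eq_zero_of_notMem_tsupport
      intro hmem
      have := hR hmem
      rw [Metric.mem_closedBall, dist_eq_norm, add_sub_cancel_left, norm_smul, hen,
        Real.norm_of_nonneg hp0.le] at this
      linarith
    simp [hF, this]
  -- `F` is continuous and vanishes for radii above `R`, so a compact rectangle suffices.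
  have hint : IntegrableOn F (Set.Ioi (0 : ℝ) ×ˢ Set.Ioo (-Real.pi) Real.pi) := by
    have h2 : IntegrableOn F (Set.Icc 0 R ×ˢ Set.Icc (-Real.pi) Real.pi) :=
      hFc.continuousOn.integrableOn_compact (isCompact_Icc.prod isCompact_Icc)
    refine h2.of_forall_sdiff_eq_zero (measurableSet_Ioi.prod measurableSet_Ioo) fun p hp => ?_
    obtain ⟨⟨hp1, hp2⟩, hp3⟩ := hp
    refine hF0 p hp1 ?_
    by_contra hcon
    exact hp3 ⟨⟨(Set.mem_Ioi.1 hp1).le, not_lt.1 hcon⟩, Set.Ioo_subset_Icc_self hp2⟩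
  have htar : polarCoord.target = Set.Ioi (0 : ℝ) ×ˢ Set.Ioo (-Real.pi) Real.pi := rfl
  rw [htar]
  rw [IntegrableOn, Measure.volume_eq_prod, ← Measure.prod_restrict] at hint
  rw [Measure.volume_eq_prod, ← Measure.prod_restrict, integral_prod_symm _ hint]
  have hr : ∀ θ, ∫ r in Set.Ioi (0 : ℝ), F (r, θ) = - f y := by
    intro θ
    set g : ℝ → ℝ := fun r => f (y + r • e θ) with hg
    have hgd : ∀ r, HasDerivAt g (F (r, θ)) r := by
      intro r
      have hl : HasDerivAt (fun r : ℝ => y + r • e θ) (e θ) r := by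
        simpa using ((hasDerivAt_id r).smul_const (e θ)).const_add y
      exact ((hf.differentiable (by simp)) _).hasFDerivAt.comp_hasDerivAt r hl
    have hgc : ContDiff ℝ 1 g := hf.comp (by fun_prop)
    have hgs : HasCompactSupport g := by
      refine HasCompactSupport.comp_isClosedEmbedding hc
        (g := fun r : ℝ => y + r • e θ) ?_
      refine Isometry.isClosedEmbedding ?_
      refine Isometry.of_dist_eq fun a b => ?_
      rw [dist_add_left, dist_eq_norm, ← sub_smul, norm_smul, hen, mul_one, Real.dist_eq]
      rfl
    have h3 := HasCompactSupport.integral_Ioi_deriv_eq hgc hgs 0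
    have h4 : deriv g = fun r => F (r, θ) := funext fun r => (hgd r).deriv
    rw [h4] at h3
    rw [h3]
    simp [hg]
  simp only [hr]
  rw [setIntegral_const, Real.volume_real_Ioo_of_le (by linarith [Real.pi_pos]), smul_eq_mul]
  ring

theorem fderiv_apply_eq_partialDeriv (ρ : Plane → ℝ) (x z : Plane) :
    fderiv ℝ ρ x z = z 0 * partialDeriv 0 ρ x + z 1 * partialDeriv 1 ρ x := by
  have hz : z = z 0 • (EuclideanSpace.single 0 1 : Plane)
      + z 1 • (EuclideanSpace.single 1 1 : Plane) := by
    ext j; fin_cases j <;> simp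
  conv_lhs => rw [hz]
  rw [map_add, map_smul, map_smul]
  rfl

/-- Crossing the rotated kernel with `(a, b)` gives the inner product of `x - y` with `(a, b)`. For
`(a, b) = ∇ρ x` this is a derivative in the direction `x - y`. -/
theorem vecPot_cross_eq_integral {ρ : Plane → ℝ} {x : Plane}
    (h : Integrable (fun y => ρ y • gradPerp w₀ (x - y))) (a b : ℝ) :
    vecPot ρ x 1 * a - vecPot ρ x 0 * b =
      ∫ y, ρ y * ((‖x - y‖ ^ 2)⁻¹ * ((x - y) 0 * a + (x - y) 1 * b)) := by
  have h1 : vecPot ρ x 1 * a - vecPot ρ x 0 * b = (a • EuclideanSpace.proj (𝕜 := ℝ) (1 : Fin 2)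
      - b • EuclideanSpace.proj (𝕜 := ℝ) (0 : Fin 2) : Plane →L[ℝ] ℝ) (vecPot ρ x) := by
    simp; ring
  rw [h1, vecPot, ← ContinuousLinearMap.integral_comp_comm _ h]
  refine integral_congr_ae (Eventually.of_forall fun y => ?_)
  have hp0 : perp (x - y) 0 = -(x - y) 1 := rfl
  have hp1 : perp (x - y) 1 = (x - y) 0 := rfl
  simp only [gradPerp_w₀, sub_apply, smul_apply,
    PiLp.proj_apply, PiLp.smul_apply, smul_eq_mul, hp0, hp1]
  ring

/-- The integrand of the double integral that represents `∫ 𝐀[ρ]^⊥ · ∇ρ`. -/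
noncomputable def curlIntegrand (ρ : Plane → ℝ) (x y : Plane) : ℝ :=
  ρ y * ((‖x - y‖ ^ 2)⁻¹ * fderiv ℝ ρ x (x - y))

theorem norm_curlIntegrand_le (ρ : Plane → ℝ) (x y : Plane) :
    ‖curlIntegrand ρ x y‖ ≤ ‖fderiv ℝ ρ x‖ * ‖ρ y • gradPerp w₀ (x - y)‖ := by
  unfold curlIntegrand
  rw [norm_mul, norm_mul, norm_smul, norm_gradPerp_w₀, norm_inv, norm_pow, norm_norm]
  have h1 := (fderiv ℝ ρ x).le_opNorm (x - y)
  calc ‖ρ y‖ * ((‖x - y‖ ^ 2)⁻¹ * ‖fderiv ℝ ρ x (x - y)‖)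
      ≤ ‖ρ y‖ * ((‖x - y‖ ^ 2)⁻¹ * (‖fderiv ℝ ρ x‖ * ‖x - y‖)) := by gcongr
    _ = ‖fderiv ℝ ρ x‖ * (‖ρ y‖ * ((‖x - y‖ ^ 2)⁻¹ * ‖x - y‖)) := by ring
    _ = _ := by
      congr 2
      by_cases hz : ‖x - y‖ = 0
      · simp [hz]
      · field_simp

/-- The inner integral is at most `‖∇ρ(x)‖` times a bound on `∫ |ρ(y)| / |x - y| dy` uniform in `x`,
and `∇ρ` is integrable. -/
theorem integrable_curlIntegrand {ρ : Plane → ℝ} (hρ : ContDiff ℝ 1 ρ)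
    (hc : HasCompactSupport ρ) (h4 : Integrable (fun x => ρ x ^ 4)) :
    Integrable (Function.uncurry (curlIntegrand ρ)) (volume.prod volume) := by
  obtain ⟨I, hI0, hI⟩ := exists_vecPot_integral_bound
  have hρi : Integrable ρ := hρ.continuous.integrable_of_hasCompactSupport hc
  have hd : Continuous (fderiv ℝ ρ) := hρ.continuous_fderiv (by simp)
  have hdi : Integrable (fderiv ℝ ρ) := hd.integrable_of_hasCompactSupport (hc.fderiv ℝ)
  have hΦm : AEStronglyMeasurable (Function.uncurry (curlIntegrand ρ))
      (volume.prod volume) := by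
    refine AEStronglyMeasurable.mul ?_ (AEStronglyMeasurable.mul ?_ ?_)
    · exact (hρ.continuous.comp continuous_snd).aestronglyMeasurable
    · exact (by fun_prop : Measurable fun p : Plane × Plane =>
        (‖p.1 - p.2‖ ^ 2)⁻¹).aestronglyMeasurable
    · exact ((hd.comp continuous_fst).clm_apply
        (continuous_fst.sub continuous_snd)).aestronglyMeasurable
  obtain ⟨B, hB⟩ : ∃ B : ℝ, ∀ x, ∫ y, ‖ρ y • gradPerp w₀ (x - y)‖ ≤ B :=
    ⟨_, fun x => (hI ρ hρi h4 x).2 1 one_pos le_rfl⟩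
  rw [integrable_prod_iff hΦm]
  simp only [Function.uncurry_apply_pair]
  have hxy : ∀ x, Integrable (fun y => curlIntegrand ρ x y) := fun x => by
    refine ((hI ρ hρi h4 x).1.norm.const_mul ‖fderiv ℝ ρ x‖).mono' ?_
      (Eventually.of_forall fun y => norm_curlIntegrand_le ρ x y)
    refine (hρ.continuous.aestronglyMeasurable).mul (AEStronglyMeasurable.mul ?_ ?_)
    · exact (by fun_prop : Measurable fun y : Plane => (‖x - y‖ ^ 2)⁻¹).aestronglyMeasurable
    · exact ((fderiv ℝ ρ x).continuous.comp
        (continuous_const.sub continuous_id)).aestronglyMeasurable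
  refine ⟨Eventually.of_forall hxy, ?_⟩
  refine (hdi.norm.mul_const B).mono' hΦm.norm.integral_prod_right'
    (Eventually.of_forall fun x => ?_)
  rw [Real.norm_of_nonneg (integral_nonneg fun y => norm_nonneg _)]
  calc ∫ y, ‖curlIntegrand ρ x y‖
      ≤ ∫ y, ‖fderiv ℝ ρ x‖ * ‖ρ y • gradPerp w₀ (x - y)‖ :=
        integral_mono (hxy x).norm ((hI ρ hρi h4 x).1.norm.const_mul _) (norm_curlIntegrand_le ρ x)
    _ = ‖fderiv ℝ ρ x‖ * ∫ y, ‖ρ y • gradPerp w₀ (x - y)‖ := integral_const_mul _ _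
    _ ≤ ‖fderiv ℝ ρ x‖ * B := by gcongr; exact hB x

/-- In the sense of distributions, `curl 𝐀[ρ] = 2πρ`. -/
theorem integral_vecPot_curl {ρ : Plane → ℝ} (hρ : ContDiff ℝ 1 ρ) (hc : HasCompactSupport ρ) :
    ∫ x, (vecPot ρ x 1 * partialDeriv 0 ρ x - vecPot ρ x 0 * partialDeriv 1 ρ x)
      = -(2 * Real.pi) * ∫ x, ρ x ^ 2 := by
  obtain ⟨I, -, hI⟩ := exists_vecPot_bound
  have hρi : Integrable ρ := hρ.continuous.integrable_of_hasCompactSupport hc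
  have hρ4 : Integrable (fun x => ρ x ^ 4) :=
    (hρ.continuous.pow 4).integrable_of_hasCompactSupport
      (hc.mono fun x hx h => hx (by simp [h]))
  have hx : ∀ x, vecPot ρ x 1 * partialDeriv 0 ρ x - vecPot ρ x 0 * partialDeriv 1 ρ x
      = ∫ y, curlIntegrand ρ x y := by
    intro x
    rw [vecPot_cross_eq_integral (hI ρ hρi hρ4 x).1]
    simp only [curlIntegrand, fderiv_apply_eq_partialDeriv]
  simp only [hx]
  -- Integrating in `x` first, with `x = y + z`, produces the radial integral
  -- `integral_fderiv_radial`.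
  rw [integral_integral_swap (integrable_curlIntegrand hρ hc hρ4)]
  have hy : ∀ y, ∫ x, curlIntegrand ρ x y = -(2 * Real.pi) * ρ y ^ 2 := by
    intro y
    unfold curlIntegrand
    rw [integral_const_mul, ← integral_add_left_eq_self _ y]
    simp only [add_sub_cancel_left]
    rw [integral_fderiv_radial hρ hc y]
    ring
  simp only [hy]
  rw [integral_const_mul]

/-! ### Strict monotonicity of the critical coupling at `β = 0` -/

/-- The real bilinear form `(z, w) ↦ Im (z̄ w)`. -/
noncomputable def imForm : ℂ →L[ℝ] ℂ →L[ℝ] ℝ :=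
  ((ContinuousLinearMap.compL ℝ ℂ ℂ ℝ Complex.imCLM).comp (ContinuousLinearMap.mul ℝ ℂ)).comp
    (Complex.conjCLE : ℂ →L[ℝ] ℂ)

theorem imForm_apply (z w : ℂ) : imForm z w = z.re * w.im - z.im * w.re := by
  simp [imForm]
  ring

theorem IsTest.pd_comm {v : Plane → ℂ} (hv : IsTest v) (i j : Fin 2) (x : Plane) :
    pd i (pd j v) x = pd j (pd i v) x := by
  have hd : DifferentiableAt ℝ (fderiv ℝ v) x :=
    (hv.contDiff.fderiv_right (m := ∞) (by simp)).differentiable (by simp) x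
  have key : ∀ i j : Fin 2, pd i (pd j v) x = fderiv ℝ (fderiv ℝ v) x
      (EuclideanSpace.single i 1) (EuclideanSpace.single j 1) := by
    intro i j
    unfold pd
    rw [fderiv_clm_apply hd (differentiableAt_const _)]
    simp
  have hs : IsSymmSndFDerivAt ℝ v x :=
    ((contDiff_infty.1 hv.contDiff 2).contDiffAt (x := x)).isSymmSndFDerivAt (by simp)
  rw [key, key, hs.eq]

theorem IsTest.integrable_imForm {v w : Plane → ℂ} (hv : IsTest v) (hw : IsTest w) :
    Integrable (fun x => imForm (v x) (w x)) := by
  have hc : Continuous fun x => imForm (v x) (w x) :=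
    (imForm.continuous.comp hv.continuous).clm_apply hw.continuous
  exact hc.integrable_of_hasCompactSupport
    (hv.hasCompactSupport.mono fun x hx h => hx (by simp [h]))

/-- The Jacobian determinant is a null Lagrangian: two integrations by parts and the symmetry of
second derivatives show that the integral equals its own negative. -/
theorem IsTest.integral_imForm_pd {v : Plane → ℂ} (hv : IsTest v) :
    ∫ x, imForm (pd 0 v x) (pd 1 v x) = 0 := by
  have h1 : ∫ x, imForm (pd 0 v x) (pd 1 v x) = -∫ x, imForm (pd 1 (pd 0 v) x) (v x) :=
    integral_bilinear_fderiv_right_eq_neg_left_of_integrable (B := imForm)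
      (((hv.isTest_pd 0).isTest_pd 1).integrable_imForm hv)
      ((hv.isTest_pd 0).integrable_imForm (hv.isTest_pd 1))
      ((hv.isTest_pd 0).integrable_imForm hv)
      (fun x _ => (hv.isTest_pd 0).differentiable x) (fun x _ => hv.differentiable x)
  have h2 : ∫ x, imForm (v x) (pd 0 (pd 1 v) x) = -∫ x, imForm (pd 0 v x) (pd 1 v x) :=
    integral_bilinear_fderiv_right_eq_neg_left_of_integrable (B := imForm)
      ((hv.isTest_pd 0).integrable_imForm (hv.isTest_pd 1))
      (hv.integrable_imForm ((hv.isTest_pd 1).isTest_pd 0))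
      (hv.integrable_imForm (hv.isTest_pd 1))
      (fun x _ => hv.differentiable x) (fun x _ => (hv.isTest_pd 1).differentiable x)
  have h3 : ∀ x, imForm (v x) (pd 0 (pd 1 v) x) = - imForm (pd 1 (pd 0 v) x) (v x) := by
    intro x
    rw [hv.pd_comm 0 1, imForm_apply, imForm_apply]
    ring
  simp only [h3, integral_neg] at h2
  linarith

theorem IsTest.partialDeriv_normSq {v : Plane → ℂ} (hv : IsTest v) (i : Fin 2) (x : Plane) :
    partialDeriv i (fun x => ‖v x‖ ^ 2) x = 2 * (conj (v x) * pd i v x).re := by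
  have hd : HasFDerivAt (fun x => ‖v x‖ ^ 2) _ x := (hv.differentiable x).hasFDerivAt.norm_sq
  unfold partialDeriv
  rw [hd.fderiv]
  simp [pd, Complex.inner]
  ring

/-- The term quadratic in the potential drops out because `imForm` vanishes on real multiples of the
same vector; the cross terms combine into derivatives of `|v|²`. -/
theorem IsTest.imForm_magGrad {v : Plane → ℂ} (hv : IsTest v) (β : ℝ) (x : Plane) :
    imForm (magGrad β v (fun i => pd i v) 0 x) (magGrad β v (fun i => pd i v) 1 x) =
      imForm (pd 0 v x) (pd 1 v x) + β / 2 *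
        (vecPot (fun y => ‖v y‖ ^ 2) x 1 * partialDeriv 0 (fun x => ‖v x‖ ^ 2) x -
          vecPot (fun y => ‖v y‖ ^ 2) x 0 * partialDeriv 1 (fun x => ‖v x‖ ^ 2) x) := by
  rw [hv.partialDeriv_normSq, hv.partialDeriv_normSq]
  simp only [imForm_apply, magGrad]
  simp
  ring

theorem IsTest.integrable_imForm_magGrad {v : Plane → ℂ} (hv : IsTest v) (β : ℝ) :
    Integrable (fun x => imForm (magGrad β v (fun i => pd i v) 0 x)
      (magGrad β v (fun i => pd i v) 1 x)) := by
  have h := fun i : Fin 2 => memLp_magGrad (β := β) (i := i) (G := fun i => pd i v) (hv.memLp 2)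
    (hv.memLp 8) ((hv.isTest_pd i).memLp 2)
  refine (integrable_sum_magGrad_sq (hv.memLp 2) hv.isWeakGradient β).mono' ?_
    (Eventually.of_forall fun x => ?_)
  · exact imForm.aestronglyMeasurable_comp₂ (h 0).1 (h 1).1
  · rw [Fin.sum_univ_two, imForm_apply, ← Complex.normSq_eq_norm_sq, ← Complex.normSq_eq_norm_sq,
      Complex.normSq_apply, Complex.normSq_apply, Real.norm_eq_abs, abs_le]
    set z := magGrad β v (fun i => pd i v) 0 x
    set w := magGrad β v (fun i => pd i v) 1 x
    constructor
    · nlinarith [sq_nonneg (z.re + w.im), sq_nonneg (z.im - w.re), sq_nonneg z.re,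
        sq_nonneg z.im, sq_nonneg w.re, sq_nonneg w.im]
    · nlinarith [sq_nonneg (z.re - w.im), sq_nonneg (z.im + w.re), sq_nonneg z.re,
        sq_nonneg z.im, sq_nonneg w.re, sq_nonneg w.im]

/-- The Jacobian term integrates to zero, and the curl identity for `ρ = |v|²` gives `(β / 2) ·
(-2π) = -πβ`. -/
theorem IsTest.integral_imForm_magGrad {v : Plane → ℂ} (hv : IsTest v) (β : ℝ) :
    ∫ x, imForm (magGrad β v (fun i => pd i v) 0 x) (magGrad β v (fun i => pd i v) 1 x) =
      -(Real.pi * β) * ∫ x, ‖v x‖ ^ 4 := by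
  by_cases hβ : β = 0
  · subst hβ
    simp only [hv.imForm_magGrad, zero_div, zero_mul, add_zero, hv.integral_imForm_pd]
    ring
  have i1 := (hv.isTest_pd 0).integrable_imForm (hv.isTest_pd 1)
  have i2 := hv.integrable_imForm_magGrad β
  have i3 : Integrable (fun x => β / 2 *
        (vecPot (fun y => ‖v y‖ ^ 2) x 1 * partialDeriv 0 (fun x => ‖v x‖ ^ 2) x -
          vecPot (fun y => ‖v y‖ ^ 2) x 0 * partialDeriv 1 (fun x => ‖v x‖ ^ 2) x)) := by
    refine (i2.sub i1).congr (Eventually.of_forall fun x => ?_)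
    simp only [Pi.sub_apply, hv.imForm_magGrad]
    ring
  simp only [hv.imForm_magGrad]
  rw [integral_add i1 i3, hv.integral_imForm_pd, integral_const_mul,
    integral_vecPot_curl (hv.contDiff_normSq.of_le (by simp)) hv.hasCompactSupport_normSq]
  simp only [← pow_mul]
  ring

/-! The regularized modulus `√(|v|² + ε²) - ε`. -/

/-- The regularized modulus of `v`, a smooth approximation of `|v|` with the same support. -/
noncomputable def regMod (ε : ℝ) (v : Plane → ℂ) (x : Plane) : ℝ := √(‖v x‖ ^ 2 + ε ^ 2) - ε

theorem regMod_nonneg (ε : ℝ) (v : Plane → ℂ) (x : Plane) : 0 ≤ regMod ε v x := by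
  unfold regMod
  have : ε ≤ √(‖v x‖ ^ 2 + ε ^ 2) := Real.le_sqrt_of_sq_le (by nlinarith [sq_nonneg ‖v x‖])
  linarith

theorem regMod_le {ε : ℝ} (hε : 0 ≤ ε) (v : Plane → ℂ) (x : Plane) : regMod ε v x ≤ ‖v x‖ := by
  unfold regMod
  have : √(‖v x‖ ^ 2 + ε ^ 2) ≤ ‖v x‖ + ε :=
    Real.sqrt_le_iff.2 ⟨by positivity, by nlinarith [norm_nonneg (v x)]⟩
  linarith

theorem IsTest.regMod {ε : ℝ} (hε : 0 < ε) {v : Plane → ℂ} (hv : IsTest v) :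
    IsTest (fun x => (regMod ε v x : ℂ)) := by
  refine ⟨?_, ?_⟩
  · refine Complex.ofRealCLM.contDiff.comp ?_
    refine ContDiff.sub (ContDiff.sqrt (hv.contDiff_normSq.add contDiff_const) fun x => ?_)
      contDiff_const
    positivity
  · refine hv.hasCompactSupport.mono fun x hx h => hx ?_
    have : √(ε ^ 2) = ε := Real.sqrt_sq hε.le
    simp [AfP.regMod, h, this]

theorem IsTest.pd_regMod {ε : ℝ} (hε : 0 < ε) {v : Plane → ℂ} (hv : IsTest v) (i : Fin 2)
    (x : Plane) : pd i (fun x => (AfP.regMod ε v x : ℂ)) x =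
      (((conj (v x) * pd i v x).re / √(‖v x‖ ^ 2 + ε ^ 2) : ℝ) : ℂ) := by
  have hpos : 0 < ‖v x‖ ^ 2 + ε ^ 2 := by positivity
  have h0 : HasFDerivAt (fun x => ‖v x‖ ^ 2) (fderiv ℝ (fun x => ‖v x‖ ^ 2) x) x :=
    (hv.contDiff_normSq.differentiable (by simp) x).hasFDerivAt
  have h1 := ((h0.add_const (ε ^ 2)).sqrt hpos.ne').sub_const ε
  have h2 := Complex.ofRealCLM.hasFDerivAt.comp x h1
  have h3 : fderiv ℝ (fun x => (AfP.regMod ε v x : ℂ)) x = _ := h2.fderiv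
  unfold pd
  rw [h3]
  have h4 := hv.partialDeriv_normSq i x
  unfold partialDeriv at h4
  simp only [ContinuousLinearMap.comp_apply, smul_apply, h4, Complex.ofRealCLM_apply, pd,
    smul_eq_mul]
  congr 1
  have : √(‖v x‖ ^ 2 + ε ^ 2) ≠ 0 := (Real.sqrt_pos.2 hpos).ne'
  field_simp

/-- With `d = |d| σ`, write `σ̄ · i Dⱼ = aⱼ + i cⱼ`; the real part `aⱼ` is the derivative of the
modulus and does not see `bⱼ`. Then `|Dⱼ|² = aⱼ² + cⱼ²` and `imForm D₀ D₁ = a₀c₁ - a₁c₀`, so with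
`aⱼ` for `dⱼ` the gap is `(c₁ + λa₀)² + (c₀ - λa₁)²`. Dividing by `s ≥ |d|`, as the regularization
does, only shrinks `dⱼ`. -/
theorem magnetic_lower_bound (d z₀ z₁ : ℂ) (d₀ d₁ b₀ b₁ lam s : ℝ) (D₀ D₁ : ℂ)
    (hD₀ : D₀ = -Complex.I * z₀ + (b₀ : ℂ) * d) (hD₁ : D₁ = -Complex.I * z₁ + (b₁ : ℂ) * d)
    (hlam : lam ^ 2 ≤ 1) (hs : ‖d‖ ≤ s) (hs0 : 0 < s)
    (hd₀ : d₀ = (conj d * z₀).re / s) (hd₁ : d₁ = (conj d * z₁).re / s) :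
    (1 - lam ^ 2) * (d₀ ^ 2 + d₁ ^ 2) - 2 * lam * imForm D₀ D₁ ≤ ‖D₀‖ ^ 2 + ‖D₁‖ ^ 2 := by
  obtain ⟨σ, hσ, hσd⟩ : ∃ σ : ℂ, ‖σ‖ = 1 ∧ d = (‖d‖ : ℂ) * σ := by
    by_cases hd : d = 0
    · exact ⟨1, by simp, by simp [hd]⟩
    · have : (‖d‖ : ℂ) ≠ 0 := by exact_mod_cast (norm_ne_zero_iff.2 hd)
      exact ⟨d / ‖d‖, by simp [hd], by field_simp⟩
  have hσ2 : σ.re * σ.re + σ.im * σ.im = 1 := by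
    rw [← Complex.normSq_apply, Complex.normSq_eq_norm_sq, hσ]; norm_num
  set a₀ := (conj σ * z₀).re with ha₀
  set a₁ := (conj σ * z₁).re with ha₁
  set c₀ := (conj σ * (Complex.I * D₀)).im with hc₀
  set c₁ := (conj σ * (Complex.I * D₁)).im with hc₁
  set r := ‖d‖ with hr
  have hr0 : 0 ≤ r := norm_nonneg d
  have e₀ : d₀ ^ 2 ≤ a₀ ^ 2 := by
    have : (conj d * z₀).re = r * a₀ := by rw [hσd, ha₀]; simp; ring
    rw [hd₀, this, div_pow, mul_pow, div_le_iff₀ (by positivity)]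
    have : r ^ 2 ≤ s ^ 2 := by gcongr
    nlinarith [sq_nonneg a₀]
  have e₁ : d₁ ^ 2 ≤ a₁ ^ 2 := by
    have : (conj d * z₁).re = r * a₁ := by rw [hσd, ha₁]; simp; ring
    rw [hd₁, this, div_pow, mul_pow, div_le_iff₀ (by positivity)]
    have : r ^ 2 ≤ s ^ 2 := by gcongr
    nlinarith [sq_nonneg a₁]
  have re : ∀ (D z : ℂ) (b : ℝ), D = -Complex.I * z + (b : ℂ) * d →
      (conj σ * z).re = (conj σ * (Complex.I * D)).re := by
    intro D z b hD
    rw [hD, hσd]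
    simp
    ring
  have nrm : ∀ D : ℂ, ‖D‖ ^ 2 = (conj σ * (Complex.I * D)).re ^ 2
      + (conj σ * (Complex.I * D)).im ^ 2 := by
    intro D
    have : ‖conj σ * (Complex.I * D)‖ = ‖D‖ := by simp [hσ]
    rw [← this, ← Complex.normSq_eq_norm_sq, Complex.normSq_apply]
    ring
  have him : imForm D₀ D₁ = a₀ * c₁ - a₁ * c₀ := by
    rw [ha₀, ha₁, re D₀ z₀ b₀ hD₀, re D₁ z₁ b₁ hD₁, hc₀, hc₁, imForm_apply]
    simp
    linear_combination (-(D₀.re * D₁.im - D₀.im * D₁.re)) * hσ2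
  rw [nrm D₀, nrm D₁, ← re D₀ z₀ b₀ hD₀, ← re D₁ z₁ b₁ hD₁, him, ← ha₀, ← ha₁, ← hc₀, ← hc₁]
  have h1 : (1 - lam ^ 2) * (d₀ ^ 2 + d₁ ^ 2) ≤ (1 - lam ^ 2) * (a₀ ^ 2 + a₁ ^ 2) := by
    have : 0 ≤ 1 - lam ^ 2 := by linarith
    gcongr
  nlinarith [sq_nonneg (c₁ + lam * a₀), sq_nonneg (c₀ - lam * a₁)]

theorem kinEnergy_zero_eq (u : Plane → ℂ) (G : Fin 2 → Plane → ℂ) :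
    kinEnergy 0 u G = ∫ x, ∑ i, ‖G i x‖ ^ 2 := by
  unfold kinEnergy magGrad
  simp

/-- A lower bound that quantifies the diamagnetic inequality. -/
theorem IsTest.kinEnergy_lower_bound {v : Plane → ℂ} (hv : IsTest v) (β : ℝ) {lam : ℝ}
    (hlam : lam ^ 2 ≤ 1) {ε : ℝ} (hε : 0 < ε) :
    (1 - lam ^ 2) * kinEnergy 0 (fun x => (AfP.regMod ε v x : ℂ))
        (fun i => pd i (fun x => (AfP.regMod ε v x : ℂ)))
      + 2 * Real.pi * β * lam * ∫ x, ‖v x‖ ^ 4 ≤ kinEnergy β v (fun i => pd i v) := by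
  have hq := hv.regMod hε
  have i0 := integrable_sum_magGrad_sq (hq.memLp 2) hq.isWeakGradient 0
  have i1 := hv.integrable_imForm_magGrad β
  have i2 := integrable_sum_magGrad_sq (hv.memLp 2) hv.isWeakGradient β
  have h := integral_mono ((i0.const_mul (1 - lam ^ 2)).sub (i1.const_mul (2 * lam))) i2
    (fun x => ?_)
  · simp only [Pi.sub_apply] at h
    rw [integral_sub (i0.const_mul _) (i1.const_mul _), integral_const_mul, integral_const_mul,
      hv.integral_imForm_magGrad] at h
    unfold kinEnergy
    linarith
  · simp only [Pi.sub_apply, Fin.sum_univ_two]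
    have key := magnetic_lower_bound (v x) (pd 0 v x) (pd 1 v x) _ _
      (β * vecPot (fun y => ‖v y‖ ^ 2) x 0) (β * vecPot (fun y => ‖v y‖ ^ 2) x 1) lam
      (√(‖v x‖ ^ 2 + ε ^ 2)) (magGrad β v (fun i => pd i v) 0 x)
      (magGrad β v (fun i => pd i v) 1 x) rfl rfl hlam
      (Real.le_sqrt_of_sq_le (by nlinarith)) (Real.sqrt_pos.2 (by positivity)) rfl rfl
    refine le_trans (le_of_eq ?_) key
    have e : ∀ i, ‖magGrad 0 (fun x => (AfP.regMod ε v x : ℂ))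
        (fun i => pd i (fun x => (AfP.regMod ε v x : ℂ))) i x‖ ^ 2 =
        ((conj (v x) * pd i v x).re / √(‖v x‖ ^ 2 + ε ^ 2)) ^ 2 := by
      intro i
      simp only [magGrad, hv.pd_regMod hε, zero_mul, Complex.ofReal_zero, add_zero, norm_mul,
        norm_neg, Complex.norm_I, one_mul, Complex.norm_real, Real.norm_eq_abs, sq_abs]
    rw [e, e]

theorem integral_norm_pow_four_pos {u : Plane → ℂ} (hu : MemLp u 2 volume)
    (hu8 : MemLp u 8 volume) (h : 0 < ∫ x, ‖u x‖ ^ 2) : 0 < ∫ x, ‖u x‖ ^ 4 := by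
  have i4 := integrable_norm_pow_of_le_eight hu hu8 (n := 4) (by norm_num) (by norm_num)
  have i2 := integrable_norm_pow_of_le_eight hu hu8 (n := 2) (by norm_num) (by norm_num)
  rw [integral_pos_iff_support_of_nonneg (fun x => by positivity) i4]
  rw [integral_pos_iff_support_of_nonneg (fun x => by positivity) i2] at h
  convert h using 2
  ext x
  simp

/-! ### Inequalities for the critical coupling -/

theorem gStar_set_bddBelow (β : ℝ) : BddBelow {q : ℝ | ∃ u : Plane → ℂ, MemH1 u ∧
    ∫ x, ‖u x‖ ^ 2 = 1 ∧
    q = (∫ x, kineticDensity β u x) / (1 / 2 * ∫ x, ‖u x‖ ^ 4)} := by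
  refine ⟨0, ?_⟩
  rintro q ⟨u, hu, -, rfl⟩
  have h1 : 0 ≤ ∫ x, kineticDensity β u x :=
    integral_nonneg fun x => by unfold kineticDensity; positivity
  have h2 : 0 ≤ ∫ x, ‖u x‖ ^ 4 := integral_nonneg fun x => by positivity
  positivity

theorem gStar_nonneg (β : ℝ) : 0 ≤ gStar β := by
  refine Real.sInf_nonneg ?_
  rintro q ⟨u, hu, -, rfl⟩
  have h1 : 0 ≤ ∫ x, kineticDensity β u x :=
    integral_nonneg fun x => by unfold kineticDensity; positivity
  have h2 : 0 ≤ ∫ x, ‖u x‖ ^ 4 := integral_nonneg fun x => by positivity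
  positivity

/-- The defining inequality of the critical coupling. -/
theorem gStar_le {β : ℝ} {u : Plane → ℂ} {G : Fin 2 → Plane → ℂ} (hu : MemLp u 2 volume)
    (hG : IsWeakGradient u G) (h1 : ∫ x, ‖u x‖ ^ 2 = 1) :
    gStar β / 2 * (∫ x, ‖u x‖ ^ 4) ≤ kinEnergy β u G := by
  have hpos := integral_norm_pow_four_pos hu (hG.memLp_eight hu) (by rw [h1]; exact one_pos)
  have h := csInf_le (gStar_set_bddBelow β) ⟨u, ⟨hu, G, hG⟩, h1, rfl⟩
  rw [integral_kineticDensity hG, le_div_iff₀ (by positivity)] at h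
  unfold gStar
  linarith

theorem IsTest.const_mul {v : Plane → ℂ} (hv : IsTest v) (c : ℂ) : IsTest (fun x => c * v x) :=
  ⟨contDiff_const.mul hv.contDiff, hv.hasCompactSupport.mono fun x hx h => hx (by simp [h])⟩

theorem IsTest.pd_const_mul {v : Plane → ℂ} (hv : IsTest v) (c : ℂ) (i : Fin 2) (x : Plane) :
    pd i (fun x => c * v x) x = c * pd i v x := by
  unfold pd
  rw [fderiv_const_mul (hv.differentiable x)]
  simp

/-- For `β = 0` the kinetic energy is homogeneous of degree two, so normalization by `(√N)⁻¹` is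
harmless. The version without unit mass is needed because regularizing the modulus changes the mass.
-/
theorem IsTest.gStar_zero_le {w : Plane → ℂ} (hw : IsTest w) :
    gStar 0 / 2 * (∫ x, ‖w x‖ ^ 4) ≤ (∫ x, ‖w x‖ ^ 2) * kinEnergy 0 w (fun i => pd i w) := by
  set N := ∫ x, ‖w x‖ ^ 2 with hN
  have hN0 : 0 ≤ N := integral_nonneg fun x => by positivity
  rcases hN0.eq_or_lt with h0 | hpos
  · have i2 := integrable_norm_pow_of_le_eight (hw.memLp 2) (hw.memLp 8) (n := 2) le_rfl
      (by norm_num)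
    have hae := (integral_eq_zero_iff_of_nonneg (fun x => by positivity) i2).1 h0.symm
    have : ∫ x, ‖w x‖ ^ 4 = 0 := by
      rw [← integral_zero Plane ℝ]
      refine integral_congr_ae ?_
      filter_upwards [hae] with x hx
      have : w x = 0 := by simpa using hx
      simp [this]
    rw [this, ← h0]
    simp
  · set c : ℝ := (√N)⁻¹ with hc
    have hc2 : c ^ 2 = N⁻¹ := by rw [hc, inv_pow, Real.sq_sqrt hN0]
    have hc4 : c ^ 4 = N⁻¹ ^ 2 := by rw [← hc2, ← pow_mul]
    have hn : ∀ x (p : ℕ), ‖(c : ℂ) * w x‖ ^ p = |c| ^ p * ‖w x‖ ^ p := by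
      intro x p
      rw [norm_mul, Complex.norm_real, Real.norm_eq_abs, mul_pow]
    have hcw := hw.const_mul (c : ℂ)
    have e2 : ∫ x, ‖(c : ℂ) * w x‖ ^ 2 = 1 := by
      simp only [hn]
      rw [integral_const_mul, sq_abs, hc2, ← hN, inv_mul_cancel₀ hpos.ne']
    have h := gStar_le (β := 0) (hcw.memLp 2) hcw.isWeakGradient e2
    simp only [hn] at h
    rw [integral_const_mul, (by decide : Even 4).pow_abs, hc4, kinEnergy_zero_eq] at h
    simp only [hw.pd_const_mul, norm_mul, mul_pow, Complex.norm_real, Real.norm_eq_abs, sq_abs,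
      hc2, ← Finset.mul_sum] at h
    rw [integral_const_mul] at h
    rw [kinEnergy_zero_eq]
    have h2 := mul_le_mul_of_nonneg_left h (sq_nonneg N)
    have e3 : N ^ 2 * (gStar 0 / 2 * (N⁻¹ ^ 2 * ∫ x, ‖w x‖ ^ 4)) =
        gStar 0 / 2 * ∫ x, ‖w x‖ ^ 4 := by
      field_simp
    rw [e3] at h2
    refine h2.trans (le_of_eq ?_)
    field_simp

theorem IsTest.tendsto_integral_regMod {v : Plane → ℂ} (hv : IsTest v) :
    Tendsto (fun n : ℕ => ∫ x, ‖(AfP.regMod (1 / ((n : ℝ) + 1)) v x : ℂ)‖ ^ 4) atTop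
      (𝓝 (∫ x, ‖v x‖ ^ 4)) := by
  have i4 := integrable_norm_pow_of_le_eight (hv.memLp 2) (hv.memLp 8) (n := 4) (by norm_num)
    (by norm_num)
  have hpos : ∀ n : ℕ, 0 < 1 / ((n : ℝ) + 1) := fun n => by positivity
  refine tendsto_integral_of_dominated_convergence _ (fun n => ?_) i4 (fun n => ?_) ?_
  · exact ((hv.regMod (hpos n)).continuous.norm.pow 4).aestronglyMeasurable
  · refine Eventually.of_forall fun x => ?_
    rw [norm_pow, norm_norm, Complex.norm_real, Real.norm_of_nonneg (regMod_nonneg _ v x)]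
    have := regMod_le (hpos n).le v x
    have := regMod_nonneg (1 / ((n : ℝ) + 1)) v x
    gcongr
  · refine Eventually.of_forall fun x => ?_
    have hc : Continuous fun ε : ℝ => ‖(AfP.regMod ε v x : ℂ)‖ ^ 4 := by
      unfold AfP.regMod
      fun_prop
    have h := (hc.tendsto 0).comp (tendsto_one_div_add_atTop_nhds_zero_nat (𝕜 := ℝ))
    have e : ‖(AfP.regMod 0 v x : ℂ)‖ ^ 4 = ‖v x‖ ^ 4 := by
      simp [AfP.regMod]
    rw [e] at h
    exact h

/-- The regularized modulus has at most the mass of `v`, so `gStar 0` bounds its energy from below;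
letting `ε → 0` only affects its `L⁴` integral. Multiplying by the mass of `v` avoids normalizing
it, as the energy is not homogeneous for `β ≠ 0`. -/
theorem IsTest.gStar_bound {v : Plane → ℂ} (hv : IsTest v) {β : ℝ} {lam : ℝ}
    (hlam : lam ^ 2 ≤ 1) :
    (1 - lam ^ 2) * (gStar 0 / 2) * (∫ x, ‖v x‖ ^ 4) +
      (∫ x, ‖v x‖ ^ 2) * (2 * Real.pi * β * lam * ∫ x, ‖v x‖ ^ 4) ≤
      (∫ x, ‖v x‖ ^ 2) * kinEnergy β v (fun i => pd i v) := by
  have hlim := ((hv.tendsto_integral_regMod.const_mul ((1 - lam ^ 2) * (gStar 0 / 2))).add_const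
    ((∫ x, ‖v x‖ ^ 2) * (2 * Real.pi * β * lam * ∫ x, ‖v x‖ ^ 4)))
  refine le_of_tendsto' hlim fun n => ?_
  set ε : ℝ := 1 / ((n : ℝ) + 1) with hεdef
  have hε : 0 < ε := by positivity
  have hq := hv.regMod hε
  have h1 := hv.kinEnergy_lower_bound β hlam hε
  have h2 := hq.gStar_zero_le
  have h3 : ∫ x, ‖(AfP.regMod ε v x : ℂ)‖ ^ 2 ≤ ∫ x, ‖v x‖ ^ 2 := by
    refine integral_mono
      (integrable_norm_pow_of_le_eight (hq.memLp 2) (hq.memLp 8) le_rfl (by norm_num))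
      (integrable_norm_pow_of_le_eight (hv.memLp 2) (hv.memLp 8) le_rfl (by norm_num)) fun x => ?_
    simp only [Complex.norm_real, Real.norm_of_nonneg (regMod_nonneg ε v x)]
    have := regMod_le hε.le v x
    have := regMod_nonneg ε v x
    gcongr
  have hK := kinEnergy_nonneg 0 (fun x => (AfP.regMod ε v x : ℂ))
    (fun i => pd i (fun x => (AfP.regMod ε v x : ℂ)))
  have hN : 0 ≤ ∫ x, ‖v x‖ ^ 2 := integral_nonneg fun x => by positivity
  have hl : 0 ≤ 1 - lam ^ 2 := by linarith
  have h4 := h2.trans (mul_le_mul_of_nonneg_right h3 hK)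
  have h5 := mul_le_mul_of_nonneg_left h4 hl
  have h6 := mul_le_mul_of_nonneg_left h1 hN
  nlinarith

/-- Mass, `L⁴` integral and magnetic energy all converge along the approximating test functions. The
result says that `gStar β ≥ (1 - λ²) gStar 0 + 4πβλ`. -/
theorem gStar_bound {β lam : ℝ} (hlam : lam ^ 2 ≤ 1) {u : Plane → ℂ} {G : Fin 2 → Plane → ℂ}
    (hu : MemLp u 2 volume) (hG : IsWeakGradient u G) (h1 : ∫ x, ‖u x‖ ^ 2 = 1) :
    ((1 - lam ^ 2) * (gStar 0 / 2) + 2 * Real.pi * β * lam) * (∫ x, ‖u x‖ ^ 4) ≤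
      kinEnergy β u G := by
  obtain ⟨v, hv, -, h2, h4, hK⟩ := hG.exists_isTest_seq_energy hu β
  have h := le_of_tendsto_of_tendsto
    ((h4.const_mul ((1 - lam ^ 2) * (gStar 0 / 2))).add (h2.mul (h4.const_mul
      (2 * Real.pi * β * lam)))) (h2.mul hK)
    (Eventually.of_forall fun n => (hv n).gStar_bound hlam)
  rw [h1] at h
  linarith

theorem exists_isTest_normalized : ∃ v : Plane → ℂ, IsTest v ∧ ∫ x, ‖v x‖ ^ 2 = 1 := by
  let b : ContDiffBump (0 : Plane) := ⟨1, 2, one_pos, one_lt_two⟩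
  have hw : IsTest (fun x => (b x : ℂ)) :=
    ⟨Complex.ofRealCLM.contDiff.comp b.contDiff,
      b.hasCompactSupport.mono fun x hx h => hx (by simp [h])⟩
  set N := ∫ x, ‖(b x : ℂ)‖ ^ 2 with hN
  have hpos : 0 < N := by
    have hc : Continuous fun x => ‖(b x : ℂ)‖ ^ 2 := hw.continuous.norm.pow 2
    have hcs : HasCompactSupport fun x => ‖(b x : ℂ)‖ ^ 2 := hw.hasCompactSupport_normSq
    refine hc.integral_pos_of_hasCompactSupport_nonneg_nonzero hcs (fun x => by positivity)
      (x := 0) ?_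
    have h3 : b 0 = 1 := b.one_of_mem_closedBall (by simp [b])
    simp [h3]
  refine ⟨_, hw.const_mul (((√N)⁻¹ : ℝ) : ℂ), ?_⟩
  simp only [norm_mul, mul_pow, Complex.norm_real (√N)⁻¹, Real.norm_eq_abs, sq_abs]
  rw [integral_const_mul, ← hN, inv_pow, Real.sq_sqrt hpos.le, inv_mul_cancel₀ hpos.ne']

/-- The critical coupling is strictly larger in the presence of self-generated fields. -/
theorem gStar_zero_lt {β : ℝ} (hβ : 0 < β) : gStar 0 < gStar β := by
  have hg := gStar_nonneg 0
  set g := gStar 0 with hgdef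
  set p := 4 * Real.pi * β with hp
  have hp0 : 0 < p := by positivity
  -- This choice gives `p - λg = λp`, so the gain `λp - λ²g` equals `λ²p > 0`, also when `g = 0`.
  set lam := p / (p + g) with hlam
  have hpg : 0 < p + g := by positivity
  have hl0 : 0 < lam := by positivity
  have hl1 : lam ≤ 1 := by rw [hlam, div_le_one hpg]; linarith
  have hlg : lam * (p + g) = p := by rw [hlam]; field_simp
  have hsq : lam ^ 2 ≤ 1 := by nlinarith
  have hgt : g < (1 - lam ^ 2) * g + p * lam := by
    have : 0 < lam * (p - lam * g) := by
      have : p - lam * g = lam * p := by linarith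
      rw [this]; positivity
    nlinarith
  refine hgt.trans_le ?_
  obtain ⟨v, hv, hv1⟩ := exists_isTest_normalized
  -- A normalized test function is needed: the real infimum of an empty set would be zero.
  refine le_csInf ⟨_, v, hv.memH1, hv1, rfl⟩ ?_
  rintro q ⟨u, hu, hu1, rfl⟩
  have hG := hu.isWeakGradient
  have hpos := integral_norm_pow_four_pos hu.1 (hG.memLp_eight hu.1) (by rw [hu1]; exact one_pos)
  rw [integral_kineticDensity hG, le_div_iff₀ (by positivity)]
  have := gStar_bound (β := β) hsq hu.1 hG hu1
  rw [← hgdef] at this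
  refine le_trans (le_of_eq ?_) this
  rw [hp]
  ring

/-! ### Compactness -/

theorem enorm_fderiv_apply_sq_le (v : Plane → ℂ) (x t : Plane) :
    ‖fderiv ℝ v x t‖ₑ ^ 2 ≤ ENNReal.ofReal (‖t‖ ^ 2) * ∑ i, ‖pd i v x‖ₑ ^ 2 := by
  have ht : t = ∑ i, t i • (EuclideanSpace.single i 1 : Plane) := by
    ext j; fin_cases j <;> simp
  have h1 : ‖fderiv ℝ v x t‖ ≤ ∑ i, |t i| * ‖pd i v x‖ := by
    conv_lhs => rw [ht]
    rw [map_sum]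
    refine (norm_sum_le _ _).trans (le_of_eq (Finset.sum_congr rfl fun i _ => ?_))
    rw [map_smul, norm_smul]
    rfl
  have h2 : ‖fderiv ℝ v x t‖ ^ 2 ≤ ‖t‖ ^ 2 * ∑ i, ‖pd i v x‖ ^ 2 := by
    have h3 := Finset.sum_mul_sq_le_sq_mul_sq Finset.univ (fun i => |t i|) (fun i => ‖pd i v x‖)
    have h4 : ‖t‖ ^ 2 = ∑ i, |t i| ^ 2 := by
      rw [EuclideanSpace.norm_sq_eq]; rfl
    rw [h4]
    exact (pow_le_pow_left₀ (norm_nonneg _) h1 2).trans h3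
  have h5 := ENNReal.ofReal_le_ofReal h2
  rw [ENNReal.ofReal_pow (norm_nonneg _), ofReal_norm, ENNReal.ofReal_mul (by positivity),
    ENNReal.ofReal_sum_of_nonneg fun i _ => by positivity] at h5
  simpa only [ENNReal.ofReal_pow (norm_nonneg (pd _ v x)), ofReal_norm] using h5

/-- The fundamental theorem of calculus along the segment from `x` to `x - t`, then Cauchy–Schwarz
in the parameter, Tonelli and translation invariance. -/
theorem IsTest.lintegral_translate_sub_le {v : Plane → ℂ} (hv : IsTest v) (t : Plane) :
    ∫⁻ x, ‖v (x - t) - v x‖ₑ ^ 2 ≤ ENNReal.ofReal (‖t‖ ^ 2) * ∫⁻ x, ∑ i, ‖pd i v x‖ₑ ^ 2 := by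
  have hcont : Continuous fun p : Plane × ℝ => fderiv ℝ v (p.1 - p.2 • t) t :=
    (hv.continuous_fderiv.comp (by fun_prop)).clm_apply continuous_const
  have h1 : ∀ x, ‖v (x - t) - v x‖ₑ ^ 2 ≤
      ∫⁻ s in Set.Ioc (0 : ℝ) 1, ‖fderiv ℝ v (x - s • t) t‖ₑ ^ 2 := by
    intro x
    have hd : ∀ s : ℝ, HasDerivAt (fun s : ℝ => v (x - s • t)) (-(fderiv ℝ v (x - s • t) t)) s := by
      intro s
      have hl : HasDerivAt (fun s : ℝ => x - s • t) (-t) s := by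
        simpa using ((hasDerivAt_id s).smul_const t).const_sub x
      have := (hv.differentiable (x - s • t)).hasFDerivAt.comp_hasDerivAt s hl
      rwa [map_neg] at this
    have hc : Continuous fun s : ℝ => -(fderiv ℝ v (x - s • t) t) :=
      (hcont.comp (by fun_prop : Continuous fun s : ℝ => (x, s))).neg
    have hftc := intervalIntegral.integral_eq_sub_of_hasDerivAt (a := 0) (b := 1)
      (fun s _ => hd s) (hc.intervalIntegrable 0 1)
    simp only [one_smul, zero_smul, sub_zero] at hftc
    rw [← hftc, intervalIntegral.integral_of_le zero_le_one]
    have h2 := enorm_integral_smul_sq_le (μ := volume.restrict (Set.Ioc (0 : ℝ) 1))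
      (φ := fun _ => (1 : ℝ)) (h := fun s => -(fderiv ℝ v (x - s • t) t)) aemeasurable_const
      hc.aestronglyMeasurable
    simpa using h2
  calc ∫⁻ x, ‖v (x - t) - v x‖ₑ ^ 2
      ≤ ∫⁻ x, ∫⁻ s in Set.Ioc (0 : ℝ) 1, ‖fderiv ℝ v (x - s • t) t‖ₑ ^ 2 := lintegral_mono h1
    _ = ∫⁻ s in Set.Ioc (0 : ℝ) 1, ∫⁻ x, ‖fderiv ℝ v (x - s • t) t‖ₑ ^ 2 :=
        lintegral_lintegral_swap (hcont.enorm.aemeasurable.pow_const 2)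
    _ = ∫⁻ s in Set.Ioc (0 : ℝ) 1, ∫⁻ x, ‖fderiv ℝ v x t‖ₑ ^ 2 := by
        refine lintegral_congr fun s => ?_
        exact lintegral_sub_right_eq_self (fun x => ‖fderiv ℝ v x t‖ₑ ^ 2) (s • t)
    _ = ∫⁻ x, ‖fderiv ℝ v x t‖ₑ ^ 2 := by simp
    _ ≤ ∫⁻ x, ENNReal.ofReal (‖t‖ ^ 2) * ∑ i, ‖pd i v x‖ₑ ^ 2 :=
        lintegral_mono fun x => enorm_fderiv_apply_sq_le v x t
    _ = _ := lintegral_const_mul' _ _ ENNReal.ofReal_ne_top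

theorem IsWeakGradient.lintegral_translate_sub_le {u : Plane → ℂ} {G : Fin 2 → Plane → ℂ}
    (hu : MemLp u 2 volume) (hG : IsWeakGradient u G) (t : Plane) :
    ∫⁻ x, ‖u (x - t) - u x‖ₑ ^ 2 ≤ ENNReal.ofReal (‖t‖ ^ 2) * ∫⁻ x, ∑ i, ‖G i x‖ₑ ^ 2 := by
  obtain ⟨v, hv, h1, h2⟩ := hG.exists_isTest_seq hu
  have hK := tendsto_lintegral_sum_sq (f := fun n i x => pd i (v n) x)
    (fun n i => ((hv n).isTest_pd i).continuous.aestronglyMeasurable) (fun i => (hG i).1) h2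
  have hmp := measurePreserving_sub_right (volume : Measure Plane) t
  refine lintegral_pow_le_of_tendsto (u := fun n x => v n (x - t) - v n x)
    (u₀ := fun x => u (x - t) - u x) (fun n => ?_) ?_ ?_
    (ENNReal.Tendsto.const_mul hK (Or.inr ENNReal.ofReal_ne_top))
    fun n => (hv n).lintegral_translate_sub_le t
  · exact (((hv n).continuous.comp (by fun_prop)).sub (hv n).continuous).aestronglyMeasurable
  · exact (hu.1.comp_measurePreserving hmp).sub hu.1
  · have h3 := h1.add h1
    rw [add_zero] at h3
    refine tendsto_of_tendsto_of_tendsto_of_le_of_le tendsto_const_nhds h3 (fun _ => zero_le)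
      fun n => ?_
    have hm : AEStronglyMeasurable (fun x => v n x - u x) volume :=
      (hv n).continuous.aestronglyMeasurable.sub hu.1
    have e : (fun x => v n (x - t) - v n x - (u (x - t) - u x)) =
        ((fun x => v n x - u x) ∘ fun x => x - t) - fun x => v n x - u x := by
      ext x; simp; ring
    change eLpNorm (fun x => v n (x - t) - v n x - (u (x - t) - u x)) 2 volume ≤ _
    rw [e]
    refine (eLpNorm_sub_le (hm.comp_measurePreserving hmp) hm (by norm_num)).trans (le_of_eq ?_)
    rw [eLpNorm_comp_measurePreserving hm hmp]

/-- Rellich's theorem by mollification. At scale `r` the squared error is at most `r² K`, uniformly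
in `n`. The mollified functions tend to zero pointwise by weak convergence and are uniformly
bounded, so dominated convergence applies on a ball; tightness handles the complement. -/
theorem tendsto_eLpNorm_zero_of_weak {w : ℕ → Plane → ℂ} {H : ℕ → Fin 2 → Plane → ℂ}
    (hw : ∀ n, MemLp (w n) 2 volume) (hH : ∀ n, IsWeakGradient (w n) (H n)) {K : ℝ≥0}
    (hwK : ∀ n, ∫⁻ x, ‖w n x‖ₑ ^ 2 ≤ K) (hHK : ∀ n, ∫⁻ x, ∑ i, ‖H n i x‖ₑ ^ 2 ≤ K)
    (htight : ∀ ε : ℝ≥0∞, 0 < ε → ∃ R : ℝ, ∀ n,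
      ∫⁻ x in (Metric.ball (0 : Plane) R)ᶜ, ‖w n x‖ₑ ^ 2 ≤ ε)
    (hweak : ∀ h : Plane → ℂ, MemLp h 2 volume →
      Tendsto (fun n => ∫ x, w n x * h x) atTop (𝓝 0)) :
    Tendsto (fun n => ∫⁻ x, ‖w n x‖ₑ ^ 2) atTop (𝓝 0) := by
  rw [ENNReal.tendsto_nhds_zero]
  intro ε hε
  have hε4 : 0 < ε / 4 := by
    rw [ENNReal.div_pos_iff]; exact ⟨hε.ne', by norm_num⟩
  obtain ⟨R, hR⟩ := htight (ε / 4) hε4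
  obtain ⟨r, hr0, hr⟩ : ∃ r : ℝ, 0 < r ∧ ENNReal.ofReal (r ^ 2) * K < ε / 4 := by
    have h1 : Tendsto (fun r : ℝ => ENNReal.ofReal (r ^ 2) * K) (𝓝[>] 0)
        (𝓝 (ENNReal.ofReal (0 ^ 2) * K)) := by
      refine ENNReal.Tendsto.mul_const (ENNReal.tendsto_ofReal ?_) (Or.inr ENNReal.coe_ne_top)
      exact (tendsto_id.mono_left nhdsWithin_le_nhds).pow 2
    rw [zero_pow (by norm_num), ENNReal.ofReal_zero, zero_mul] at h1
    obtain ⟨r, h⟩ := ((h1.eventually_lt_const hε4).and self_mem_nhdsWithin).exists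
    exact ⟨r, h.2, h.1⟩
  let φ : ContDiffBump (0 : Plane) := ⟨r / 2, r, by positivity, by linarith⟩
  set ψ : Plane → ℝ := φ.normed volume with hψ
  have hψc : Continuous ψ := φ.continuous_normed
  have hψs : HasCompactSupport ψ := φ.hasCompactSupport_normed
  set c : ℕ → Plane → ℂ := fun n => ψ ⋆[ContinuousLinearMap.lsmul ℝ ℝ, volume] w n with hc
  have hcc : ∀ n, Continuous (c n) := fun n =>
    hψs.continuous_convolution_left _ hψc ((hw n).locallyIntegrable (by norm_num))
  have hmol : ∀ n, ∫⁻ x, ‖c n x - w n x‖ₑ ^ 2 ≤ ε / 4 := by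
    intro n
    refine (lintegral_convolution_sub_sq_le hψc hψs φ.nonneg_normed φ.integral_normed
      ((hw n).locallyIntegrable (by norm_num)) fun t ht => ?_).trans hr.le
    refine ((hH n).lintegral_translate_sub_le (hw n) t).trans ?_
    rw [hψ, φ.support_normed_eq] at ht
    have : ‖t‖ ≤ r := by simpa using (Metric.mem_ball.1 ht).le
    gcongr
    exact hHK n
  have hpt : ∀ x, Tendsto (fun n => c n x) atTop (𝓝 0) := by
    intro x
    have hcx : Continuous fun y => (ψ (x - y) : ℂ) :=
      Complex.continuous_ofReal.comp (hψc.comp (by fun_prop))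
    have hsx : HasCompactSupport fun y => (ψ (x - y) : ℂ) :=
      (hψs.comp_homeomorph (Homeomorph.subLeft x)).mono fun y hy h => hy (by
        have : ψ (x - y) = 0 := h
        simp [this])
    have h := hweak _ (hcx.memLp_of_hasCompactSupport hsx)
    refine h.congr fun n => ?_
    simp only [hc, convolution]
    rw [← integral_sub_left_eq_self _ volume x]
    refine integral_congr_ae (Eventually.of_forall fun y => ?_)
    simp [mul_comm]
  obtain ⟨S, hS⟩ := hψs.exists_bound_of_continuous hψc
  have hcb : ∀ n x, ‖c n x‖ₑ ^ 2 ≤ ENNReal.ofReal S * K := by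
    intro n x
    have hm : AEStronglyMeasurable (fun t => w n (x - t)) volume :=
      (hw n).1.comp_quasiMeasurePreserving (quasiMeasurePreserving_sub_left volume x)
    have hmass : ∫⁻ t, ‖ψ t‖ₑ = 1 := by
      have h1 := ofReal_integral_eq_lintegral_ofReal
        (hψc.integrable_of_hasCompactSupport hψs (μ := volume))
        (Eventually.of_forall φ.nonneg_normed)
      rw [φ.integral_normed, ENNReal.ofReal_one] at h1
      rw [h1]
      exact lintegral_congr fun t => Real.enorm_of_nonneg (φ.nonneg_normed t)
    refine (enorm_integral_smul_sq_le hψc.aemeasurable hm).trans ?_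
    rw [hmass, one_mul]
    calc ∫⁻ t, ‖ψ t‖ₑ * ‖w n (x - t)‖ₑ ^ 2 ≤ ∫⁻ t, ENNReal.ofReal S * ‖w n (x - t)‖ₑ ^ 2 := by
          refine lintegral_mono fun t => ?_
          gcongr
          rw [← ofReal_norm]
          exact ENNReal.ofReal_le_ofReal (hS t)
      _ = ENNReal.ofReal S * ∫⁻ t, ‖w n (x - t)‖ₑ ^ 2 :=
          lintegral_const_mul' _ _ ENNReal.ofReal_ne_top
      _ = ENNReal.ofReal S * ∫⁻ t, ‖w n t‖ₑ ^ 2 := by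
          rw [lintegral_sub_left_eq_self (fun t => ‖w n t‖ₑ ^ 2) x]
      _ ≤ _ := by gcongr; exact hwK n
  have hball : Tendsto (fun n => ∫⁻ x in Metric.ball (0 : Plane) R, ‖c n x‖ₑ ^ 2) atTop (𝓝 0) := by
    have h := tendsto_lintegral_of_dominated_convergence
      (μ := volume.restrict (Metric.ball (0 : Plane) R)) (F := fun n x => ‖c n x‖ₑ ^ 2)
      (f := fun _ => 0) (fun _ => ENNReal.ofReal S * K)
      (fun n => ((hcc n).enorm.measurable.pow_const 2))
      (fun n => Eventually.of_forall fun x => hcb n x) ?_ (Eventually.of_forall fun x => ?_)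
    · simpa using h
    · rw [lintegral_const]
      refine ENNReal.mul_ne_top (ENNReal.mul_ne_top ENNReal.ofReal_ne_top ENNReal.coe_ne_top) ?_
      rw [Measure.restrict_apply_univ]
      exact measure_ball_lt_top.ne
    · have := ENNReal.Tendsto.pow (n := 2) (hpt x).enorm
      simpa using this
  have hε8 : 0 < ε / 8 := by
    rw [ENNReal.div_pos_iff]; exact ⟨hε.ne', by norm_num⟩
  filter_upwards [hball.eventually_le_const hε8] with n hn
  rw [← lintegral_add_compl (fun x => ‖w n x‖ₑ ^ 2)
    (measurableSet_ball (x := (0 : Plane)) (ε := R))]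
  have hsplit : ∫⁻ x in Metric.ball (0 : Plane) R, ‖w n x‖ₑ ^ 2 ≤
      2 * (ε / 4) + 2 * (ε / 8) := by
    calc ∫⁻ x in Metric.ball (0 : Plane) R, ‖w n x‖ₑ ^ 2
        ≤ ∫⁻ x in Metric.ball (0 : Plane) R, (2 * ‖c n x - w n x‖ₑ ^ 2 + 2 * ‖c n x‖ₑ ^ 2) := by
          refine lintegral_mono fun x => ?_
          have h1 : ‖w n x‖ ^ 2 ≤ 2 * ‖c n x - w n x‖ ^ 2 + 2 * ‖c n x‖ ^ 2 := by
            have h2 : ‖w n x‖ ≤ ‖c n x‖ + ‖c n x - w n x‖ := by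
              have := norm_sub_le (c n x) (c n x - w n x)
              simpa using this
            nlinarith [norm_nonneg (w n x), sq_nonneg (‖c n x‖ - ‖c n x - w n x‖)]
          have h3 := ENNReal.ofReal_le_ofReal h1
          rw [ENNReal.ofReal_add (by positivity) (by positivity),
            ENNReal.ofReal_mul (by norm_num), ENNReal.ofReal_mul (by norm_num),
            ENNReal.ofReal_pow (norm_nonneg _), ENNReal.ofReal_pow (norm_nonneg _),
            ENNReal.ofReal_pow (norm_nonneg _), ofReal_norm, ofReal_norm, ofReal_norm] at h3
          simpa using h3
      _ = 2 * (∫⁻ x in Metric.ball (0 : Plane) R, ‖c n x - w n x‖ₑ ^ 2) +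
            2 * ∫⁻ x in Metric.ball (0 : Plane) R, ‖c n x‖ₑ ^ 2 := by
          rw [lintegral_add_right _ (((hcc n).enorm.measurable.pow_const 2).const_mul 2),
            lintegral_const_mul' _ _ (by norm_num), lintegral_const_mul' _ _ (by norm_num)]
      _ ≤ _ := by
          gcongr
          exact (setLIntegral_le_lintegral _ _).trans (hmol n)
  -- Mollification error, mollified function on the ball, and tail, the first two doubled by `|a -
  -- b|² ≤ 2|a|² + 2|b|²`.
  calc _ ≤ 2 * (ε / 4) + 2 * (ε / 8) + ε / 4 := add_le_add hsplit (hR n)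
    _ = ε := by
      have e1 : ε / 4 = 2 * (ε / 8) := by
        rw [← mul_div_assoc, mul_comm, ENNReal.div_eq_div_iff] <;> try norm_num
        ring
      have e2 : 2 * (ε / 8) = ε / 4 := e1.symm
      rw [e2]
      have : 2 * (ε / 4) + ε / 4 + ε / 4 = 4 * (ε / 4) := by ring
      rw [this, ENNReal.mul_div_cancel (by norm_num) (by norm_num)]

/-! ### Weak convergence, extraction of subsequences and lower semicontinuity -/

/-- Bounded sequences in `L²` have weakly convergent subsequences. -/
theorem exists_weak_subseq {f : ℕ → Plane → ℂ} (hf : ∀ n, MemLp (f n) 2 volume) {K : ℝ≥0}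
    (hK : ∀ n, eLpNorm (f n) 2 volume ≤ K) :
    ∃ (f₀ : Plane → ℂ) (φ : ℕ → ℕ), MemLp f₀ 2 volume ∧ StrictMono φ ∧
      ∀ h : Plane → ℂ, MemLp h 2 volume →
        Tendsto (fun n => ∫ x, f (φ n) x * h x) atTop (𝓝 (∫ x, f₀ x * h x)) := by
  have : Fact ((2 : ℝ≥0∞) ≠ ⊤) := ⟨by norm_num⟩
  have hsep : TopologicalSpace.SeparableSpace (Lp ℂ 2 (volume : Measure Plane)) := inferInstance
  let H := Lp ℂ 2 (volume : Measure Plane)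
  let F : ℕ → H := fun n => (hf n).toLp (f n)
  let ψ : ℕ → WeakDual ℂ H := fun n => StrongDual.toWeakDual (InnerProductSpace.toDual ℂ H (F n))
  have hψ : ∀ n, ψ n ∈ WeakDual.toStrongDual ⁻¹' Metric.closedBall (0 : StrongDual ℂ H) K := by
    intro n
    simp only [Set.mem_preimage, mem_closedBall_zero_iff]
    change ‖InnerProductSpace.toDual ℂ H (F n)‖ ≤ K
    rw [LinearIsometryEquiv.norm_map, Lp.norm_toLp]
    exact ENNReal.toReal_le_of_le_ofReal K.2 (by simpa using hK n)
  -- Sequential Banach–Alaoglu for the separable space `L²`; the Riesz isomorphism carries the limit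
  -- back to a function.
  obtain ⟨ψ₀, -, φ, hφ, hlim⟩ := WeakDual.isSeqCompact_closedBall ℂ (Lp ℂ 2 (volume : Measure Plane)) 0 K hψ
  let F₀ : H := (InnerProductSpace.toDual ℂ H).symm (WeakDual.toStrongDual ψ₀)
  refine ⟨F₀, φ, Lp.memLp F₀, hφ, fun h hh => ?_⟩
  -- The inner product conjugates its first entry, so testing with `conj h` gives the conjugate of
  -- the bilinear pairing `∫ f h`.
  have hhc : MemLp (fun x => conj (h x)) 2 volume := hh.star
  have h1 : Tendsto (fun n => ψ (φ n) (hhc.toLp _)) atTop (𝓝 (ψ₀ (hhc.toLp _))) :=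
    (WeakDual.eval_continuous (hhc.toLp _)).tendsto ψ₀ |>.comp hlim
  have e : ∀ (a : H) (a' : Plane → ℂ), a =ᵐ[volume] a' →
      InnerProductSpace.toDual ℂ H a (hhc.toLp _) = conj (∫ x, a' x * h x) := by
    intro a a' ha
    rw [InnerProductSpace.toDual_apply_apply, L2.inner_def, ← integral_conj]
    refine integral_congr_ae ?_
    filter_upwards [ha, hhc.coeFn_toLp] with x hx1 hx2
    rw [hx1, hx2]
    simp [mul_comm]
  have e1 : ∀ n, ψ (φ n) (hhc.toLp _) = conj (∫ x, f (φ n) x * h x) := fun n =>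
    e (F (φ n)) _ (hf _).coeFn_toLp
  have e0 : ψ₀ (hhc.toLp _) = conj (∫ x, F₀ x * h x) := by
    rw [← e F₀ F₀ (ae_eq_refl _)]
    simp only [F₀, LinearIsometryEquiv.apply_symm_apply]
    rfl
  rw [e0] at h1
  simp only [e1] at h1
  have h2 := (Complex.continuous_conj.tendsto _).comp h1
  simpa [Function.comp_def] using h2

/-- Weak convergence in `L²`. -/
def WeaklyTendsto (f : ℕ → Plane → ℂ) (f₀ : Plane → ℂ) : Prop :=
  ∀ h : Plane → ℂ, MemLp h 2 volume →
    Tendsto (fun n => ∫ x, f n x * h x) atTop (𝓝 (∫ x, f₀ x * h x))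

theorem WeaklyTendsto.comp {f : ℕ → Plane → ℂ} {f₀ : Plane → ℂ} (hf : WeaklyTendsto f f₀)
    {φ : ℕ → ℕ} (hφ : StrictMono φ) : WeaklyTendsto (fun n => f (φ n)) f₀ :=
  fun h hh => (hf h hh).comp hφ.tendsto_atTop

theorem integrable_mul_of_memLp_two {f h : Plane → ℂ} (hf : MemLp f 2 volume)
    (hh : MemLp h 2 volume) : Integrable (fun x => f x * h x) :=
  hf.integrable_mul hh

theorem enorm_sub_sq_le (a b : ℂ) : ‖a - b‖ₑ ^ 2 ≤ 2 * ‖a‖ₑ ^ 2 + 2 * ‖b‖ₑ ^ 2 := by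
  have h1 : ‖a - b‖ ^ 2 ≤ 2 * ‖a‖ ^ 2 + 2 * ‖b‖ ^ 2 := by
    nlinarith [norm_sub_le a b, norm_nonneg (a - b), sq_nonneg (‖a‖ - ‖b‖)]
  have h3 := ENNReal.ofReal_le_ofReal h1
  rw [ENNReal.ofReal_add (by positivity) (by positivity),
    ENNReal.ofReal_mul (by norm_num), ENNReal.ofReal_mul (by norm_num),
    ENNReal.ofReal_pow (norm_nonneg _), ENNReal.ofReal_pow (norm_nonneg _),
    ENNReal.ofReal_pow (norm_nonneg _), ofReal_norm, ofReal_norm, ofReal_norm] at h3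
  simpa using h3

theorem lintegral_enorm_sub_sq_le {f h : Plane → ℂ} (hf : AEStronglyMeasurable f volume)
    (s : Set Plane) :
    ∫⁻ x in s, ‖f x - h x‖ₑ ^ 2 ≤ 2 * (∫⁻ x in s, ‖f x‖ₑ ^ 2) + 2 * ∫⁻ x in s, ‖h x‖ₑ ^ 2 := by
  rw [← lintegral_const_mul' _ _ (by norm_num), ← lintegral_const_mul' _ _ (by norm_num),
    ← lintegral_add_left' ((hf.restrict.enorm.pow_const 2).const_mul 2)]
  exact lintegral_mono fun x => enorm_sub_sq_le _ _

theorem IsWeakGradient.sub {u v : Plane → ℂ} {G H : Fin 2 → Plane → ℂ} (hu : MemLp u 2 volume)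
    (hv : MemLp v 2 volume) (hG : IsWeakGradient u G) (hH : IsWeakGradient v H) :
    IsWeakGradient (fun x => u x - v x) (fun i x => G i x - H i x) := by
  intro i
  refine ⟨(hG i).1.sub (hH i).1, fun φ hφ hc => ?_⟩
  have hφ' : Continuous (partialDeriv i φ) :=
    (hφ.continuous_fderiv (by simp)).clm_apply continuous_const
  have hc' : HasCompactSupport (partialDeriv i φ) := hc.fderiv_apply (𝕜 := ℝ) _
  simp only [smul_sub]
  rw [integral_sub (integrable_smul_of_memLp hφ' hc' hu) (integrable_smul_of_memLp hφ' hc' hv),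
    integral_sub (integrable_smul_of_memLp hφ.continuous hc (hG i).1)
      (integrable_smul_of_memLp hφ.continuous hc (hH i).1), (hG i).2 φ hφ hc, (hH i).2 φ hφ hc]
  ring

/-- Both sides of the defining identity are pairings with fixed `L²` functions, hence stable under
weak limits. -/
theorem IsWeakGradient.of_weaklyTendsto {u : ℕ → Plane → ℂ} {u₀ : Plane → ℂ}
    {G : ℕ → Fin 2 → Plane → ℂ} {G₀ : Fin 2 → Plane → ℂ} (hG : ∀ n, IsWeakGradient (u n) (G n))
    (hG₀ : ∀ i, MemLp (G₀ i) 2 volume) (h : WeaklyTendsto u u₀)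
    (hi : ∀ i, WeaklyTendsto (fun n => G n i) (G₀ i)) : IsWeakGradient u₀ G₀ := by
  intro i
  refine ⟨hG₀ i, fun φ hφ hc => ?_⟩
  have hφ' : Continuous (partialDeriv i φ) :=
    (hφ.continuous_fderiv (by simp)).clm_apply continuous_const
  have hc' : HasCompactSupport (partialDeriv i φ) := hc.fderiv_apply (𝕜 := ℝ) _
  have key : ∀ (χ : Plane → ℝ) (f : ℕ → Plane → ℂ) (f₀ : Plane → ℂ), Continuous χ →
      HasCompactSupport χ → WeaklyTendsto f f₀ →
      Tendsto (fun n => ∫ x, χ x • f n x) atTop (𝓝 (∫ x, χ x • f₀ x)) := by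
    intro χ f f₀ hχ hχc hf
    have hs : HasCompactSupport fun x => (χ x : ℂ) := hχc.comp_left Complex.ofReal_zero
    have := hf (fun x => (χ x : ℂ))
      ((Complex.continuous_ofReal.comp hχ).memLp_of_hasCompactSupport hs)
    simpa only [Complex.real_smul, mul_comm] using this
  have h1 := key _ _ _ hφ' hc' h
  have h2 := (key _ _ _ hφ.continuous hc (hi i)).neg
  exact tendsto_nhds_unique (h1.congr fun n => (hG n i).2 φ hφ hc) h2

/-- A tight sequence bounded in `H¹` has a subsequence converging in `L²` and weakly in `H¹`. -/
theorem exists_strong_subseq {u : ℕ → Plane → ℂ} {G : ℕ → Fin 2 → Plane → ℂ}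
    (hu : ∀ n, MemLp (u n) 2 volume) (hG : ∀ n, IsWeakGradient (u n) (G n)) {K : ℝ≥0}
    (huK : ∀ n, eLpNorm (u n) 2 volume ≤ K) (hGK : ∀ n i, eLpNorm (G n i) 2 volume ≤ K)
    (htight : ∀ ε : ℝ≥0∞, 0 < ε → ∃ R : ℝ, ∀ n,
      ∫⁻ x in (Metric.ball (0 : Plane) R)ᶜ, ‖u n x‖ₑ ^ 2 ≤ ε) :
    ∃ (u₀ : Plane → ℂ) (G₀ : Fin 2 → Plane → ℂ) (φ : ℕ → ℕ), MemLp u₀ 2 volume ∧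
      IsWeakGradient u₀ G₀ ∧ StrictMono φ ∧
      Tendsto (fun n => eLpNorm (fun x => u (φ n) x - u₀ x) 2 volume) atTop (𝓝 0) ∧
      ∀ i, WeaklyTendsto (fun n => G (φ n) i) (G₀ i) := by
  obtain ⟨u₀, a, hu₀, ha, hua⟩ := exists_weak_subseq hu huK
  obtain ⟨g₀, b, hg₀, hb, hgb⟩ := exists_weak_subseq (f := fun n => G (a n) 0)
    (fun n => (hG _ 0).1) (fun n => hGK _ 0)
  obtain ⟨g₁, c, hg₁, hc, hgc⟩ := exists_weak_subseq (f := fun n => G (a (b n)) 1)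
    (fun n => (hG _ 1).1) (fun n => hGK _ 1)
  have hφ : StrictMono (a ∘ b ∘ c) := ha.comp (hb.comp hc)
  have hw : WeaklyTendsto (fun n => u ((a ∘ b ∘ c) n)) u₀ :=
    WeaklyTendsto.comp (f := fun n => u (a n)) hua (hb.comp hc)
  have hwG : ∀ i, WeaklyTendsto (fun n => G ((a ∘ b ∘ c) n) i) (![g₀, g₁] i) := by
    intro i
    fin_cases i
    · exact WeaklyTendsto.comp (f := fun n => G (a (b n)) 0) hgb hc
    · exact hgc
  have hm : ∀ i, MemLp (![g₀, g₁] i) 2 volume := by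
    intro i
    fin_cases i
    · exact hg₀
    · exact hg₁
  generalize a ∘ b ∘ c = φ at hφ hw hwG
  generalize ![g₀, g₁] = G₀ at hwG hm
  have hG₀ : IsWeakGradient u₀ G₀ := .of_weaklyTendsto (fun n => hG (φ n)) hm hw hwG
  refine ⟨u₀, G₀, φ, hu₀, hG₀, hφ, ?_, hwG⟩
  have hsq : ∀ {f : Plane → ℂ}, MemLp f 2 volume → ∫⁻ x, ‖f x‖ₑ ^ 2 ≠ ⊤ := fun hf => by
    rw [← eLpNorm_two_sq]; exact ENNReal.pow_ne_top hf.2.ne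
  have hKsq : ∀ {f : Plane → ℂ}, eLpNorm f 2 volume ≤ K → ∫⁻ x, ‖f x‖ₑ ^ 2 ≤ (K : ℝ≥0∞) ^ 2 :=
    fun hf => by rw [← eLpNorm_two_sq]; gcongr
  have hsub : ∀ (f h : Plane → ℂ), AEStronglyMeasurable f volume →
      ∫⁻ x, ‖f x - h x‖ₑ ^ 2 ≤ 2 * (∫⁻ x, ‖f x‖ₑ ^ 2) + 2 * ∫⁻ x, ‖h x‖ₑ ^ 2 := fun f h hf => by
    simpa using lintegral_enorm_sub_sq_le (h := h) hf Set.univ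
  let A : ℝ≥0∞ := 2 * (K : ℝ≥0∞) ^ 2 + 2 * ∫⁻ x, ‖u₀ x‖ₑ ^ 2
  let B : ℝ≥0∞ := ∑ i, (2 * (K : ℝ≥0∞) ^ 2 + 2 * ∫⁻ x, ‖G₀ i x‖ₑ ^ 2)
  have hA : A ≠ ⊤ := ENNReal.add_ne_top.2 ⟨ENNReal.mul_ne_top (by norm_num)
    (ENNReal.pow_ne_top ENNReal.coe_ne_top), ENNReal.mul_ne_top (by norm_num) (hsq hu₀)⟩
  have hB : B ≠ ⊤ := ENNReal.sum_ne_top.2 fun i _ => ENNReal.add_ne_top.2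
    ⟨ENNReal.mul_ne_top (by norm_num) (ENNReal.pow_ne_top ENNReal.coe_ne_top),
      ENNReal.mul_ne_top (by norm_num) (hsq (hm i))⟩
  have hlim := tendsto_eLpNorm_zero_of_weak (w := fun n x => u (φ n) x - u₀ x)
    (H := fun n i x => G (φ n) i x - G₀ i x) (K := (A + B).toNNReal)
    (fun n => (hu _).sub hu₀) (fun n => (hG _).sub (hu _) hu₀ hG₀) (fun n => ?_) (fun n => ?_)
    (fun ε hε => ?_) (fun h hh => ?_)
  · simp only [← eLpNorm_two_sq] at hlim
    have h2 := hlim.ennrpow_const (1 / 2 : ℝ)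
    rw [ENNReal.zero_rpow_of_pos (by norm_num)] at h2
    refine h2.congr fun n => ?_
    rw [← ENNReal.rpow_natCast, ← ENNReal.rpow_mul]
    norm_num
  · rw [ENNReal.coe_toNNReal (ENNReal.add_ne_top.2 ⟨hA, hB⟩)]
    refine ((hsub _ _ (hu _).1).trans ?_).trans le_self_add
    exact add_le_add_left (mul_le_mul_right (hKsq (huK _)) 2) _
  · rw [ENNReal.coe_toNNReal (ENNReal.add_ne_top.2 ⟨hA, hB⟩),
      lintegral_finsetSum' (f := fun i x => ‖G (φ n) i x - G₀ i x‖ₑ ^ 2) _ fun i _ => ((hG (φ n) i).1.1.sub (hm i).1).enorm.pow_const 2]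
    refine (Finset.sum_le_sum fun i _ => ?_).trans le_add_self
    refine (hsub _ _ (hG _ i).1.1).trans ?_
    exact add_le_add_left (mul_le_mul_right (hKsq (hGK _ i)) 2) _
  · have hε4 : 0 < ε / 4 := by
      rw [ENNReal.div_pos_iff]; exact ⟨hε.ne', by norm_num⟩
    obtain ⟨R, hR⟩ := htight (ε / 4) hε4
    have htail : Tendsto (fun n : ℕ => ∫⁻ x in (Metric.ball (0 : Plane) n)ᶜ, ‖u₀ x‖ₑ ^ 2) atTop
        (𝓝 0) := by
      have hms : ∀ n : ℕ, MeasurableSet (Metric.ball (0 : Plane) n)ᶜ :=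
        fun n => measurableSet_ball.compl
      -- The tail of the limit vanishes by continuity from above of the finite measure `|u₀|² dx`.
      have h1 := tendsto_measure_iInter_atTop (μ := volume.withDensity fun x => ‖u₀ x‖ₑ ^ 2)
        (s := fun n : ℕ => (Metric.ball (0 : Plane) n)ᶜ) (fun n => (hms n).nullMeasurableSet)
        (fun n m hnm => Set.compl_subset_compl.2 (Metric.ball_subset_ball (by exact_mod_cast hnm)))
        ⟨0, by rw [withDensity_apply _ (hms 0)]
               exact ((setLIntegral_le_lintegral _ _).trans_lt (hsq hu₀).lt_top).ne⟩
      rw [← Set.compl_iUnion, Metric.iUnion_ball_nat, Set.compl_univ, measure_empty] at h1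
      exact h1.congr fun n => withDensity_apply _ (hms n)
    obtain ⟨n, hn1, hn2⟩ := ((htail.eventually_le_const hε4).and
      (eventually_ge_atTop ⌈R⌉₊)).exists
    refine ⟨n, fun m => (lintegral_enorm_sub_sq_le (hu _).1 _).trans ?_⟩
    have hRn : R ≤ n := (Nat.le_ceil R).trans (by exact_mod_cast hn2)
    calc _ ≤ 2 * (ε / 4) + 2 * (ε / 4) := by
          gcongr
          refine le_trans (lintegral_mono_set ?_) (hR (φ m))
          exact Set.compl_subset_compl.2 (Metric.ball_subset_ball hRn)
      _ = 4 * (ε / 4) := by ring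
      _ = ε := ENNReal.mul_div_cancel (by norm_num) (by norm_num)
  · have h1 := (hw h hh).sub_const (∫ x, u₀ x * h x)
    rw [sub_self] at h1
    refine h1.congr fun n => ?_
    rw [← integral_sub (integrable_mul_of_memLp_two (hu _) hh)
      (integrable_mul_of_memLp_two hu₀ hh)]
    simp only [sub_mul]

/-- Weak lower semicontinuity of the squared `L²` norm. -/
theorem sum_integral_sq_le_of_weaklyTendsto {W : ℕ → Fin 2 → Plane → ℂ} {W₀ : Fin 2 → Plane → ℂ}
    (hW : ∀ n i, MemLp (W n i) 2 volume) (hW₀ : ∀ i, MemLp (W₀ i) 2 volume)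
    (hlim : ∀ i, WeaklyTendsto (fun n => W n i) (W₀ i)) {c : ℕ → ℝ} {c₀ : ℝ}
    (hc : Tendsto c atTop (𝓝 c₀)) (hle : ∀ n, ∑ i, ∫ x, ‖W n i x‖ ^ 2 ≤ c n) :
    ∑ i, ∫ x, ‖W₀ i x‖ ^ 2 ≤ c₀ := by
  have hint : ∀ {f : Plane → ℂ}, MemLp f 2 volume → Integrable fun x => ‖f x‖ ^ 2 :=
    fun hf => (memLp_natCast_iff (n := 2) (by norm_num) hf.1).1 hf
  have hconj : ∀ i, MemLp (fun x => conj (W₀ i x)) 2 volume := fun i => (hW₀ i).star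
  -- Expanding `|W - W₀|² ≥ 0` bounds the norm below by an expression affine in `W`, which passes to
  -- the weak limit.
  have h1 : ∀ n i, 2 * (∫ x, W n i x * conj (W₀ i x)).re - ∫ x, ‖W₀ i x‖ ^ 2 ≤
      ∫ x, ‖W n i x‖ ^ 2 := by
    intro n i
    have hi := integrable_mul_of_memLp_two (hW n i) (hconj i)
    have e := integral_re hi
    simp only [RCLike.re_to_complex] at e
    have hi2 : Integrable fun x => 2 * (W n i x * conj (W₀ i x)).re := hi.re.const_mul 2
    rw [← e, ← integral_const_mul, ← integral_sub hi2 (hint (hW₀ i))]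
    refine integral_mono (hi2.sub (hint (hW₀ i))) (hint (hW n i)) fun x => ?_
    simp only [← Complex.normSq_eq_norm_sq, Complex.normSq_apply, Complex.mul_re, Complex.conj_re,
      Complex.conj_im]
    nlinarith [sq_nonneg ((W n i x).re - (W₀ i x).re), sq_nonneg ((W n i x).im - (W₀ i x).im)]
  have h2 : Tendsto (fun n => ∑ i, (2 * (∫ x, W n i x * conj (W₀ i x)).re -
      ∫ x, ‖W₀ i x‖ ^ 2)) atTop (𝓝 (∑ i, ∫ x, ‖W₀ i x‖ ^ 2)) := by
    refine tendsto_finsetSum _ fun i _ => ?_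
    have h3 := (((Complex.continuous_re.tendsto _).comp (hlim i _ (hconj i))).const_mul 2).sub_const
      (∫ x, ‖W₀ i x‖ ^ 2)
    have e : ∫ x, W₀ i x * conj (W₀ i x) = ((∫ x, ‖W₀ i x‖ ^ 2 : ℝ) : ℂ) := by
      rw [← integral_complex_ofReal]
      refine integral_congr_ae (Eventually.of_forall fun x => ?_)
      simp [Complex.mul_conj, Complex.normSq_eq_norm_sq]
    rw [e, Complex.ofReal_re] at h3
    have e2 : ∀ a : ℝ, 2 * a - a = a := fun a => by ring
    rwa [e2] at h3
  exact le_of_tendsto_of_tendsto h2 hc (Eventually.of_forall fun n =>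
    (Finset.sum_le_sum fun i _ => h1 n i).trans (hle n))

/-! ### The trapping potential and coercivity -/

section Potential

variable {V : Plane → ℝ}

theorem aestronglyMeasurable_of_locally_bounded
    (hVloc : ∀ K : Set Plane, IsCompact K → MemLp V ⊤ (volume.restrict K)) :
    AEStronglyMeasurable V volume := by
  have h : AEMeasurable V (volume.restrict (⋃ n : ℕ, Metric.closedBall (0 : Plane) n)) :=
    aemeasurable_iUnion_iff.2 fun n =>
      (hVloc _ (isCompact_closedBall 0 (n : ℝ))).1.aemeasurable
  rw [Metric.iUnion_closedBall_nat, Measure.restrict_univ] at h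
  exact h.aestronglyMeasurable

theorem exists_ae_abs_le_of_isCompact
    (hVloc : ∀ K : Set Plane, IsCompact K → MemLp V ⊤ (volume.restrict K)) {K : Set Plane}
    (hK : IsCompact K) : ∃ C : ℝ, 0 ≤ C ∧ ∀ᵐ x, x ∈ K → |V x| ≤ C := by
  have h := hVloc K hK
  refine ⟨(eLpNormEssSup V (volume.restrict K)).toReal, ENNReal.toReal_nonneg, ?_⟩
  have h2 := h.2
  rw [eLpNorm_exponent_top] at h2
  rw [← ae_restrict_iff' hK.measurableSet]
  filter_upwards [ae_le_eLpNormEssSup (f := V) (μ := volume.restrict K)] with x hx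
  have := ENNReal.toReal_mono h2.ne hx
  simpa using this

/-- The filter `cocompact ⊓ ae` encodes divergence at infinity up to null sets; the exceptional
compact set fits in a ball. -/
theorem exists_ae_ge_outside_ball (hVinf : Tendsto V (cocompact Plane ⊓ ae volume) atTop)
    (Λ : ℝ) : ∃ R : ℝ, ∀ᵐ x, x ∉ Metric.ball (0 : Plane) R → Λ ≤ V x := by
  have h := hVinf.eventually (eventually_ge_atTop Λ)
  obtain ⟨s, hs, t, ht, hst⟩ := mem_inf_iff_superset.1 h
  obtain ⟨K, hK, hKs⟩ := mem_cocompact.1 hs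
  obtain ⟨R, hR⟩ := hK.isBounded.subset_ball (0 : Plane)
  refine ⟨R, ?_⟩
  filter_upwards [ht] with x hx hxR
  exact hst ⟨hKs fun h => hxR (hR h), hx⟩

theorem exists_ae_ge (hVloc : ∀ K : Set Plane, IsCompact K → MemLp V ⊤ (volume.restrict K))
    (hVinf : Tendsto V (cocompact Plane ⊓ ae volume) atTop) :
    ∃ C : ℝ, 0 ≤ C ∧ ∀ᵐ x, 0 ≤ V x + C := by
  obtain ⟨R, hR⟩ := exists_ae_ge_outside_ball hVinf 0
  obtain ⟨C, hC0, hC⟩ := exists_ae_abs_le_of_isCompact hVloc (isCompact_closedBall (0 : Plane) R)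
  refine ⟨C, hC0, ?_⟩
  filter_upwards [hR, hC] with x h1 h2
  by_cases hx : x ∈ Metric.ball (0 : Plane) R
  · linarith [neg_abs_le (V x), h2 (Metric.ball_subset_closedBall hx)]
  · linarith [h1 hx]

theorem exists_admissible
    (hVloc : ∀ K : Set Plane, IsCompact K → MemLp V ⊤ (volume.restrict K)) :
    ∃ u, Admissible V u := by
  obtain ⟨v, hv, h1⟩ := exists_isTest_normalized
  refine ⟨v, hv.memH1, ⟨hv.memLp 2, ?_⟩, h1⟩
  obtain ⟨C, -, hC⟩ := exists_ae_abs_le_of_isCompact hVloc hv.hasCompactSupport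
  have hi := integrable_norm_pow_of_le_eight (hv.memLp 2) (hv.memLp 8) (n := 2) le_rfl
    (by norm_num)
  refine (hi.const_mul C).mono' ((aestronglyMeasurable_of_locally_bounded hVloc).mul hi.1) ?_
  filter_upwards [hC] with x hx
  rw [norm_mul, norm_pow, norm_norm, Real.norm_eq_abs]
  by_cases hxs : x ∈ tsupport v
  · gcongr
    exact hx hxs
  · simp [image_eq_zero_of_notMem_tsupport hxs]

end Potential

/-! ### Energy decomposition, coercivity and limits of the energy terms -/

theorem integrable_normSq {u : Plane → ℂ} (hu : MemLp u 2 volume) :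
    Integrable (fun x => ‖u x‖ ^ 2) :=
  (memLp_natCast_iff (n := 2) (by norm_num) hu.1).1 hu

theorem energy_eq {V : Plane → ℝ} {β g : ℝ} {u : Plane → ℂ} {G : Fin 2 → Plane → ℂ}
    (hu : MemL2V V u) (hG : IsWeakGradient u G) :
    energy V β g u = kinEnergy β u G + (∫ x, V x * ‖u x‖ ^ 2) - g / 2 * ∫ x, ‖u x‖ ^ 4 := by
  have hK : Integrable (kineticDensity β u) :=
    (integrable_sum_magGrad_sq hu.1 hG β).congr (kineticDensity_ae_eq hG β).symm
  have h4 := integrable_norm_pow_of_le_eight hu.1 (hG.memLp_eight hu.1) (n := 4) (by norm_num)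
    (by norm_num)
  have hKV : Integrable fun x => kineticDensity β u x + V x * ‖u x‖ ^ 2 := hK.add hu.2
  rw [energy, integral_sub hKV (h4.const_mul _), integral_add hK hu.2,
    integral_const_mul, integral_kineticDensity hG β]

/-- For `g ≤ 0` the quartic term helps and `κ = 1`. Otherwise `g / gStar β` times the defining
inequality of `gStar` absorbs it, leaving `κ = 1 - g / gStar β`. -/
theorem exists_coercive {β g : ℝ} (hg : g < gStar β) : ∃ κ : ℝ, 0 < κ ∧
    ∀ (u : Plane → ℂ) (G : Fin 2 → Plane → ℂ), MemLp u 2 volume → IsWeakGradient u G →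
      ∫ x, ‖u x‖ ^ 2 = 1 → κ * kinEnergy β u G ≤ kinEnergy β u G - g / 2 * ∫ x, ‖u x‖ ^ 4 := by
  rcases le_or_gt g 0 with h | h
  · refine ⟨1, one_pos, fun u G _ _ _ => ?_⟩
    have p4 : 0 ≤ ∫ x, ‖u x‖ ^ 4 := integral_nonneg fun x => by positivity
    nlinarith
  · have hs : 0 < gStar β := h.trans hg
    refine ⟨1 - g / gStar β, by rw [sub_pos, div_lt_one hs]; exact hg, fun u G hu hG h1 => ?_⟩
    have h2 := mul_le_mul_of_nonneg_left (gStar_le (β := β) hu hG h1) (div_nonneg h.le hs.le)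
    have e : g / gStar β * (gStar β / 2 * ∫ x, ‖u x‖ ^ 4) = g / 2 * ∫ x, ‖u x‖ ^ 4 := by
      field_simp
    rw [e] at h2
    linarith

theorem exists_vecPot_uniform_bound : ∃ I : ℝ, ∀ (u : Plane → ℂ), MemLp u 2 volume →
    MemLp u 8 volume → ∀ x, ‖vecPot (fun y => ‖u y‖ ^ 2) x‖ ≤
      (∫ y, ‖u y‖ ^ 2) + (∫ y, ‖u y‖ ^ 8) + I := by
  obtain ⟨I, -, hI⟩ := exists_vecPot_bound
  refine ⟨I, fun u h2 h8 x => ?_⟩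
  obtain ⟨i2, i8⟩ := normSq_integrable h2 h8
  have h := (hI _ i2 i8 x).2 1 one_pos le_rfl
  simpa [← pow_mul] using h

theorem eLpNorm_magGrad_sq_le {u : Plane → ℂ} {G : Fin 2 → Plane → ℂ} (hu : MemLp u 2 volume)
    (hG : IsWeakGradient u G) (β : ℝ) (i : Fin 2) :
    eLpNorm (magGrad β u G i) 2 volume ≤ ENNReal.ofReal √(kinEnergy β u G) := by
  have h : eLpNorm (magGrad β u G i) 2 volume ^ 2 ≤ ENNReal.ofReal √(kinEnergy β u G) ^ 2 := by
    rw [eLpNorm_two_sq, ← ENNReal.ofReal_pow (Real.sqrt_nonneg _),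
      Real.sq_sqrt (kinEnergy_nonneg _ _ _), ofReal_kinEnergy hu hG β]
    exact lintegral_mono fun x => Finset.single_le_sum (f := fun i => ‖magGrad β u G i x‖ₑ ^ 2)
      (fun _ _ => zero_le) (Finset.mem_univ i)
  exact (ENNReal.pow_le_pow_left_iff two_ne_zero).1 h

/-- The ordinary gradient is, up to the factor `-i`, the magnetic one minus `β 𝐀 u`, and `u` has
unit mass. -/
theorem eLpNorm_weakGradient_le {u : Plane → ℂ} {G : Fin 2 → Plane → ℂ} (hu : MemLp u 2 volume)
    (hG : IsWeakGradient u G) (h1 : ∫ x, ‖u x‖ ^ 2 = 1) (β : ℝ) {B : ℝ}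
    (hB : ∀ x, ‖vecPot (fun y => ‖u y‖ ^ 2) x‖ ≤ B) (i : Fin 2) :
    eLpNorm (G i) 2 volume ≤ ENNReal.ofReal (√(kinEnergy β u G) + |β| * B) := by
  have hB0 : 0 ≤ B := (norm_nonneg _).trans (hB 0)
  have hu1 : eLpNorm u 2 volume = 1 := by
    have h : eLpNorm u 2 volume ^ 2 = 1 := by
      rw [eLpNorm_two_sq, lintegral_enorm_pow_eq (integrable_normSq hu), h1, ENNReal.ofReal_one]
    exact le_antisymm ((ENNReal.pow_le_pow_left_iff two_ne_zero).1 (by rw [h, one_pow]))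
      ((ENNReal.pow_le_pow_left_iff two_ne_zero).1 (by rw [h, one_pow]))
  have hA : AEStronglyMeasurable
      (fun x => ((β * vecPot (fun y => ‖u y‖ ^ 2) x i : ℝ) : ℂ) * u x) volume :=
    (Complex.measurable_ofReal.comp_aemeasurable
      (aemeasurable_vecPot_coord hu.1 β i)).aestronglyMeasurable.mul hu.1
  have e : eLpNorm (G i) 2 volume = eLpNorm (magGrad β u G i -
      fun x => ((β * vecPot (fun y => ‖u y‖ ^ 2) x i : ℝ) : ℂ) * u x) 2 volume := by
    refine eLpNorm_congr_norm_ae (Eventually.of_forall fun x => ?_)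
    simp [magGrad]
  rw [e, ENNReal.ofReal_add (Real.sqrt_nonneg _) (by positivity)]
  refine (eLpNorm_sub_le (memLp_magGrad hu (hG.memLp_eight hu) (hG i).1).1 hA
    (by norm_num)).trans (add_le_add (eLpNorm_magGrad_sq_le hu hG β i) ?_)
  refine (eLpNorm_le_mul_eLpNorm_of_ae_le_mul (c := |β| * B) (g := u)
    (Eventually.of_forall fun x => ?_) 2).trans ?_
  · rw [norm_mul, Complex.norm_real, Real.norm_eq_abs, abs_mul]
    gcongr
    exact (abs_coord_le_norm _ i).trans (hB x)
  · rw [hu1, mul_one]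

/-- Mass outside large balls is controlled by the potential energy. -/
theorem tight_of_potential_bound {V : Plane → ℝ} {C M : ℝ}
    (hVinf : Tendsto V (cocompact Plane ⊓ ae volume) atTop)
    (hC : ∀ᵐ x, 0 ≤ V x + C) {u : ℕ → Plane → ℂ}
    (hui : ∀ n, Integrable fun x => (V x + C) * ‖u n x‖ ^ 2)
    (hM : ∀ n, ∫ x, (V x + C) * ‖u n x‖ ^ 2 ≤ M) {ε : ℝ≥0∞} (hε : 0 < ε) :
    ∃ R : ℝ, ∀ n, ∫⁻ x in (Metric.ball (0 : Plane) R)ᶜ, ‖u n x‖ₑ ^ 2 ≤ ε := by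
  obtain ⟨δ, hδ0, hδ⟩ : ∃ δ : ℝ, 0 < δ ∧ ENNReal.ofReal δ ≤ ε := by
    obtain ⟨δ, h1, h2⟩ := ENNReal.lt_iff_exists_nnreal_btwn.1 hε
    exact ⟨δ, by exact_mod_cast h1, by simpa using h2.le⟩
  have hM0 : 0 ≤ M := (integral_nonneg_of_ae (by
    filter_upwards [hC] with x hx
    exact mul_nonneg hx (by positivity))).trans (hM 0)
  -- Where `V + C ≥ Λ` the mass is at most `M / Λ`, hence below `δ`; the `+ 1` keeps `Λ` positive.
  set Λ : ℝ := (M + 1) / δ with hΛ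
  have hΛ0 : 0 < Λ := by positivity
  obtain ⟨R, hR⟩ := exists_ae_ge_outside_ball hVinf (Λ - C)
  refine ⟨R, fun n => ?_⟩
  calc ∫⁻ x in (Metric.ball (0 : Plane) R)ᶜ, ‖u n x‖ₑ ^ 2
      ≤ ∫⁻ x in (Metric.ball (0 : Plane) R)ᶜ,
          ENNReal.ofReal (Λ⁻¹ * ((V x + C) * ‖u n x‖ ^ 2)) := by
        refine lintegral_mono_ae ((ae_restrict_iff' measurableSet_ball.compl).2 ?_)
        filter_upwards [hR] with x hx hxR
        rw [← ofReal_norm, ← ENNReal.ofReal_pow (norm_nonneg _)]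
        refine ENNReal.ofReal_le_ofReal ?_
        have h2 : Λ ≤ V x + C := by linarith [hx hxR]
        rw [← mul_assoc]
        refine le_mul_of_one_le_left (by positivity) ?_
        rw [inv_mul_eq_div, one_le_div hΛ0]
        exact h2
    _ ≤ ∫⁻ x, ENNReal.ofReal (Λ⁻¹ * ((V x + C) * ‖u n x‖ ^ 2)) := setLIntegral_le_lintegral _ _
    _ = ENNReal.ofReal (∫ x, Λ⁻¹ * ((V x + C) * ‖u n x‖ ^ 2)) := by
        refine (ofReal_integral_eq_lintegral_ofReal ((hui n).const_mul _) ?_).symm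
        filter_upwards [hC] with x hx
        exact mul_nonneg (inv_nonneg.2 hΛ0.le) (mul_nonneg hx (by positivity))
    _ ≤ ENNReal.ofReal δ := by
        refine ENNReal.ofReal_le_ofReal ?_
        rw [integral_const_mul, inv_mul_eq_div, div_le_iff₀ hΛ0, hΛ, mul_div_cancel₀ _ hδ0.ne']
        linarith [hM n]
    _ ≤ ε := hδ

/-- Fatou's lemma for the potential energy along `L²` convergence. -/
theorem potential_le_of_tendsto {W : Plane → ℝ} (hW : AEStronglyMeasurable W volume)
    (hW0 : ∀ᵐ x, 0 ≤ W x) {u : ℕ → Plane → ℂ} {u₀ : Plane → ℂ}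
    (hu : ∀ n, AEStronglyMeasurable (u n) volume) (hu₀ : AEStronglyMeasurable u₀ volume)
    (hlim : Tendsto (fun n => eLpNorm (fun x => u n x - u₀ x) 2 volume) atTop (𝓝 0))
    (hui : ∀ n, Integrable fun x => W x * ‖u n x‖ ^ 2) {p : ℝ}
    (hp : Tendsto (fun n => ∫ x, W x * ‖u n x‖ ^ 2) atTop (𝓝 p)) :
    Integrable (fun x => W x * ‖u₀ x‖ ^ 2) ∧ ∫ x, W x * ‖u₀ x‖ ^ 2 ≤ p := by
  obtain ⟨ns, hns, hae⟩ := (tendstoInMeasure_of_tendsto_eLpNorm (by norm_num) hu hu₀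
    hlim).exists_seq_tendsto_ae
  have hnn : ∀ f : Plane → ℂ, 0 ≤ᵐ[volume] fun x => W x * ‖f x‖ ^ 2 := fun f => by
    filter_upwards [hW0] with x hx
    exact mul_nonneg hx (by positivity)
  have hm : ∀ {f : Plane → ℂ}, AEStronglyMeasurable f volume →
      AEStronglyMeasurable (fun x => W x * ‖f x‖ ^ 2) volume := fun hf => hW.mul (hf.norm.pow 2)
  have h : ∫⁻ x, ENNReal.ofReal (W x * ‖u₀ x‖ ^ 2) ≤ ENNReal.ofReal p := by
    calc ∫⁻ x, ENNReal.ofReal (W x * ‖u₀ x‖ ^ 2)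
        = ∫⁻ x, liminf (fun n => ENNReal.ofReal (W x * ‖u (ns n) x‖ ^ 2)) atTop := by
          refine lintegral_congr_ae ?_
          filter_upwards [hae] with x hx
          exact (ENNReal.tendsto_ofReal ((hx.norm.pow 2).const_mul (W x))).liminf_eq.symm
      _ ≤ liminf (fun n => ∫⁻ x, ENNReal.ofReal (W x * ‖u (ns n) x‖ ^ 2)) atTop :=
          lintegral_liminf_le' fun n => (hm (hu (ns n))).aemeasurable.ennreal_ofReal
      _ = liminf (fun n => ENNReal.ofReal (∫ x, W x * ‖u (ns n) x‖ ^ 2)) atTop := by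
          simp only [fun n => ofReal_integral_eq_lintegral_ofReal (hui n) (hnn (u n))]
      _ = ENNReal.ofReal p :=
          ((ENNReal.tendsto_ofReal hp).comp hns.tendsto_atTop).liminf_eq
  have hi : Integrable (fun x => W x * ‖u₀ x‖ ^ 2) :=
    ⟨hm hu₀, (hasFiniteIntegral_iff_ofReal (hnn u₀)).2 (h.trans_lt ENNReal.ofReal_lt_top)⟩
  refine ⟨hi, ?_⟩
  rw [← ofReal_integral_eq_lintegral_ofReal hi (hnn u₀)] at h
  have hp0 : 0 ≤ p := ge_of_tendsto' hp fun n => integral_nonneg_of_ae (hnn (u n))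
  exact (ENNReal.ofReal_le_ofReal_iff hp0).1 h

/-- Weak convergence of gradients and strong `L²` convergence give weak convergence of the
magnetic gradients. -/
theorem weaklyTendsto_magGrad {u : ℕ → Plane → ℂ} {u₀ : Plane → ℂ}
    {G : ℕ → Fin 2 → Plane → ℂ} {G₀ : Fin 2 → Plane → ℂ} (β : ℝ) (i : Fin 2)
    (hu : ∀ n, MemLp (u n) 2 volume) (hu₀ : MemLp u₀ 2 volume)
    (hG : ∀ n, IsWeakGradient (u n) (G n)) (hG₀ : IsWeakGradient u₀ G₀) {M : ℝ}
    (hM : ∀ n, ∫ x, ‖u n x‖ ^ 8 ≤ M)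
    (hlim : Tendsto (fun n => eLpNorm (fun x => u n x - u₀ x) 2 volume) atTop (𝓝 0))
    (hw : WeaklyTendsto (fun n => G n i) (G₀ i)) :
    WeaklyTendsto (fun n => magGrad β (u n) (G n) i) (magGrad β u₀ G₀ i) := by
  intro h hh
  have hu8 := fun n => (hG n).memLp_eight (hu n)
  have hu₀8 := hG₀.memLp_eight hu₀
  have hd := tendsto_eLpNorm_magGrad_sub_potential (G := G) (G₀ := G₀) β i hu hu₀ hu8 hu₀8 hM hlim
  have hm := fun n => memLp_magGrad (β := β) (i := i) (hu n) (hu8 n) (hG n i).1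
  have hm₀ := memLp_magGrad (β := β) (i := i) hu₀ hu₀8 (hG₀ i).1
  have hDmem : ∀ n, MemLp (fun x => (magGrad β (u n) (G n) i x - magGrad β u₀ G₀ i x)
      + Complex.I * (G n i x - G₀ i x)) 2 volume := fun n =>
    ((hm n).sub hm₀).add (((hG n i).1.sub (hG₀ i).1).const_mul _)
  have h1 : Tendsto (fun n => ∫ x, ((magGrad β (u n) (G n) i x - magGrad β u₀ G₀ i x)
      + Complex.I * (G n i x - G₀ i x)) * h x) atTop (𝓝 0) := by
    rw [tendsto_zero_iff_enorm_tendsto_zero]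
    have h2 := ENNReal.Tendsto.mul_const (b := eLpNorm h 2 volume) hd (Or.inr hh.2.ne)
    rw [zero_mul] at h2
    refine tendsto_of_tendsto_of_tendsto_of_le_of_le tendsto_const_nhds h2 (fun _ => zero_le)
      fun n => ?_
    refine (enorm_integral_le_lintegral_enorm _).trans ?_
    have h3 := eLpNorm_smul_le_mul_eLpNorm (p := 2) (q := 2) (r := 1) hh.1 (hDmem n).1
    rw [eLpNorm_one_eq_lintegral_enorm] at h3
    exact h3
  -- The potential part converges strongly; the weak convergence of gradients supplies the
  -- remainder.
  have h4 := (h1.sub (((hw h hh).sub_const (∫ x, G₀ i x * h x)).const_mul Complex.I)).add_const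
    (∫ x, magGrad β u₀ G₀ i x * h x)
  rw [sub_self, mul_zero, sub_zero, zero_add] at h4
  refine h4.congr fun n => ?_
  have iG := integrable_mul_of_memLp_two (hG n i).1 hh
  have iG₀ := integrable_mul_of_memLp_two (hG₀ i).1 hh
  have im := integrable_mul_of_memLp_two (hm n) hh
  have im₀ := integrable_mul_of_memLp_two hm₀ hh
  have e : ∫ x, ((magGrad β (u n) (G n) i x - magGrad β u₀ G₀ i x)
      + Complex.I * (G n i x - G₀ i x)) * h x =
      (∫ x, magGrad β (u n) (G n) i x * h x) - (∫ x, magGrad β u₀ G₀ i x * h x) +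
        Complex.I * ((∫ x, G n i x * h x) - ∫ x, G₀ i x * h x) := by
    rw [← integral_sub im im₀, ← integral_sub iG iG₀, ← integral_const_mul]
    refine (integral_congr_ae (Eventually.of_forall fun x => ?_)).trans
      (integral_add (im.sub im₀) ((iG.sub iG₀).const_mul Complex.I))
    change _ = magGrad β (u n) (G n) i x * h x - magGrad β u₀ G₀ i x * h x +
      Complex.I * (G n i x * h x - G₀ i x * h x)
    ring
  rw [e]
  ring

/-! ### Existence of minimizers -/

theorem kinEnergy_eq_sum {u : Plane → ℂ} {G : Fin 2 → Plane → ℂ} (hu : MemLp u 2 volume)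
    (hG : IsWeakGradient u G) (β : ℝ) :
    kinEnergy β u G = ∑ i, ∫ x, ‖magGrad β u G i x‖ ^ 2 :=
  integral_finsetSum _ fun i _ =>
    integrable_normSq (memLp_magGrad hu (hG.memLp_eight hu) (hG i).1)

/-- `H¹` bounds for normalized functions of bounded kinetic energy. -/
theorem exists_H1_bounds (β K : ℝ) : ∃ (M : ℝ) (B : ℝ≥0), ∀ (u : Plane → ℂ)
    (G : Fin 2 → Plane → ℂ), MemLp u 2 volume → IsWeakGradient u G → ∫ x, ‖u x‖ ^ 2 = 1 →
    kinEnergy β u G ≤ K → ∫ x, ‖u x‖ ^ 8 ≤ M ∧ eLpNorm u 2 volume ≤ B ∧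
      ∀ i, eLpNorm (G i) 2 volume ≤ B := by
  obtain ⟨C, hC, hS⟩ := exists_sobolev_H1
  obtain ⟨I, hI⟩ := exists_vecPot_uniform_bound
  -- The `L⁴` bound for unit mass, inserted into the `L⁸` bound.
  let M : ℝ := C * (C * 1 * K) * K ^ 2
  refine ⟨M, max 1 (√K + |β| * (1 + M + I)).toNNReal, fun u G hu hG h1 hK => ?_⟩
  have hk := kinEnergy_nonneg β u G
  obtain ⟨s4, s8⟩ := hS β u G hu hG
  rw [h1] at s4
  have h8 : ∫ x, ‖u x‖ ^ 8 ≤ M := by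
    have p4 : 0 ≤ ∫ x, ‖u x‖ ^ 4 := integral_nonneg fun x => by positivity
    have h4 : ∫ x, ‖u x‖ ^ 4 ≤ C * 1 * K := s4.trans (by gcongr)
    have hK0 : 0 ≤ K := hk.trans hK
    refine s8.trans (mul_le_mul (mul_le_mul_of_nonneg_left h4 hC) ?_ (by positivity)
      (by positivity))
    gcongr
  refine ⟨h8, ?_, fun i => ?_⟩
  · have h : eLpNorm u 2 volume ^ 2 ≤ 1 ^ 2 := by
      rw [eLpNorm_two_sq, lintegral_enorm_pow_eq (integrable_normSq hu), h1, ENNReal.ofReal_one,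
        one_pow]
    refine ((ENNReal.pow_le_pow_left_iff two_ne_zero).1 h).trans ?_
    exact_mod_cast le_max_left _ _
  · have hB : ∀ x, ‖vecPot (fun y => ‖u y‖ ^ 2) x‖ ≤ 1 + M + I := fun x =>
      (hI u hu (hG.memLp_eight hu) x).trans (by rw [h1]; gcongr)
    refine (eLpNorm_weakGradient_le hu hG h1 β hB i).trans ?_
    refine (ENNReal.ofReal_le_ofReal (by gcongr :
      √(kinEnergy β u G) + |β| * (1 + M + I) ≤ √K + |β| * (1 + M + I))).trans ?_
    exact ENNReal.coe_le_coe.2 (le_max_right _ _)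

theorem integral_normSq_eq_of_tendsto {u : ℕ → Plane → ℂ} {u₀ : Plane → ℂ}
    (hu : ∀ n, MemLp (u n) 2 volume) (hu₀ : MemLp u₀ 2 volume)
    (h1 : ∀ n, ∫ x, ‖u n x‖ ^ 2 = 1)
    (hlim : Tendsto (fun n => eLpNorm (fun x => u n x - u₀ x) 2 volume) atTop (𝓝 0)) :
    ∫ x, ‖u₀ x‖ ^ 2 = 1 := by
  have h := tendsto_integral_abs_normSq_sub hu hu₀ hlim
  have h3 : Tendsto (fun n => ∫ x, ‖u n x‖ ^ 2) atTop (𝓝 (∫ x, ‖u₀ x‖ ^ 2)) := by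
    rw [tendsto_iff_dist_tendsto_zero]
    refine squeeze_zero (fun _ => dist_nonneg) (fun n => ?_) h
    rw [Real.dist_eq, ← integral_sub (integrable_normSq (hu n)) (integrable_normSq hu₀)]
    exact abs_integral_le_integral_abs
  exact tendsto_nhds_unique h3 (by simp only [h1]; exact tendsto_const_nhds)

/-- A minimizing sequence has bounded kinetic and potential energy by coercivity. The shift `C`
makes `V + C` nonnegative, which tightness and Fatou require; on normalized functions it only adds a
constant. -/
theorem exists_minimizer {V : Plane → ℝ}
    (hVloc : ∀ K : Set Plane, IsCompact K → MemLp V ⊤ (volume.restrict K))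
    (hVinf : Tendsto V (cocompact Plane ⊓ ae volume) atTop) {β g : ℝ} (hg : g < gStar β) :
    ∃ u, Admissible V u ∧ ∀ v, Admissible V v → energy V β g u ≤ energy V β g v := by
  obtain ⟨C, -, hC⟩ := exists_ae_ge hVloc hVinf
  obtain ⟨κ, hκ, hcoer⟩ := exists_coercive hg
  have hVm := aestronglyMeasurable_of_locally_bounded hVloc
  have hint : ∀ u, MemL2V V u → Integrable fun x => (V x + C) * ‖u x‖ ^ 2 := fun u hu => by
    simp only [add_mul]
    exact hu.2.add ((integrable_normSq hu.1).const_mul C)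
  have hpot : ∀ u, Admissible V u →
      ∫ x, (V x + C) * ‖u x‖ ^ 2 = (∫ x, V x * ‖u x‖ ^ 2) + C := fun u hu => by
    simp only [add_mul]
    rw [integral_add hu.2.1.2 ((integrable_normSq hu.2.1.1).const_mul C), integral_const_mul,
      hu.2.2, mul_one]
  have hpot0 : ∀ u : Plane → ℂ, 0 ≤ ∫ x, (V x + C) * ‖u x‖ ^ 2 := fun u =>
    integral_nonneg_of_ae (by filter_upwards [hC] with x hx; exact mul_nonneg hx (by positivity))
  have hbound : ∀ u G, Admissible V u → IsWeakGradient u G →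
      κ * kinEnergy β u G + ∫ x, (V x + C) * ‖u x‖ ^ 2 ≤ energy V β g u + C := fun u G hu hG => by
    rw [energy_eq hu.2.1 hG, hpot u hu]
    linarith [hcoer u G hu.1.1 hG hu.2.2]
  set S : Set ℝ := {e | ∃ u, Admissible V u ∧ energy V β g u = e} with hS
  have hne : S.Nonempty := let ⟨u, hu⟩ := exists_admissible hVloc; ⟨_, u, hu, rfl⟩
  have hbdd : BddBelow S := by
    refine ⟨-C, ?_⟩
    rintro _ ⟨u, hu, rfl⟩
    obtain ⟨G, hG⟩ := hu.1.2
    have := mul_nonneg hκ.le (kinEnergy_nonneg β u G)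
    linarith [hbound u G hu hG, hpot0 u]
  obtain ⟨e, he, hetend, heS⟩ := exists_seq_tendsto_sInf hne hbdd
  choose u hu hue using heS
  choose G hG using fun n => (hu n).1.2
  have hu2 := fun n => (hu n).1.1
  have henergy : ∀ n, energy V β g (u n) ≤ e 0 := fun n => by rw [hue]; exact he (zero_le)
  have hK : ∀ n, kinEnergy β (u n) (G n) ≤ (e 0 + C) / κ := fun n => by
    rw [le_div_iff₀ hκ]
    linarith [hbound _ _ (hu n) (hG n), hpot0 (u n), henergy n]
  have hP : ∀ n, ∫ x, (V x + C) * ‖u n x‖ ^ 2 ≤ e 0 + C := fun n => by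
    linarith [hbound _ _ (hu n) (hG n), mul_nonneg hκ.le (kinEnergy_nonneg β (u n) (G n)),
      henergy n]
  obtain ⟨M, B, hMB⟩ := exists_H1_bounds β ((e 0 + C) / κ)
  have hMB' := fun n => hMB (u n) (G n) (hu2 n) (hG n) (hu n).2.2 (hK n)
  obtain ⟨u₀, G₀, φ, hu₀, hG₀, hφ, hlim, hweak⟩ := exists_strong_subseq hu2 hG
    (fun n => (hMB' n).2.1) (fun n i => (hMB' n).2.2 i)
    (fun ε hε => tight_of_potential_bound hVinf hC (fun n => hint _ (hu n).2.1) hP hε)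
  -- Once the kinetic energies converge to some `k`, the energy identity forces the potential
  -- energies to converge as well.
  obtain ⟨k, -, ψ, hψ, hk⟩ := (isCompact_Icc (a := (0 : ℝ)) (b := (e 0 + C) / κ)).tendsto_subseq
    (x := fun n => kinEnergy β (u (φ n)) (G (φ n)))
    (fun n => ⟨kinEnergy_nonneg _ _ _, hK (φ n)⟩)
  have hlim' := hlim.comp hψ.tendsto_atTop
  have h4 := tendsto_integral_norm_pow_four (u := fun n => u (φ (ψ n))) (fun n => hu2 _) hu₀
    (fun n => (hG _).memLp_eight (hu2 _)) (hG₀.memLp_eight hu₀) (fun n => (hMB' _).1) hlim'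
  have hpk : Tendsto (fun n => ∫ x, (V x + C) * ‖u (φ (ψ n)) x‖ ^ 2) atTop
      (𝓝 (sInf S + g / 2 * (∫ x, ‖u₀ x‖ ^ 4) + C - k)) := by
    refine ((((hetend.comp (hφ.comp hψ).tendsto_atTop).add (h4.const_mul (g / 2))).add_const
      C).sub hk).congr fun n => ?_
    rw [hpot _ (hu _)]
    have := energy_eq (β := β) (g := g) (hu (φ (ψ n))).2.1 (hG (φ (ψ n)))
    rw [hue] at this
    simp only [Function.comp_apply]
    linarith
  obtain ⟨hi₀, hp₀⟩ := potential_le_of_tendsto (W := fun x => V x + C)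
    (hVm.add aestronglyMeasurable_const) hC (fun n => (hu2 _).1) hu₀.1 hlim'
    (fun n => hint _ (hu _).2.1) hpk
  have hk₀ : kinEnergy β u₀ G₀ ≤ k := by
    rw [kinEnergy_eq_sum hu₀ hG₀]
    refine sum_integral_sq_le_of_weaklyTendsto
      (W := fun n i => magGrad β (u (φ (ψ n))) (G (φ (ψ n))) i)
      (fun n i => memLp_magGrad (hu2 _) ((hG _).memLp_eight (hu2 _)) (hG _ i).1)
      (fun i => memLp_magGrad hu₀ (hG₀.memLp_eight hu₀) (hG₀ i).1)
      (fun i => weaklyTendsto_magGrad β i (fun n => hu2 _) hu₀ (fun n => hG _) hG₀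
        (fun n => (hMB' _).1) hlim' ((hweak i).comp hψ)) hk
      fun n => (kinEnergy_eq_sum (hu2 _) (hG _) β).symm.le
  have h1₀ : ∫ x, ‖u₀ x‖ ^ 2 = 1 := integral_normSq_eq_of_tendsto
    (fun n => hu2 (φ n)) hu₀ (fun n => (hu _).2.2) hlim
  have hV₀ : Integrable fun x => V x * ‖u₀ x‖ ^ 2 := by
    refine (hi₀.sub ((integrable_normSq hu₀).const_mul C)).congr
      (Eventually.of_forall fun x => ?_)
    simp only [Pi.sub_apply]
    ring
  have hadm : Admissible V u₀ := ⟨⟨hu₀, G₀, hG₀⟩, ⟨hu₀, hV₀⟩, h1₀⟩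
  -- The kinetic bound `k` and the potential bound, which contains `-k`, add up to the infimum. The
  -- quartic term is an exact limit, so the sign of `g` plays no role.
  refine ⟨u₀, hadm, fun v hv => le_trans ?_ (csInf_le hbdd ⟨v, hv, rfl⟩)⟩
  rw [energy_eq hadm.2.1 hG₀]
  have := hpot u₀ hadm
  linarith

end AfP

/-! ### The main theorem -/

theorem theorem1p1 (V : AfP.Plane → ℝ)
    (hVloc : ∀ K : Set AfP.Plane, IsCompact K → MemLp V ⊤ (volume.restrict K))
    (hVinf : Tendsto V (cocompact AfP.Plane ⊓ ae volume) atTop)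
    (β g : ℝ) (hβ : 0 ≤ β)
    (hg : g < AfP.gStar β ∨ (0 < β ∧ g = AfP.gStar 0)) :
    ∃ u : AfP.Plane → ℂ, AfP.MemH1 u ∧ AfP.MemL2V V u ∧ ∫ x, ‖u x‖ ^ 2 = 1 ∧
      (AfP.energy V β g u : EReal) = AfP.groundEnergy V β g := by
  have hg' : g < AfP.gStar β := by
    rcases hg with h | ⟨h, rfl⟩
    · exact h
    · exact AfP.gStar_zero_lt h
  obtain ⟨u, hu, hmin⟩ := AfP.exists_minimizer hVloc hVinf hg'
  -- Equality with a coerced real number also shows that the extended infimum is finite.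
  refine ⟨u, hu.1, hu.2.1, hu.2.2, le_antisymm ?_ (iInf₂_le u hu)⟩
  exact le_iInf₂ fun v hv => EReal.coe_le_coe_iff.2 (hmin v hv)
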